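/- Let $d\ge 1$, $\mathbb T^d=\mathbb R^d/\mathbb Z^d$. A *symplectic twist map* of $\mathbb T^d\times\mathbb R^d$ is a $C^1$ diffeomorphism $f$ of $\mathbb T^d\times\mathbb R^d$ having a lift $F(q,p)=(Q(q,p),P(q,p))$ to $\mathbb R^d\times\mathbb R^d$ such that $F(q+m,p)=F(q,p)+(m,0)$ for $m\in\mathbb Z^d$, the map $(q,p)\mapsto(q,Q(q,p))$ is a diffeomorphism of $\mathbb R^d\times\mathbb R^d$, and $F$ has a *generating function* $S:\mathbb R^d\times\mathbb R^d\to\mathbb R$, i.e. $S(q+m,Q+m)=S(q,Q)$ for $m\in\mathbb Z^d$ and $P\,dQ-p\,dq=dS(q,Q)$. Let $f$ be a symplectic twist map, $F$ a lift of $f$ and $S$ its generating function. Let $G\in C^2(\mathbb T^d)$ and consider symplectic twist maps $f_\varepsilon$, $\varepsilon\in\mathbb R$, with generating functions $S_\varepsilon(q,Q)=S(q,Q)+\varepsilon G(q)$; let $F_\varepsilon$ be a continuous family of lifts of $f_\varepsilon$. Assume: (i) $f$ is completely integrable: $f(q,p)=(q+\nabla\ell(p),p)$ for some $\ell\in C^2(\mathbb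 R^d,\mathbb R)$ such that $\nabla\ell$ is a $C^1$ diffeomorphism of $\mathbb R^d$; (ii) $f$ is strongly positive: $f$ has a $C^2$ generating function $S$, for which there are $\alpha,\beta>0$ with $-\beta\|v\|^2\le\partial^2_{q,Q}S(q,Q)(v,v)\le-\alpha\|v\|^2$ for all $q,Q,v\in\mathbb R^d$; (iii) $f$ has the analyticity property: there is a holomorphic diffeomorphism $\mathcal F=(Q,P)$ of $\mathbb C^d\times\mathbb C^d$ whose restriction to $\mathbb R^d\times\mathbb R^d$ is a lift of $f$, such that $(q,p)\mapsto(q,Q(q,p))$ is a diffeomorphism of $\mathbb C^d\times\mathbb C^d$ and there is $S:\mathbb C^d\times\mathbb C^d\to\mathbb C$ with $S(q+m,Q+m)=S(q,Q)$ for $m\in\mathbb Z^d$ and $P\,dQ-p\,dq=dS(q,Q)$; (iv) there are a basis $q_1,\dots,q_d$ of $\mathbb Q^d$ and nonempty open intervals $I_1,\dots,I_d\subset\mathbb R$ such that, for all $m\in\mathbb Z^d$ and $n\in\mathbb N^*$ with $\gcd(m_1,\dots,m_d,n)=1$ and $\frac mn\in\bigcup_{j=1}^d I_jq_j$, the number $0$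 is an accumulation point of the set of $\varepsilon\in\mathbb R$ for which $F_\varepsilon$ has a Lipschitz Lagrangian $(m,n)$-periodic graph, that is, there is a Lipschitz, $\mathbb Z^d$-periodic $\gamma:\mathbb R^d\to\mathbb R^d$ with $F_\varepsilon^n(q,\gamma(q))=(q+m,\gamma(q))$ for all $q\in\mathbb R^d$ and $\int_{\mathbb T}\gamma(\nu(t))\cdot\dot\nu(t)\,dt=0$ for every $C^1$ loop $\nu:\mathbb T\to\mathbb R^d$. Then $G$ is identically constant. -/

import Mathlib

open Filter Topology

/-- The torus `𝕋ᵈ = ℝᵈ / ℤᵈ`. -/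
abbrev Torus (d : ℕ) : Type := Fin d → UnitAddCircle

/-- The space `𝕜ᵈ × 𝕜ᵈ` of pairs `(q, p)`, for `𝕜 = ℝ` or `𝕜 = ℂ`. -/
abbrev PhaseSpace (𝕜 : Type) [RCLike 𝕜] (d : ℕ) : Type :=
  EuclideanSpace 𝕜 (Fin d) × EuclideanSpace 𝕜 (Fin d)

/-- The annulus `𝕋ᵈ × ℝᵈ`. -/
abbrev Annulus (d : ℕ) : Type := Torus d × EuclideanSpace ℝ (Fin d)

/-- The covering projection `ℝᵈ → 𝕋ᵈ`. -/
def torusProj {d : ℕ} (q : EuclideanSpace ℝ (Fin d)) : Torus d :=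
  fun i => (q i : UnitAddCircle)

/-- The integer vector `m ∈ ℤᵈ`, seen in `𝕜ᵈ`. -/
def intVec (𝕜 : Type) [RCLike 𝕜] {d : ℕ} (m : Fin d → ℤ) : EuclideanSpace 𝕜 (Fin d) :=
  WithLp.toLp 2 (fun i => (m i : 𝕜))

/-- `f` is a diffeomorphism of `X`: a bijection which is, with its inverse, of class `C¹` over `𝕜`.
For `𝕜 = ℂ` this says that `f` is a biholomorphism. -/
def IsDiffeo (𝕜 : Type) [RCLike 𝕜] {X : Type} [NormedAddCommGroup X] [NormedSpace 𝕜 X]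
    (f : X → X) : Prop :=
  ContDiff 𝕜 1 f ∧
    ∃ g : X → X, ContDiff 𝕜 1 g ∧ Function.LeftInverse g f ∧ Function.RightInverse g f

/-- The `𝕜`-linear form `v ↦ ∑ᵢ wᵢ vᵢ` on `𝕜ᵈ` (bilinear in `w, v`, without conjugation). -/
noncomputable def pairing {𝕜 : Type} [RCLike 𝕜] {d : ℕ} (w : EuclideanSpace 𝕜 (Fin d)) :
    EuclideanSpace 𝕜 (Fin d) →L[𝕜] 𝕜 :=
  ∑ i, w i • (EuclideanSpace.proj i : EuclideanSpace 𝕜 (Fin d) →L[𝕜] 𝕜)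

/-- `S` is a generating function of `F(q, p) = (Q(q, p), P(q, p))`:
`S(q + m, Q + m) = S(q, Q)` for `m ∈ ℤᵈ`, and `P dQ - p dq = dS(q, Q)`. -/
structure IsGeneratingFunction (𝕜 : Type) [RCLike 𝕜] {d : ℕ}
    (F : PhaseSpace 𝕜 d → PhaseSpace 𝕜 d) (S : PhaseSpace 𝕜 d → 𝕜) : Prop where
  periodic : ∀ (m : Fin d → ℤ) (q Q : EuclideanSpace 𝕜 (Fin d)),
    S (q + intVec 𝕜 m, Q + intVec 𝕜 m) = S (q, Q)
  hasFDerivAt : ∀ q p : EuclideanSpace 𝕜 (Fin d),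
    HasFDerivAt S
      ((pairing (F (q, p)).2).comp
          (ContinuousLinearMap.snd 𝕜 (EuclideanSpace 𝕜 (Fin d)) (EuclideanSpace 𝕜 (Fin d))) -
        (pairing p).comp
          (ContinuousLinearMap.fst 𝕜 (EuclideanSpace 𝕜 (Fin d)) (EuclideanSpace 𝕜 (Fin d))))
      (q, (F (q, p)).1)

/-- The twist condition: `(q, p) ↦ (q, Q(q, p))` is a diffeomorphism of `𝕜ᵈ × 𝕜ᵈ`. -/
def TwistCondition (𝕜 : Type) [RCLike 𝕜] {d : ℕ}
    (F : PhaseSpace 𝕜 d → PhaseSpace 𝕜 d) : Prop :=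
  IsDiffeo 𝕜 (fun x : PhaseSpace 𝕜 d => ((x.1, (F x).1) : PhaseSpace 𝕜 d))

/-- `F : ℝᵈ × ℝᵈ → ℝᵈ × ℝᵈ` is a (continuous) lift of `f : 𝕋ᵈ × ℝᵈ → 𝕋ᵈ × ℝᵈ`. -/
def IsLift {d : ℕ} (F : PhaseSpace ℝ d → PhaseSpace ℝ d) (f : Annulus d → Annulus d) : Prop :=
  Continuous F ∧
    ∀ q p : EuclideanSpace ℝ (Fin d),
      f (torusProj q, p) = (torusProj (F (q, p)).1, (F (q, p)).2)

/-- `f` is a symplectic twist map of `𝕋ᵈ × ℝᵈ`. For a map with a lift that commutes with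
the translations `(q, p) ↦ (q + m, p)`, being a `C¹` diffeomorphism of `𝕋ᵈ × ℝᵈ` is the same as
the lift being a `C¹` diffeomorphism of `ℝᵈ × ℝᵈ`, because the covering is a local diffeomorphism. -/
def IsSymplecticTwistMap {d : ℕ} (f : Annulus d → Annulus d) : Prop :=
  ∃ F : PhaseSpace ℝ d → PhaseSpace ℝ d,
    IsLift F f ∧ IsDiffeo ℝ F ∧
    (∀ (m : Fin d → ℤ) (q p : EuclideanSpace ℝ (Fin d)),
      F (q + intVec ℝ m, p) = F (q, p) + (intVec ℝ m, 0)) ∧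
    TwistCondition ℝ F ∧
    ∃ S : PhaseSpace ℝ d → ℝ, IsGeneratingFunction ℝ F S

/-- `S` is a generating function of the map `f` of the annulus, that is, of one of its lifts. -/
def HasGeneratingFunction {d : ℕ} (f : Annulus d → Annulus d) (S : PhaseSpace ℝ d → ℝ) : Prop :=
  ∃ F : PhaseSpace ℝ d → PhaseSpace ℝ d, IsLift F f ∧ IsGeneratingFunction ℝ F S

/-- `f` is strongly positive: it has a `C²` generating function `S` with
`-β ‖v‖² ≤ ∂²_{q,Q} S(q, Q)(v, v) ≤ -α ‖v‖²` for constants `α, β > 0`. -/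
def StronglyPositive {d : ℕ} (f : Annulus d → Annulus d) : Prop :=
  ∃ S : PhaseSpace ℝ d → ℝ, HasGeneratingFunction f S ∧ ContDiff ℝ 2 S ∧
    ∃ α β : ℝ, 0 < α ∧ 0 < β ∧ ∀ q Q v : EuclideanSpace ℝ (Fin d),
      -β * ‖v‖ ^ 2 ≤ fderiv ℝ (fderiv ℝ S) (q, Q) (v, 0) (0, v) ∧
      fderiv ℝ (fderiv ℝ S) (q, Q) (v, 0) (0, v) ≤ -α * ‖v‖ ^ 2

/-- `f` is completely integrable: `f(q, p) = (q + ∇ℓ(p), p)` with `ℓ : ℝᵈ → ℝ` of class `C²` and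
`∇ℓ` a `C¹` diffeomorphism of `ℝᵈ`. -/
def CompletelyIntegrable {d : ℕ} (f : Annulus d → Annulus d) : Prop :=
  ∃ ℓ : EuclideanSpace ℝ (Fin d) → ℝ, ContDiff ℝ 2 ℓ ∧ IsDiffeo ℝ (gradient ℓ) ∧
    ∀ (θ : Torus d) (p : EuclideanSpace ℝ (Fin d)), f (θ, p) = (θ + torusProj (gradient ℓ p), p)

/-- The inclusion `ℝᵈ × ℝᵈ ⊆ ℂᵈ × ℂᵈ`. -/
def complexify {d : ℕ} (x : PhaseSpace ℝ d) : PhaseSpace ℂ d :=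
  (WithLp.toLp 2 (fun i => (x.1 i : ℂ)), WithLp.toLp 2 (fun i => (x.2 i : ℂ)))

/-- The analyticity property: some lift of `f` is the restriction of a holomorphic diffeomorphism
of `ℂᵈ × ℂᵈ` that satisfies the twist condition and has a generating function. -/
def AnalyticityProperty {d : ℕ} (f : Annulus d → Annulus d) : Prop :=
  ∃ Fc : PhaseSpace ℂ d → PhaseSpace ℂ d,
    IsDiffeo ℂ Fc ∧
    (∃ F : PhaseSpace ℝ d → PhaseSpace ℝ d,
      IsLift F f ∧ ∀ x, Fc (complexify x) = complexify (F x)) ∧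
    TwistCondition ℂ Fc ∧
    ∃ S : PhaseSpace ℂ d → ℂ, IsGeneratingFunction ℂ Fc S

/-- `m ∈ ℤᵈ` and `n ∈ ℕ` are coprime: `gcd(m₁, …, m_d, n) = 1`. -/
def CoprimePair {d : ℕ} (m : Fin d → ℤ) (n : ℕ) : Prop :=
  Nat.Coprime (Finset.univ.gcd (fun i => (m i).natAbs)) n

/-- The graph of `γ` is Lagrangian: `∫ γ(ν(t)) · ν'(t) dt = 0` for every `C¹` loop `ν` in `ℝᵈ`. -/
def IsLagrangianGraph {d : ℕ} (γ : EuclideanSpace ℝ (Fin d) → EuclideanSpace ℝ (Fin d)) : Prop :=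
  ∀ ν : ℝ → EuclideanSpace ℝ (Fin d), ContDiff ℝ 1 ν → Function.Periodic ν 1 →
    ∫ t in (0 : ℝ)..1, inner ℝ (γ (ν t)) (deriv ν t) = 0

/-- The graph of `γ`, with `γ` continuous and `ℤᵈ`-periodic, is an `(m, n)`-periodic graph of `F`. -/
structure IsPeriodicGraph {d : ℕ} (F : PhaseSpace ℝ d → PhaseSpace ℝ d) (m : Fin d → ℤ) (n : ℕ)
    (γ : EuclideanSpace ℝ (Fin d) → EuclideanSpace ℝ (Fin d)) : Prop where
  continuous : Continuous γ
  periodic : ∀ (k : Fin d → ℤ) (q : EuclideanSpace ℝ (Fin d)), γ (q + intVec ℝ k) = γ q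
  iterate : ∀ q : EuclideanSpace ℝ (Fin d), F^[n] (q, γ q) = (q + intVec ℝ m, γ q)

/-- `F` has a Lipschitz Lagrangian `(m, n)`-periodic graph. -/
def HasLipschitzLagrangianPeriodicGraph {d : ℕ} (F : PhaseSpace ℝ d → PhaseSpace ℝ d)
    (m : Fin d → ℤ) (n : ℕ) : Prop :=
  ∃ γ : EuclideanSpace ℝ (Fin d) → EuclideanSpace ℝ (Fin d),
    (∃ K, LipschitzWith K γ) ∧ IsLagrangianGraph γ ∧ IsPeriodicGraph F m n γ

/-! Complete integrability turns the generating function into `h (Q - q) + ε * G q`, where `h` is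
uniformly convex with bounded second derivative and `∇h` is the inverse of the frequency map `L`.
Analyticity of the lift makes `L` real analytic.

A Lipschitz Lagrangian graph of `(m, n)`-periodic points is the graph of `∇w`. For small `ε` it is
invariant, because the `n`-th iterate is still injective in the momentum. The defect `S_ε(q, Q) - (w
Q - w q)` then attains its minimum exactly where minimality forces the pair onto the dynamics, and
it is constant along the dynamics. So `w` is calibrated (`IsCalibrated`,
`exists_isCalibrated_of_graph`): a subsolution of a discrete Hamilton-Jacobi equation with equality
along all orbits of the graph. Calibration says that through every point passes an action-minimizing
chain from `q` to `q + m`, and that all of these have the same action. It makes sense for every `ε`,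
not only for small ones. Three facts about it give the theorem.

Near `ε = 0`, comparing the minimizing chains with the uniform chains of step `m / n` shows that the
sums of `G` along the unperturbed periodic orbits are constant (`sum_G_eq_of_accPt`). Hence the
Fourier coefficient of `G` at `k ≠ 0` vanishes whenever `k · m / n` is an integer. The segments
along a basis supply such an `m / n` for all but finitely many `k`, so `G` is a trigonometric
polynomial, in particular analytic (`contDiff_omega_of_sum_eq`).

Once `L` and `∇G` are analytic, calibration propagates from an accumulation point at `0` to all of
`ℝ` (`calibratedSet_eq_univ`). The set of calibrated parameters is closed by compactness. At an
accumulation point the graph is nondegenerate, since minimizing chains have no conjugate points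
(`IsCalibrated.eq_zero_of_hasDerivAt`). The graph therefore continues analytically in `ε`, and the
identity theorem keeps it invariant and Lagrangian.

For large `ε`, a minimizing chain starting at `q` pays `ε * G q`, while a competitor waits at a
minimum of `G` and makes one jump whose cost does not depend on `ε`. Letting `ε → ∞` forces `G q =
min G` (`G_eq_of_calibratedSet_eq_univ`). -/

open Filter Topology

open scoped ContDiff RealInnerProductSpace

/-! ### Convexity estimates and differentiability by squeezing. -/

section Calculus

variable {V : Type*} [NormedAddCommGroup V] [InnerProductSpace ℝ V] [CompleteSpace V]

theorem HasGradientAt.comp_hasDerivAt {f : V → ℝ} {a : V} {c : ℝ → V} {c' : V} {t : ℝ}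
    (hf : HasGradientAt f a (c t)) (hc : HasDerivAt c c' t) :
    HasDerivAt (fun s => f (c s)) ⟪a, c'⟫ t := by
  have := hf.hasFDerivAt.comp_hasDerivAt t hc
  rwa [InnerProductSpace.toDual_apply_apply] at this

theorem HasGradientAt.comp_add_const {f : V → ℝ} {a x : V} (b : V)
    (hf : HasGradientAt f a (x + b)) : HasGradientAt (fun y => f (y + b)) a x := by
  rw [hasGradientAt_iff_hasFDerivAt] at hf ⊢
  exact (hasFDerivAt_comp_add_right b).2 hf

theorem HasGradientAt.add' {f g : V → ℝ} {a b x : V}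
    (hf : HasGradientAt f a x) (hg : HasGradientAt g b x) :
    HasGradientAt (fun y => f y + g y) (a + b) x := by
  rw [hasGradientAt_iff_hasFDerivAt] at hf hg ⊢
  rw [map_add]
  exact hf.add hg

theorem HasGradientAt.add_const' {f : V → ℝ} {a x : V} (c : ℝ)
    (hf : HasGradientAt f a x) : HasGradientAt (fun y => f y + c) a x := by
  rw [hasGradientAt_iff_hasFDerivAt] at hf ⊢
  exact hf.add_const c

theorem HasGradientAt.neg' {f : V → ℝ} {a x : V} (hf : HasGradientAt f a x) :
    HasGradientAt (fun y => -f y) (-a) x := by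
  rw [hasGradientAt_iff_hasFDerivAt] at hf ⊢
  rw [map_neg]
  exact hf.neg

theorem HasGradientAt.const_mul' {f : V → ℝ} {a x : V} (c : ℝ) (hf : HasGradientAt f a x) :
    HasGradientAt (fun y => c * f y) (c • a) x := by
  rw [hasGradientAt_iff_hasFDerivAt] at hf ⊢
  have := hf.const_mul c
  simpa using this

theorem HasGradientAt.comp_const_sub {f : V → ℝ} {a x : V} (b : V)
    (hf : HasGradientAt f a (b - x)) : HasGradientAt (fun y => f (b - y)) (-a) x := by
  rw [hasGradientAt_iff_hasFDerivAt] at hf ⊢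
  have := hf.comp x ((hasFDerivAt_id x).const_sub b)
  refine this.congr_fderiv ?_
  ext v
  simp

/-- A lower bound on the monotonicity of a gradient gives a quadratic lower bound. -/
theorem quadratic_lower_bound {h : V → ℝ} {H : V → V} (hh : ∀ v, HasGradientAt h (H v) v) {α : ℝ}
    (mono : ∀ u v, α * ‖u - v‖ ^ 2 ≤ ⟪H u - H v, u - v⟫) (u v : V) :
    h u + ⟪H u, v⟫ + α / 2 * ‖v‖ ^ 2 ≤ h (u + v) := by
  -- Along the segment, subtract from `h` the tangent line and the parabola. The remainder is
  -- nondecreasing on `[0, 1]`, because monotonicity of `H` between `u + t • v` and `u` is `t` times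
  -- the required inequality.
  have hd : ∀ t : ℝ, HasDerivAt (fun t : ℝ => h (u + t • v) - t * ⟪H u, v⟫ - α / 2 * ‖v‖ ^ 2 * t ^ 2)
      (⟪H (u + t • v), v⟫ - ⟪H u, v⟫ - α * ‖v‖ ^ 2 * t) t := by
    intro t
    have h1 : HasDerivAt (fun t : ℝ => u + t • v) v t := by
      simpa using ((hasDerivAt_id t).smul_const v).const_add u
    have h2 := (hh (u + t • v)).comp_hasDerivAt h1
    have h3 := (h2.sub ((hasDerivAt_id t).mul_const ⟪H u, v⟫)).sub
      (((hasDerivAt_id t).pow 2).const_mul (α / 2 * ‖v‖ ^ 2))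
    refine h3.congr_deriv ?_
    simp; ring
  have hm : MonotoneOn (fun t : ℝ => h (u + t • v) - t * ⟪H u, v⟫ - α / 2 * ‖v‖ ^ 2 * t ^ 2)
      (Set.Icc 0 1) := by
    refine monotoneOn_of_deriv_nonneg (convex_Icc 0 1)
      (fun t _ => (hd t).continuousAt.continuousWithinAt)
      (fun t _ => (hd t).differentiableAt.differentiableWithinAt) ?_
    intro t ht
    rw [interior_Icc] at ht
    rw [(hd t).deriv]
    have := mono (u + t • v) u
    simp only [add_sub_cancel_left, norm_smul, inner_smul_right, Real.norm_eq_abs, mul_pow,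
      sq_abs, inner_sub_left] at this
    have ht0 := ht.1
    by_contra hc
    push Not at hc
    nlinarith [mul_pos ht0 (neg_pos.2 hc)]
  have := hm (Set.left_mem_Icc.2 zero_le_one) (Set.right_mem_Icc.2 zero_le_one) zero_le_one
  simp at this
  linarith

theorem quadratic_upper_bound {h : V → ℝ} {H : V → V} (hh : ∀ v, HasGradientAt h (H v) v) {β : ℝ}
    (mono : ∀ u v, ⟪H u - H v, u - v⟫ ≤ β * ‖u - v‖ ^ 2) (u v : V) :
    h (u + v) ≤ h u + ⟪H u, v⟫ + β / 2 * ‖v‖ ^ 2 := by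
  have := quadratic_lower_bound (h := fun v => -h v) (H := fun v => -H v) (α := -β)
    (fun v => (hh v).neg') (fun u v => by
      have := mono u v
      rw [← neg_sub', inner_neg_left]
      linarith) u v
  rw [inner_neg_left] at this
  linarith

/-- A function squeezed between two differentiable functions is differentiable at a contact point,
and all three gradients agree. -/
theorem hasGradientAt_of_squeeze {l w u : V → ℝ} {a b x : V} (hl : HasGradientAt l a x)
    (hu : HasGradientAt u b x) (hlw : ∀ y, l y ≤ w y) (hwu : ∀ y, w y ≤ u y)
    (hx : u x ≤ l x) : a = b ∧ HasGradientAt w a x := by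
  have hab : a = b := by
    have hmin : IsLocalMin (fun y => u y + -l y) x :=
      Filter.Eventually.of_forall fun y => by
        have := hlw y; have := hwu y; simp only; linarith
    have h1 := hmin.hasFDerivAt_eq_zero (hu.add' hl.neg').hasFDerivAt
    have h2 : b + -a = 0 := (map_eq_zero_iff _ (InnerProductSpace.toDual ℝ V).injective).1 h1
    rw [← sub_eq_add_neg] at h2
    exact (sub_eq_zero.1 h2).symm
  refine ⟨hab, ?_⟩
  subst hab
  rw [hasGradientAt_iff_isLittleO] at *
  have e1 : u x = w x := le_antisymm (hx.trans (hlw x)) (hwu x)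
  have e2 : l x = w x := le_antisymm (hlw x) ((hwu x).trans hx)
  have := hu.norm_left.add hl.norm_left
  refine Asymptotics.IsBigO.trans_isLittleO (Asymptotics.IsBigO.of_bound 1 ?_) this
  refine Filter.Eventually.of_forall fun y => ?_
  have h1 := hlw y
  have h2 := hwu y
  rw [e1, e2, one_mul, Real.norm_eq_abs, Real.norm_eq_abs, Real.norm_eq_abs, Real.norm_eq_abs]
  refine le_trans ?_ (le_abs_self _)
  rw [abs_le]
  constructor
  · linarith [neg_abs_le (l y - w x - ⟪a, y - x⟫), abs_nonneg (u y - w x - ⟪a, y - x⟫)]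
  · linarith [le_abs_self (u y - w x - ⟪a, y - x⟫), abs_nonneg (l y - w x - ⟪a, y - x⟫)]

/-- If `h` has a gradient `H` with `h (u + v) ≤ h u + ⟪H u, v⟫ + β / 2 ‖v‖²` and `H` is monotone,
then `H` is `β`-Lipschitz. -/
theorem norm_gradient_sub_le {h : V → ℝ} {H : V → V} {β : ℝ} (hβ : 0 < β)
    (upper : ∀ u v, h (u + v) ≤ h u + ⟪H u, v⟫ + β / 2 * ‖v‖ ^ 2)
    (lower : ∀ u v, h u + ⟪H u, v⟫ ≤ h (u + v)) (x y : V) :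
    ‖H y - H x‖ ≤ β * ‖y - x‖ := by
  -- Cocoercivity argument: one gradient step of length `β⁻¹` from `y` in the direction `-D` gives
  -- the best use of the upper bound, and the lower bound at `x` is tested at the same point.
  set D := H y - H x with hD
  have h1 := upper y (-(β⁻¹ • D))
  have h2 := lower x (y + -(β⁻¹ • D) - x)
  have h3 := upper x (y - x)
  rw [add_sub_cancel] at h2 h3
  have h4 : ⟪H y, D⟫ - ⟪H x, D⟫ = ‖D‖ ^ 2 := by
    rw [← inner_sub_left, ← hD, real_inner_self_eq_norm_sq]
  simp only [inner_sub_right, inner_add_right, inner_neg_right, inner_smul_right, norm_neg,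
    norm_smul, mul_pow, norm_inv, Real.norm_eq_abs, inv_pow, sq_abs] at h1 h2 h3
  have h5 : β⁻¹ * ‖D‖ ^ 2 ≤ β / 2 * ‖y - x‖ ^ 2 + β⁻¹ / 2 * ‖D‖ ^ 2 := by
    have h6 : β / 2 * ((β ^ 2)⁻¹ * ‖D‖ ^ 2) = β⁻¹ / 2 * ‖D‖ ^ 2 := by field_simp
    have h7 : β⁻¹ * ⟪H y, D⟫ - β⁻¹ * ⟪H x, D⟫ = β⁻¹ * ‖D‖ ^ 2 := by rw [← h4]; ring
    linarith
  have h8 : ‖D‖ ^ 2 ≤ (β * ‖y - x‖) ^ 2 := by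
    have : β⁻¹ * ‖D‖ ^ 2 ≤ β * ‖y - x‖ ^ 2 := by linarith
    rw [inv_mul_le_iff₀ hβ] at this
    nlinarith
  exact le_of_sq_le_sq h8 (by positivity)

/-- The second derivative is nonnegative at a minimum. -/
theorem second_deriv_nonneg_of_min {f f' : ℝ → ℝ} {D : ℝ} (hf : ∀ s, HasDerivAt f (f' s) s)
    (hf' : HasDerivAt f' D 0) (hmin : ∀ s, f 0 ≤ f s) : 0 ≤ D := by
  by_contra hD
  push Not at hD
  have hderiv : deriv f = f' := funext fun s => (hf s).deriv
  have h0 : f' 0 = 0 :=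
    IsLocalMin.hasDerivAt_eq_zero (Filter.Eventually.of_forall hmin) (hf 0)
  -- A negative second derivative would make `0` a local maximum as well, so `f` would be locally
  -- constant and `D` would be zero.
  have hmax : IsLocalMax f 0 := isLocalMax_of_deriv_deriv_neg
    (by rw [hderiv, hf'.deriv]; exact hD) (by rw [hderiv, h0]) (hf 0).continuousAt
  have hconst : f =ᶠ[𝓝 0] fun _ => f 0 := by
    filter_upwards [hmax] with s hs using le_antisymm hs (hmin s)
  have h1 : f' =ᶠ[𝓝 0] fun _ => 0 := by
    have := hconst.deriv
    rw [hderiv] at this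
    filter_upwards [this] with s hs
    simpa using hs
  have := hf'.unique ((hasDerivAt_const (0 : ℝ) (0 : ℝ)).congr_of_eventuallyEq h1)
  exact hD.ne this

end Calculus

/-! ### Compactness modulo the integer lattice. -/

section Lattice

variable {d : ℕ}

theorem intVec_neg (k : Fin d → ℤ) : intVec ℝ (-k) = -intVec ℝ k := by
  ext i; simp [intVec]

/-- A fundamental domain of `ℤᵈ` is contained in a ball. -/
theorem exists_add_intVec_mem_closedBall (q : EuclideanSpace ℝ (Fin d)) :
    ∃ k : Fin d → ℤ, q + intVec ℝ k ∈ Metric.closedBall (0 : EuclideanSpace ℝ (Fin d)) (√d) := by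
  refine ⟨fun i => -⌊q i⌋, ?_⟩
  rw [mem_closedBall_zero_iff, EuclideanSpace.norm_eq]
  refine Real.sqrt_le_sqrt ?_
  calc ∑ i, ‖(q + intVec ℝ fun i => -⌊q i⌋) i‖ ^ 2 ≤ ∑ i : Fin d, (1 : ℝ) := by
        refine Finset.sum_le_sum fun i _ => ?_
        have : (q + intVec ℝ fun i => -⌊q i⌋) i = Int.fract (q i) := by
          simp [intVec, Int.fract, sub_eq_add_neg]
        rw [this, Real.norm_eq_abs, sq_abs]
        have h0 := Int.fract_nonneg (q i)
        have h1 := Int.fract_lt_one (q i)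
        nlinarith
    _ = d := by simp

/-- A continuous periodic function is bounded. -/
theorem exists_norm_le_of_periodic {F : Type*} [NormedAddCommGroup F]
    {f : EuclideanSpace ℝ (Fin d) → F} (hf : Continuous f)
    (hper : ∀ (k : Fin d → ℤ) q, f (q + intVec ℝ k) = f q) : ∃ C, 0 ≤ C ∧ ∀ q, ‖f q‖ ≤ C := by
  obtain ⟨C, hC⟩ := (isCompact_closedBall (0 : EuclideanSpace ℝ (Fin d)) (√d)).exists_bound_of_continuousOn
    hf.continuousOn
  refine ⟨max C 0, le_max_right _ _, fun q => ?_⟩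
  obtain ⟨k, hk⟩ := exists_add_intVec_mem_closedBall q
  rw [← hper k q]
  exact (hC _ hk).trans (le_max_left _ _)

/-- A property which is `ℤᵈ`-periodic in `q` and holds locally near every `(x₀, q)` holds for all
`q` when the parameter is near `x₀`. -/
theorem eventually_forall_of_periodic {X : Type*} [TopologicalSpace X] {x₀ : X}
    {P : X → EuclideanSpace ℝ (Fin d) → Prop}
    (hper : ∀ x (k : Fin d → ℤ) q, P x (q + intVec ℝ k) → P x q)
    (hloc : ∀ q, ∀ᶠ z : X × EuclideanSpace ℝ (Fin d) in 𝓝 (x₀, q), P z.1 z.2) :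
    ∀ᶠ x in 𝓝 x₀, ∀ q, P x q := by
  have := (isCompact_closedBall (0 : EuclideanSpace ℝ (Fin d))
    (√d)).eventually_forall_of_forall_eventually (x₀ := x₀) (P := P) (fun q _ => hloc q)
  filter_upwards [this] with x hx q
  obtain ⟨k, hk⟩ := exists_add_intVec_mem_closedBall q
  exact hper x k q (hx _ hk)

end Lattice

/-! ### The standard family and its basic estimates. -/

/-- A family of generating functions `h(Q - q) + ε G(q)` on `ℝᵈ × ℝᵈ`, where `h` is uniformly convex
with bounded second derivative, `L` is the inverse of `H = ∇h`, `G` is `ℤᵈ`-periodic and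
`g = ∇G`. -/
structure StandardFamily (d : ℕ) where
  h : EuclideanSpace ℝ (Fin d) → ℝ
  H : EuclideanSpace ℝ (Fin d) → EuclideanSpace ℝ (Fin d)
  L : EuclideanSpace ℝ (Fin d) → EuclideanSpace ℝ (Fin d)
  G : EuclideanSpace ℝ (Fin d) → ℝ
  g : EuclideanSpace ℝ (Fin d) → EuclideanSpace ℝ (Fin d)
  α : ℝ
  β : ℝ
  M : ℝ
  B : ℝ
  α_pos : 0 < α
  β_pos : 0 < β
  M_nonneg : 0 ≤ M
  B_nonneg : 0 ≤ B
  hasGradientAt_h : ∀ v, HasGradientAt h (H v) v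
  hasGradientAt_G : ∀ v, HasGradientAt G (g v) v
  contDiff_H : ContDiff ℝ 1 H
  H_L : ∀ p, H (L p) = p
  L_H : ∀ v, L (H v) = v
  H_mono : ∀ u v, α * ‖u - v‖ ^ 2 ≤ ⟪H u - H v, u - v⟫
  h_upper : ∀ u v, h (u + v) ≤ h u + ⟪H u, v⟫ + β / 2 * ‖v‖ ^ 2
  G_periodic : ∀ (k : Fin d → ℤ) q, G (q + intVec ℝ k) = G q
  g_lipschitz : ∀ u v, ‖g u - g v‖ ≤ M * ‖u - v‖
  G_bound : ∀ q, |G q| ≤ B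
  g_bound : ∀ q, ‖g q‖ ≤ B

namespace StandardFamily

variable {d : ℕ} (A : StandardFamily d)

theorem h_lower (u v : EuclideanSpace ℝ (Fin d)) :
    A.h u + ⟪A.H u, v⟫ + A.α / 2 * ‖v‖ ^ 2 ≤ A.h (u + v) :=
  quadratic_lower_bound A.hasGradientAt_h A.H_mono u v

theorem H_lipschitz (u v : EuclideanSpace ℝ (Fin d)) : ‖A.H u - A.H v‖ ≤ A.β * ‖u - v‖ :=
  norm_gradient_sub_le A.β_pos A.h_upper (fun u v => by
    have := A.h_lower u v
    have := A.α_pos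
    have : 0 ≤ A.α / 2 * ‖v‖ ^ 2 := by positivity
    linarith) v u

theorem L_lipschitz (p p' : EuclideanSpace ℝ (Fin d)) :
    ‖A.L p - A.L p'‖ ≤ A.α⁻¹ * ‖p - p'‖ := by
  have h1 := A.H_mono (A.L p) (A.L p')
  rw [A.H_L, A.H_L] at h1
  have h2 := real_inner_le_norm (p - p') (A.L p - A.L p')
  rw [inv_mul_eq_div, le_div_iff₀ A.α_pos]
  rcases (norm_nonneg (A.L p - A.L p')).eq_or_lt with h0 | h0
  · rw [← h0]; simp
  · nlinarith

theorem continuous_H : Continuous A.H := A.contDiff_H.continuous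

theorem continuous_L : Continuous A.L :=
  (LipschitzWith.of_dist_le_mul (K := A.α⁻¹.toNNReal) fun p p' => by
    rw [dist_eq_norm, dist_eq_norm, Real.coe_toNNReal _ (inv_nonneg.2 A.α_pos.le)]
    exact A.L_lipschitz p p').continuous

theorem continuous_g : Continuous A.g :=
  (LipschitzWith.of_dist_le_mul (K := A.M.toNNReal) fun p p' => by
    rw [dist_eq_norm, dist_eq_norm, Real.coe_toNNReal _ A.M_nonneg]
    exact A.g_lipschitz p p').continuous

theorem continuous_h : Continuous A.h :=
  continuous_iff_continuousAt.2 fun v => (A.hasGradientAt_h v).continuousAt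

theorem continuous_G : Continuous A.G :=
  continuous_iff_continuousAt.2 fun v => (A.hasGradientAt_G v).continuousAt

/-- Strong monotonicity of `H` bounds the inner product below by `α ‖L p - L p'‖ ^ 2`, and the
Lipschitz bound on `H` converts this to `‖p - p'‖ ^ 2` at the price of `β ^ 2`. -/
theorem L_mono (p p' : EuclideanSpace ℝ (Fin d)) :
    A.α / A.β ^ 2 * ‖p - p'‖ ^ 2 ≤ ⟪A.L p - A.L p', p - p'⟫ := by
  have h1 := A.H_mono (A.L p) (A.L p')
  have h2 := A.H_lipschitz (A.L p) (A.L p')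
  rw [A.H_L, A.H_L] at h1 h2
  rw [real_inner_comm]
  refine le_trans ?_ h1
  have hβ := A.β_pos
  have hα := A.α_pos
  have h3 : ‖p - p'‖ ^ 2 ≤ A.β ^ 2 * ‖A.L p - A.L p'‖ ^ 2 := by
    rw [← mul_pow]; gcongr
  rw [div_mul_eq_mul_div, div_le_iff₀ (by positivity)]
  nlinarith

theorem g_periodic (k : Fin d → ℤ) (q : EuclideanSpace ℝ (Fin d)) :
    A.g (q + intVec ℝ k) = A.g q := by
  have h1 := (A.hasGradientAt_G (q + intVec ℝ k)).comp_add_const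
  simp only [A.G_periodic] at h1
  exact h1.unique (A.hasGradientAt_G q)

theorem G_upper (u v : EuclideanSpace ℝ (Fin d)) :
    A.G (u + v) ≤ A.G u + ⟪A.g u, v⟫ + A.M / 2 * ‖v‖ ^ 2 :=
  quadratic_upper_bound A.hasGradientAt_G (fun u v => by
    have := real_inner_le_norm (A.g u - A.g v) (u - v)
    have := mul_le_mul_of_nonneg_right (A.g_lipschitz u v) (norm_nonneg (u - v))
    nlinarith) u v

theorem G_lower (u v : EuclideanSpace ℝ (Fin d)) :
    A.G u + ⟪A.g u, v⟫ - A.M / 2 * ‖v‖ ^ 2 ≤ A.G (u + v) := by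
  have := quadratic_lower_bound (α := -A.M) A.hasGradientAt_G (fun u v => by
    have := neg_le_of_abs_le (abs_real_inner_le_norm (A.g u - A.g v) (u - v))
    have := mul_le_mul_of_nonneg_right (A.g_lipschitz u v) (norm_nonneg (u - v))
    nlinarith) u v
  linarith

theorem mul_G_upper (ε : ℝ) (u v : EuclideanSpace ℝ (Fin d)) :
    ε * A.G (u + v) ≤ ε * A.G u + ⟪ε • A.g u, v⟫ + |ε| * A.M / 2 * ‖v‖ ^ 2 := by
  rw [real_inner_smul_left]
  rcases le_total 0 ε with h | h
  · rw [abs_of_nonneg h]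
    have := mul_le_mul_of_nonneg_left (A.G_upper u v) h
    nlinarith
  · rw [abs_of_nonpos h]
    have := mul_le_mul_of_nonpos_left (A.G_lower u v) h
    nlinarith

/-- The generating function `S_ε(q, Q) = h(Q - q) + ε G(q)`. -/
def step (ε : ℝ) (q Q : EuclideanSpace ℝ (Fin d)) : ℝ := A.h (Q - q) + ε * A.G q

/-- The map generated by `S_ε`. -/
def map (ε : ℝ) (x : EuclideanSpace ℝ (Fin d) × EuclideanSpace ℝ (Fin d)) :
    EuclideanSpace ℝ (Fin d) × EuclideanSpace ℝ (Fin d) :=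
  (x.1 + A.L (x.2 + ε • A.g x.1), x.2 + ε • A.g x.1)

theorem step_add_intVec (ε : ℝ) (k : Fin d → ℤ) (q Q : EuclideanSpace ℝ (Fin d)) :
    A.step ε (q + intVec ℝ k) (Q + intVec ℝ k) = A.step ε q Q := by
  rw [step, step, add_sub_add_right_eq_sub, A.G_periodic]

theorem map_add_intVec (ε : ℝ) (k : Fin d → ℤ) (q p : EuclideanSpace ℝ (Fin d)) :
    A.map ε (q + intVec ℝ k, p) = ((A.map ε (q, p)).1 + intVec ℝ k, (A.map ε (q, p)).2) := by
  simp only [map, A.g_periodic]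
  congr 1
  abel

theorem map_iterate_add_intVec (ε : ℝ) (k : Fin d → ℤ) (n : ℕ) (q p : EuclideanSpace ℝ (Fin d)) :
    (A.map ε)^[n] (q + intVec ℝ k, p) =
      (((A.map ε)^[n] (q, p)).1 + intVec ℝ k, ((A.map ε)^[n] (q, p)).2) := by
  induction n with
  | zero => rfl
  | succ n ih => rw [Function.iterate_succ_apply', ih, map_add_intVec, Function.iterate_succ_apply']

theorem hasGradientAt_step_right (ε : ℝ) (q Q : EuclideanSpace ℝ (Fin d)) :
    HasGradientAt (fun Q => A.step ε q Q) (A.H (Q - q)) Q := by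
  have := ((A.hasGradientAt_h (Q + -q)).comp_add_const (-q)).add_const' (ε * A.G q)
  simpa only [step, ← sub_eq_add_neg] using this

theorem hasGradientAt_step_left (ε : ℝ) (q Q : EuclideanSpace ℝ (Fin d)) :
    HasGradientAt (fun q => A.step ε q Q) (-A.H (Q - q) + ε • A.g q) q :=
  ((A.hasGradientAt_h (Q - q)).comp_const_sub Q).add' ((A.hasGradientAt_G q).const_mul' ε)

/-- `w` is a subsolution of the discrete Hamilton-Jacobi equation with constant `κ`, and chains of
length `n` from `q` to `q + m` with equality at each step pass through every point. -/
structure IsCalibrated (m : Fin d → ℤ) (n : ℕ) (ε : ℝ) (w : EuclideanSpace ℝ (Fin d) → ℝ)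
    (κ : ℝ) : Prop where
  shift : ∀ (k : Fin d → ℤ) q q', w (q + intVec ℝ k) - w q = w (q' + intVec ℝ k) - w q'
  le : ∀ q Q, w Q - w q ≤ A.step ε q Q + κ
  chain : ∀ q, ∃ x : ℕ → EuclideanSpace ℝ (Fin d), x 0 = q ∧ x n = q + intVec ℝ m ∧
    ∀ i < n, w (x (i + 1)) - w (x i) = A.step ε (x i) (x (i + 1)) + κ

/-- The candidate for the dynamics on the graph of `γ`. -/
def graphMap (ε : ℝ) (γ : EuclideanSpace ℝ (Fin d) → EuclideanSpace ℝ (Fin d))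
    (q : EuclideanSpace ℝ (Fin d)) : EuclideanSpace ℝ (Fin d) :=
  q + A.L (γ q + ε • A.g q)

theorem H_graphMap_sub (ε : ℝ) (γ : EuclideanSpace ℝ (Fin d) → EuclideanSpace ℝ (Fin d))
    (q : EuclideanSpace ℝ (Fin d)) : A.H (A.graphMap ε γ q - q) = γ q + ε • A.g q := by
  rw [graphMap, add_sub_cancel_left, A.H_L]

theorem eq_H_graphMap_sub (ε : ℝ) (γ : EuclideanSpace ℝ (Fin d) → EuclideanSpace ℝ (Fin d))
    (q : EuclideanSpace ℝ (Fin d)) : γ q = A.H (A.graphMap ε γ q - q) - ε • A.g q := by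
  rw [A.H_graphMap_sub, add_sub_cancel_right]

/-- Half the bound on the second derivatives of `S_ε` that enters all quadratic estimates. -/
noncomputable def curv (ε : ℝ) : ℝ := A.β + |ε| * A.M / 2

theorem curv_pos (ε : ℝ) : 0 < A.curv ε := by
  have := A.β_pos
  have := A.M_nonneg
  rw [curv]; positivity

/-! ### Regularity and dynamics of calibrated functions. -/

namespace IsCalibrated

variable {A} {m : Fin d → ℤ} {n : ℕ} {ε : ℝ} {w : EuclideanSpace ℝ (Fin d) → ℝ} {κ : ℝ}
  (hc : A.IsCalibrated m n ε w κ) (hn : 0 < n)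

include hc

theorem periodic_gap (k : Fin d → ℤ) (q Q : EuclideanSpace ℝ (Fin d)) :
    w (Q + intVec ℝ k) - w (q + intVec ℝ k) = w Q - w q := by
  have := hc.shift k q Q
  linarith

include hn

theorem exists_next (q : EuclideanSpace ℝ (Fin d)) : ∃ Q, w Q - w q = A.step ε q Q + κ := by
  obtain ⟨x, h0, -, hx⟩ := hc.chain q
  exact ⟨x 1, by simpa [h0] using hx 0 hn⟩

/-- The chain that starts at `Q` ends at `Q + m`; its last link, translated by `-m`, ends at `Q`. -/
theorem exists_prev (Q : EuclideanSpace ℝ (Fin d)) : ∃ q, w Q - w q = A.step ε q Q + κ := by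
  obtain ⟨x, -, h1, hx⟩ := hc.chain Q
  have h2 := hx (n - 1) (by omega)
  rw [Nat.sub_add_cancel hn, h1] at h2
  refine ⟨x (n - 1) + intVec ℝ (-m), ?_⟩
  have h3 := hc.periodic_gap (-m) (x (n - 1)) (Q + intVec ℝ m)
  have h4 := A.step_add_intVec ε (-m) (x (n - 1)) (Q + intVec ℝ m)
  have h5 : Q + intVec ℝ m + intVec ℝ (-m) = Q := by rw [intVec_neg]; abel
  rw [h5] at h3 h4
  linarith

/-- Every point has a successor and a predecessor. The successor supports `w` from below by a
translate of `-S_ε(·, R)`, the predecessor from above by a translate of `S_ε(R, ·)`, and both touch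
`w` at the point. So `w` is differentiable there and its gradient is read off from either side. -/
theorem hasGradientAt_and_eq {q Q : EuclideanSpace ℝ (Fin d)}
    (h : w Q - w q = A.step ε q Q + κ) :
    HasGradientAt w (A.H (Q - q)) Q ∧ HasGradientAt w (A.H (Q - q) - ε • A.g q) q := by
  constructor
  · obtain ⟨R, hR⟩ := hc.exists_next hn Q
    have hl := ((A.hasGradientAt_step_left ε Q R).neg').add_const' (w R - κ)
    have hu := (A.hasGradientAt_step_right ε q Q).add_const' (κ + w q)
    obtain ⟨e, hw⟩ := hasGradientAt_of_squeeze (w := w) hl hu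
      (fun y => by have := hc.le y R; linarith) (fun y => by have := hc.le q y; linarith)
      (by linarith)
    rwa [e] at hw
  · obtain ⟨R, hR⟩ := hc.exists_prev hn q
    have hl := ((A.hasGradientAt_step_left ε q Q).neg').add_const' (w Q - κ)
    have hu := (A.hasGradientAt_step_right ε R q).add_const' (κ + w R)
    obtain ⟨-, hw⟩ := hasGradientAt_of_squeeze (w := w) hl hu
      (fun y => by have := hc.le y Q; linarith) (fun y => by have := hc.le R y; linarith)
      (by linarith)
    convert! hw using 1
    abel

theorem hasGradientAt (q : EuclideanSpace ℝ (Fin d)) : HasGradientAt w (gradient w q) q := by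
  obtain ⟨Q, hQ⟩ := hc.exists_next hn q
  exact (hc.hasGradientAt_and_eq hn hQ).2.differentiableAt.hasGradientAt

theorem eq_graphMap {q Q : EuclideanSpace ℝ (Fin d)} (h : w Q - w q = A.step ε q Q + κ) :
    Q = A.graphMap ε (gradient w) q := by
  have h1 := (hc.hasGradientAt_and_eq hn h).2.gradient
  rw [graphMap, h1, sub_add_cancel, A.L_H]
  abel

theorem graphMap_step (q : EuclideanSpace ℝ (Fin d)) :
    w (A.graphMap ε (gradient w) q) - w q = A.step ε q (A.graphMap ε (gradient w) q) + κ := by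
  obtain ⟨Q, hQ⟩ := hc.exists_next hn q
  rwa [← hc.eq_graphMap hn hQ]

theorem gradient_graphMap (q : EuclideanSpace ℝ (Fin d)) :
    gradient w (A.graphMap ε (gradient w) q) = gradient w q + ε • A.g q := by
  rw [(hc.hasGradientAt_and_eq hn (hc.graphMap_step hn q)).1.gradient, H_graphMap_sub]

theorem gradient_periodic (k : Fin d → ℤ) (q : EuclideanSpace ℝ (Fin d)) :
    gradient w (q + intVec ℝ k) = gradient w q := by
  have h1 := (hc.hasGradientAt hn (q + intVec ℝ k)).comp_add_const
  have h2 : (fun y => w (y + intVec ℝ k)) = fun y => w y + (w (q + intVec ℝ k) - w q) := by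
    funext y
    have := hc.shift k q y
    linarith
  rw [h2] at h1
  exact h1.unique ((hc.hasGradientAt hn q).add_const' _)

theorem chain_eq_iterate {x : ℕ → EuclideanSpace ℝ (Fin d)}
    (hx : ∀ i < n, w (x (i + 1)) - w (x i) = A.step ε (x i) (x (i + 1)) + κ) :
    ∀ i ≤ n, x i = (A.graphMap ε (gradient w))^[i] (x 0) := by
  intro i
  induction i with
  | zero => intro _; rfl
  | succ i ih =>
    intro hi
    rw [Function.iterate_succ_apply', ← ih (by omega)]
    exact hc.eq_graphMap hn (hx i (by omega))

theorem graphMap_iterate (q : EuclideanSpace ℝ (Fin d)) :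
    (A.graphMap ε (gradient w))^[n] q = q + intVec ℝ m := by
  obtain ⟨x, h0, h1, hx⟩ := hc.chain q
  rw [← h0, ← hc.chain_eq_iterate hn hx n le_rfl, h1, h0]

/-- Semiconcavity is inherited from `h` through the support from above given by a predecessor of
`Q`. -/
theorem upper (Q v : EuclideanSpace ℝ (Fin d)) :
    w (Q + v) ≤ w Q + ⟪gradient w Q, v⟫ + A.β / 2 * ‖v‖ ^ 2 := by
  obtain ⟨q, hq⟩ := hc.exists_prev hn Q
  rw [(hc.hasGradientAt_and_eq hn hq).1.gradient]
  have h1 := hc.le q (Q + v)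
  have h2 := A.h_upper (Q - q) v
  rw [step] at hq h1
  rw [← add_sub_right_comm] at h2
  linarith

/-- The defect of calibration controls the distance to the graph dynamics. -/
theorem quadratic_defect (q Q : EuclideanSpace ℝ (Fin d)) :
    A.α ^ 2 / (4 * A.curv ε) * ‖Q - A.graphMap ε (gradient w) q‖ ^ 2 ≤
      A.step ε q Q + κ - (w Q - w q) := by
  set Y := Q - A.graphMap ε (gradient w) q with hY
  -- Apply the subsolution inequality to the pair `(q + t • Y, Q)` and expand all terms to second
  -- order at `q`. The defect is at least `(t * α - curv * t ^ 2) ‖Y‖ ^ 2`, and this `t` maximizes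
  -- the coefficient.
  set t := A.α / (2 * A.curv ε) with ht
  have hC := A.curv_pos ε
  have hα := A.α_pos
  have h1 := hc.le (q + t • Y) Q
  have h2 := hc.upper hn q (t • Y)
  have h3 := A.h_upper (Q - q) (-(t • Y))
  have h4 := A.mul_G_upper ε q (t • Y)
  have h5 := A.H_mono (Q - q) (A.graphMap ε (gradient w) q - q)
  rw [sub_sub_sub_cancel_right, ← hY, A.H_graphMap_sub, inner_sub_left, inner_add_left] at h5
  rw [step] at h1 ⊢
  rw [← sub_eq_add_neg, sub_sub] at h3
  simp only [inner_neg_right, inner_smul_right, norm_neg, norm_smul, mul_pow, Real.norm_eq_abs,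
    sq_abs] at h2 h3 h4
  have h6 : A.α ^ 2 / (4 * A.curv ε) = t * A.α - A.curv ε * t ^ 2 := by
    rw [ht]; field_simp; ring
  have ht0 : 0 ≤ t := by positivity
  rw [h6, curv]
  nlinarith [mul_le_mul_of_nonneg_left h5 ht0]

/-- A Mather-type Lipschitz estimate. The defect of the pair `(q', T q)` is at most `curv * ‖q' - q‖
^ 2`, since it vanishes for `q' = q` and has a quadratic upper bound without linear term; it is at
least a multiple of `‖T q - T q'‖ ^ 2` by `quadratic_defect`. No regularity of the graph is assumed.
-/
theorem graphMap_lipschitz (q q' : EuclideanSpace ℝ (Fin d)) :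
    ‖A.graphMap ε (gradient w) q - A.graphMap ε (gradient w) q'‖ ≤
      2 * A.curv ε / A.α * ‖q - q'‖ := by
  have hC := A.curv_pos ε
  have hα := A.α_pos
  set T := A.graphMap ε (gradient w) with hT
  have h1 := hc.quadratic_defect hn q' (T q)
  have h2 := hc.graphMap_step hn q
  have h3 := hc.upper hn q (q' - q)
  have h4 := A.h_upper (T q - q) (-(q' - q))
  have h5 := A.mul_G_upper ε q (q' - q)
  have h6 : T q - q + -(q' - q) = T q - q' := by abel
  rw [← hT] at h1 h2
  rw [hT, A.H_graphMap_sub, ← hT, h6, inner_add_left] at h4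
  rw [add_sub_cancel] at h3 h5
  simp only [step] at h1 h2
  simp only [inner_neg_right, norm_neg] at h4
  have h7 : A.α ^ 2 / (4 * A.curv ε) * ‖T q - T q'‖ ^ 2 ≤ A.curv ε * ‖q' - q‖ ^ 2 := by
    refine h1.trans ?_
    conv_rhs => rw [curv]
    linarith
  rw [div_mul_eq_mul_div, div_le_iff₀ (by positivity)] at h7
  refine le_of_sq_le_sq ?_ (by positivity)
  rw [mul_pow, div_pow, div_mul_eq_mul_div, le_div_iff₀ (by positivity), norm_sub_rev q q']
  nlinarith

theorem continuous_graphMap : Continuous (A.graphMap ε (gradient w)) := by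
  have hC := A.curv_pos ε
  have hα := A.α_pos
  refine (LipschitzWith.of_dist_le_mul (K := (2 * A.curv ε / A.α).toNNReal)
    fun p p' => ?_).continuous
  rw [dist_eq_norm, dist_eq_norm, Real.coe_toNNReal _ (by positivity)]
  exact hc.graphMap_lipschitz hn p p'

theorem continuous_gradient : Continuous (gradient w) := by
  have h1 := hc.continuous_graphMap hn
  have h2 := A.continuous_H
  have h3 := A.continuous_g
  rw [funext (A.eq_H_graphMap_sub ε (gradient w))]
  fun_prop

omit hn

theorem action_ge (x : ℕ → EuclideanSpace ℝ (Fin d)) (N : ℕ) :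
    w (x N) - w (x 0) ≤ ∑ i ∈ Finset.range N, A.step ε (x i) (x (i + 1)) + N * κ := by
  rw [← Finset.sum_range_sub (fun i => w (x i)), ← nsmul_eq_mul, ← Finset.card_range N,
    ← Finset.sum_const, Finset.card_range, ← Finset.sum_add_distrib]
  exact Finset.sum_le_sum fun i _ => hc.le _ _

/-- The equalities telescope, and `shift` makes the total independent of `q`: all calibrated chains
have the same action. With `action_ge_of_eq` this is the minimal action in the class of chains from
a point to its translate by `m`. -/
theorem exists_action_eq (q : EuclideanSpace ℝ (Fin d)) :
    ∃ x : ℕ → EuclideanSpace ℝ (Fin d), x 0 = q ∧ x n = q + intVec ℝ m ∧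
      (∀ i < n, w (x (i + 1)) - w (x i) = A.step ε (x i) (x (i + 1)) + κ) ∧
      w (intVec ℝ m) - w 0 = ∑ i ∈ Finset.range n, A.step ε (x i) (x (i + 1)) + n * κ := by
  obtain ⟨x, h0, h1, hx⟩ := hc.chain q
  refine ⟨x, h0, h1, hx, ?_⟩
  have h2 := hc.shift m 0 q
  rw [zero_add] at h2
  rw [h2, ← h1, ← h0, ← Finset.sum_range_sub (fun i => w (x i)), ← nsmul_eq_mul,
    ← Finset.card_range n, ← Finset.sum_const, Finset.card_range, ← Finset.sum_add_distrib]
  exact Finset.sum_congr rfl fun i hi => hx i (Finset.mem_range.1 hi)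

theorem action_ge_of_eq {x : ℕ → EuclideanSpace ℝ (Fin d)} (hx : x n = x 0 + intVec ℝ m) :
    w (intVec ℝ m) - w 0 ≤ ∑ i ∈ Finset.range n, A.step ε (x i) (x (i + 1)) + n * κ := by
  have h1 := hc.action_ge x n
  have h2 := hc.shift m 0 (x 0)
  rw [zero_add, ← hx] at h2
  rwa [h2]

end IsCalibrated

end StandardFamily

/-! ### From periodic Lagrangian graphs to calibration. -/

namespace StandardFamily

variable {d : ℕ} (A : StandardFamily d) {m : Fin d → ℤ} {n : ℕ} {ε : ℝ}
  {w : EuclideanSpace ℝ (Fin d) → ℝ} {γ : EuclideanSpace ℝ (Fin d) → EuclideanSpace ℝ (Fin d)}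

theorem shift_of_hasGradientAt (hw : ∀ q, HasGradientAt w (γ q) q)
    (hper : ∀ (k : Fin d → ℤ) q, γ (q + intVec ℝ k) = γ q) (k : Fin d → ℤ)
    (q q' : EuclideanSpace ℝ (Fin d)) :
    w (q + intVec ℝ k) - w q = w (q' + intVec ℝ k) - w q' := by
  have h1 : ∀ y, HasFDerivAt (fun y => w (y + intVec ℝ k) - w y) (0 : _ →L[ℝ] ℝ) y := by
    intro y
    have h2 := (hw (y + intVec ℝ k)).comp_add_const
    rw [hper] at h2
    exact (h2.hasFDerivAt.sub (hw y).hasFDerivAt).congr_fderiv (sub_self _)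
  exact is_const_of_fderiv_eq_zero (𝕜 := ℝ) (fun y => (h1 y).differentiableAt)
    (fun y => (h1 y).fderiv) q q'

theorem abs_sub_le_of_norm_gradient_le {Γ : ℝ} {w : EuclideanSpace ℝ (Fin d) → ℝ}
    {γ : EuclideanSpace ℝ (Fin d) → EuclideanSpace ℝ (Fin d)}
    (hw : ∀ q, HasGradientAt w (γ q) q) (hΓ : ∀ q, ‖γ q‖ ≤ Γ) (q Q : EuclideanSpace ℝ (Fin d)) :
    |w Q - w q| ≤ Γ * ‖Q - q‖ := by
  have := Convex.norm_image_sub_le_of_norm_hasFDerivWithin_le (f := w) (C := Γ)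
    (fun x _ => (hw x).hasFDerivAt.hasFDerivWithinAt) (fun x _ => by
      rw [LinearIsometryEquiv.norm_map]; exact hΓ x) convex_univ (Set.mem_univ q)
    (Set.mem_univ Q)
  simpa using this

/-- Coercivity: the defect `S_ε(q, Q) - (w(Q) - w(q))` has a minimum. -/
theorem exists_min_defect (hw : ∀ q, HasGradientAt w (γ q) q) (hγ : Continuous γ)
    (hper : ∀ (k : Fin d → ℤ) q, γ (q + intVec ℝ k) = γ q) :
    ∃ q₀ Q₀, ∀ q Q, A.step ε q₀ Q₀ - (w Q₀ - w q₀) ≤ A.step ε q Q - (w Q - w q) := by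
  obtain ⟨Γ, hΓ0, hΓ⟩ := exists_norm_le_of_periodic hγ hper
  have hwlip := abs_sub_le_of_norm_gradient_le hw hΓ
  have hα := A.α_pos
  set K := ‖A.H 0‖ + Γ with hK
  have hK0 : 0 ≤ K := by positivity
  have hεG : ∀ q, |ε * A.G q| ≤ |ε| * A.B := fun q => by
    rw [abs_mul]; exact mul_le_mul_of_nonneg_left (A.G_bound q) (abs_nonneg ε)
  set c := ε * A.G 0 + |ε| * A.B with hc
  have hc0 : 0 ≤ c := by linarith [neg_le_of_abs_le (hεG 0)]
  -- Beyond `R` the convexity term `α / 2 * ‖v‖ ^ 2` dominates `K * ‖v‖ + c`, where `c ≤ c * ‖v‖`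
  -- because `R ≥ 1`. Minimization is thereby reduced to a compact set of pairs `(q, v)`.
  set R := max 1 (2 * (K + c) / A.α) with hR
  have hfar : ∀ q v : EuclideanSpace ℝ (Fin d), R < ‖v‖ →
      A.step ε 0 0 - (w 0 - w 0) ≤ A.step ε q (q + v) - (w (q + v) - w q) := by
    intro q v hv
    have h1 := A.h_lower 0 v
    have h2 := neg_le_of_abs_le ((abs_real_inner_le_norm (A.H 0) v))
    have h3 := neg_le_of_abs_le (hεG q)
    have h4 := le_of_abs_le (hwlip q (q + v))
    rw [add_sub_cancel_left] at h4
    have h5 : 1 ≤ ‖v‖ := (le_max_left _ _).trans hv.le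
    have h6 : 2 * (K + c) / A.α ≤ ‖v‖ := (le_max_right _ _).trans hv.le
    rw [div_le_iff₀ hα] at h6
    rw [zero_add] at h1
    simp only [step, sub_self, sub_zero, add_sub_cancel_left]
    nlinarith
  have hcont : Continuous w := continuous_iff_continuousAt.2 fun q => (hw q).continuousAt
  have hcont2 : Continuous fun z : EuclideanSpace ℝ (Fin d) × EuclideanSpace ℝ (Fin d) =>
      A.step ε z.1 (z.1 + z.2) - (w (z.1 + z.2) - w z.1) := by
    have := A.continuous_h
    have := A.continuous_G
    simp only [step]
    fun_prop
  obtain ⟨⟨q₀, v₀⟩, -, hmin⟩ := ((isCompact_closedBall (0 : EuclideanSpace ℝ (Fin d)) (√d)).prod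
    (isCompact_closedBall (0 : EuclideanSpace ℝ (Fin d)) R)).exists_isMinOn
    ⟨(0, 0), by simp [hR, Real.sqrt_nonneg]⟩ hcont2.continuousOn
  refine ⟨q₀, q₀ + v₀, fun q Q => ?_⟩
  obtain ⟨k, hk⟩ := exists_add_intVec_mem_closedBall q
  have hshift := shift_of_hasGradientAt hw hper k q Q
  by_cases hv : ‖Q - q‖ ≤ R
  · have := hmin (Set.mk_mem_prod hk (mem_closedBall_zero_iff.2 hv))
    simp only [Set.mem_ofPred_eq] at this
    have e : q + intVec ℝ k + (Q - q) = Q + intVec ℝ k := by abel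
    rw [e, step_add_intVec] at this
    linarith
  · have h0 := hmin (show ((0, 0) : EuclideanSpace ℝ (Fin d) × EuclideanSpace ℝ (Fin d)) ∈ _ by
      simp [hR, Real.sqrt_nonneg])
    have h1 := hfar q (Q - q) (not_le.1 hv)
    simp only [Set.mem_ofPred_eq, add_zero] at h0
    rw [add_sub_cancel] at h1
    exact h0.trans h1

/-- An invariant Lagrangian graph that consists of periodic points is calibrated. -/
theorem exists_isCalibrated_of_graph (hw : ∀ q, HasGradientAt w (γ q) q) (hγ : Continuous γ)
    (hper : ∀ (k : Fin d → ℤ) q, γ (q + intVec ℝ k) = γ q)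
    (hinv : ∀ q, γ (A.graphMap ε γ q) = γ q + ε • A.g q)
    (hit : ∀ q, (A.graphMap ε γ)^[n] q = q + intVec ℝ m)
    (hlip : ∀ q, (fun q' => A.graphMap ε γ q' - A.graphMap ε γ q) =O[𝓝 q] fun q' => q' - q) :
    ∃ κ, A.IsCalibrated m n ε w κ := by
  set T := A.graphMap ε γ with hT
  obtain ⟨q₀, Q₀, hmin⟩ := A.exists_min_defect (ε := ε) hw hγ hper
  -- Criticality in the variable `q` alone reads `H (Q₀ - q₀) = γ q₀ + ε • g q₀`, which determines
  -- `Q₀`.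
  have hQ₀ : Q₀ = T q₀ := by
    have h1 := ((A.hasGradientAt_step_left ε q₀ Q₀).add' (hw q₀)).add_const' (-w Q₀)
    have h2 : IsLocalMin (fun q => A.step ε q Q₀ + w q + -w Q₀) q₀ :=
      Filter.Eventually.of_forall fun q => by
        have := hmin q Q₀
        simp only
        linarith
    have h3 := (map_eq_zero_iff _ (InnerProductSpace.toDual ℝ _).injective).1
      (h2.hasFDerivAt_eq_zero h1.hasFDerivAt)
    have h4 : A.H (Q₀ - q₀) = γ q₀ + ε • A.g q₀ := by
      have : γ q₀ + ε • A.g q₀ = A.H (Q₀ - q₀) + (-A.H (Q₀ - q₀) + ε • A.g q₀ + γ q₀) := by abel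
      rw [this, h3, add_zero]
    rw [hT, graphMap, ← h4, A.L_H]
    abel
  have hTcont : Continuous T := by
    have := A.continuous_L
    have := A.continuous_g
    rw [hT]
    unfold graphMap
    fun_prop
  -- The full differential of the defect vanishes at `(q, T q)`: the first component by definition
  -- of `T`, the second by invariance of the graph. As `T` satisfies a local Lipschitz bound at `q`,
  -- the composite has derivative zero there without `T` being differentiable.
  have hderiv : ∀ q, HasFDerivAt (fun q => A.step ε q (T q) - (w (T q) - w q))
      (0 : _ →L[ℝ] ℝ) q := by
    intro q
    have h1 : HasFDerivAt (fun z : EuclideanSpace ℝ (Fin d) × EuclideanSpace ℝ (Fin d) =>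
        A.step ε z.1 z.2 - (w z.2 - w z.1)) (0 : _ →L[ℝ] ℝ) (q, T q) := by
      have a1 := (A.hasGradientAt_h (T q - q)).hasFDerivAt.comp
        (f := fun z : EuclideanSpace ℝ (Fin d) × EuclideanSpace ℝ (Fin d) => z.2 - z.1) (q, T q)
        ((hasFDerivAt_snd (𝕜 := ℝ) (p := (q, T q))).sub (hasFDerivAt_fst (𝕜 := ℝ)))
      have a2 := (A.hasGradientAt_G q).hasFDerivAt.comp (q, T q)
        (hasFDerivAt_fst (𝕜 := ℝ) (p := (q, T q)))
      have a3 := (hw (T q)).hasFDerivAt.comp (q, T q)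
        (hasFDerivAt_snd (𝕜 := ℝ) (p := (q, T q)))
      have a4 := (hw q).hasFDerivAt.comp (q, T q)
        (hasFDerivAt_fst (𝕜 := ℝ) (p := (q, T q)))
      refine ((a1.add (a2.const_mul ε)).sub (a3.sub a4)).congr_fderiv ?_
      ext v
      · simp [hT, A.H_graphMap_sub]
      · simp [hT, A.H_graphMap_sub, ← hinv]
    have h2 := h1.isLittleO.comp_tendsto
      (show Tendsto (fun q' => (q', T q')) (𝓝 q) (𝓝 (q, T q)) from
        (continuous_id.prodMk hTcont).continuousAt)
    have h3 : (fun q' => ((q', T q') : EuclideanSpace ℝ (Fin d) × EuclideanSpace ℝ (Fin d)) -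
        (q, T q)) =O[𝓝 q] fun q' => q' - q :=
      (Asymptotics.isBigO_refl _ _).prod_left (hlip q)
    have h4 := h2.trans_isBigO h3
    refine HasFDerivAt.of_isLittleO (h4.congr_left fun q' => ?_)
    simp
  have hconst : ∀ q q', A.step ε q (T q) - (w (T q) - w q) =
      A.step ε q' (T q') - (w (T q') - w q') :=
    is_const_of_fderiv_eq_zero (𝕜 := ℝ) (fun q => (hderiv q).differentiableAt)
      (fun q => (hderiv q).fderiv)
  -- The defect is constant along `T` and equals its global minimum at `q₀`; `κ` is minus that
  -- minimum.
  refine ⟨-(A.step ε q₀ (T q₀) - (w (T q₀) - w q₀)), shift_of_hasGradientAt hw hper,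
    fun q Q => ?_, fun q => ⟨fun i => T^[i] q, rfl, hit q, fun i _ => ?_⟩⟩
  · have := hmin q Q
    rw [hQ₀] at this
    linarith
  · have := hconst q₀ (T^[i] q)
    simp only [Function.iterate_succ_apply']
    linarith

end StandardFamily

/-! ### Dependence on the parameter and closedness of calibration. -/

namespace StandardFamily

variable {d : ℕ} (A : StandardFamily d)

/-- The parameters for which the family is calibrated by periodic chains of type `(m, n)`. -/
def calibratedSet (m : Fin d → ℤ) (n : ℕ) : Set ℝ := {ε | ∃ w κ, A.IsCalibrated m n ε w κ}

variable {A} {m : Fin d → ℤ} {n : ℕ} {ε ε' : ℝ} {w w' : EuclideanSpace ℝ (Fin d) → ℝ} {κ κ' : ℝ}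

theorem abs_sum_step_sub_le (x : ℕ → EuclideanSpace ℝ (Fin d)) (n : ℕ) (ε ε' : ℝ) :
    |∑ i ∈ Finset.range n, A.step ε' (x i) (x (i + 1)) -
      ∑ i ∈ Finset.range n, A.step ε (x i) (x (i + 1))| ≤ n * (A.B * |ε' - ε|) := by
  rw [← Finset.sum_sub_distrib]
  refine (Finset.abs_sum_le_sum_abs _ _).trans ?_
  calc _ ≤ ∑ i ∈ Finset.range n, A.B * |ε' - ε| := Finset.sum_le_sum fun i _ => by
        rw [step, step, add_sub_add_left_eq_sub, ← sub_mul, abs_mul, mul_comm]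
        exact mul_le_mul_of_nonneg_right (A.G_bound _) (abs_nonneg _)
    _ = _ := by simp

/-- The excess of the action over its minimum is the sum of the nonnegative defects of the links, so
it bounds the defect of the first link, which is quadratic in the distance to the graph dynamics. -/
theorem IsCalibrated.sq_norm_first_sub_le (hc : A.IsCalibrated m n ε w κ) (hn : 0 < n)
    {x : ℕ → EuclideanSpace ℝ (Fin d)} (hx : x n = x 0 + intVec ℝ m) :
    A.α ^ 2 / (4 * A.curv ε) * ‖x 1 - A.graphMap ε (gradient w) (x 0)‖ ^ 2 ≤
      ∑ i ∈ Finset.range n, A.step ε (x i) (x (i + 1)) + n * κ - (w (intVec ℝ m) - w 0) := by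
  refine (hc.quadratic_defect hn (x 0) (x 1)).trans ?_
  have h5 := Finset.single_le_sum (s := Finset.range n)
    (f := fun i => A.step ε (x i) (x (i + 1)) + κ - (w (x (i + 1)) - w (x i)))
    (fun i _ => by have := hc.le (x i) (x (i + 1)); linarith) (Finset.mem_range.2 hn)
  simp only [zero_add] at h5
  rw [Finset.sum_sub_distrib, Finset.sum_add_distrib, Finset.sum_range_sub (fun i => w (x i)),
    Finset.sum_const, Finset.card_range, nsmul_eq_mul, hx] at h5
  have h6 := hc.shift m (x 0) 0
  rw [zero_add] at h6
  linarith

namespace IsCalibrated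

variable (hc : A.IsCalibrated m n ε w κ) (hc' : A.IsCalibrated m n ε' w' κ') (hn : 0 < n)

include hc hc' hn

/-- The chain through `q` that is minimal for `ε'` is nearly minimal for `ε`: changing the parameter
along it and along a minimal chain for `ε` costs at most `n * B * |ε' - ε|` each time. -/
theorem sq_norm_graphMap_sub_le (q : EuclideanSpace ℝ (Fin d)) :
    A.α ^ 2 / (4 * A.curv ε) *
      ‖A.graphMap ε' (gradient w') q - A.graphMap ε (gradient w) q‖ ^ 2 ≤
      2 * n * A.B * |ε' - ε| := by
  obtain ⟨x, hx0, hxn, hx, hxa⟩ := hc'.exists_action_eq q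
  obtain ⟨y, hy0, hyn, -, hya⟩ := hc.exists_action_eq q
  have h1 := hc'.action_ge_of_eq (x := y) (by rw [hyn, hy0])
  have h2 := abs_sum_step_sub_le (A := A) x n ε ε'
  have h3 := abs_sum_step_sub_le (A := A) y n ε ε'
  rw [abs_le] at h2 h3
  have hx1 : x 1 = A.graphMap ε' (gradient w') q := by
    have := hc'.eq_graphMap hn (hx 0 hn)
    rwa [hx0, zero_add] at this
  have h4 := hc.sq_norm_first_sub_le hn (x := x) (by rw [hxn, hx0])
  rw [hx0] at h4
  rw [← hx1]
  linarith

/-- Hölder dependence on the parameter with exponent one half, valid for all pairs of parameters. It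
provides both continuity near `ε` and a bound far from it. -/
theorem norm_gradient_sub_le' (q : EuclideanSpace ℝ (Fin d)) :
    ‖gradient w' q - gradient w q‖ ≤
      A.β * √(8 * n * A.B * A.curv ε / A.α ^ 2 * |ε' - ε|) + A.B * |ε' - ε| := by
  have hC := A.curv_pos ε
  have hα := A.α_pos
  have hβ := A.β_pos
  have h1 := hc.sq_norm_graphMap_sub_le hc' hn q
  have h2 : ‖A.graphMap ε' (gradient w') q - A.graphMap ε (gradient w) q‖ ≤
      √(8 * n * A.B * A.curv ε / A.α ^ 2 * |ε' - ε|) := by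
    refine Real.le_sqrt_of_sq_le ?_
    rw [div_mul_eq_mul_div, div_le_iff₀ (by positivity)] at h1
    rw [div_mul_eq_mul_div, le_div_iff₀ (by positivity)]
    linarith
  have h3 : gradient w' q - gradient w q =
      (A.H (A.graphMap ε' (gradient w') q - q) - A.H (A.graphMap ε (gradient w) q - q)) -
        (ε' - ε) • A.g q := by
    rw [H_graphMap_sub, H_graphMap_sub, sub_smul]
    abel
  rw [h3]
  refine (norm_sub_le _ _).trans (add_le_add ?_ ?_)
  · refine (A.H_lipschitz _ _).trans ?_
    rw [sub_sub_sub_cancel_right]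
    gcongr
  · rw [norm_smul, Real.norm_eq_abs, mul_comm]
    exact mul_le_mul_of_nonneg_right (A.g_bound q) (abs_nonneg _)

end IsCalibrated

theorem IsCalibrated.eventually_norm_gradient_sub_lt (hc : A.IsCalibrated m n ε w κ) (hn : 0 < n)
    {ρ : ℝ} (hρ : 0 < ρ) : ∀ᶠ ε' in 𝓝 ε, ∀ w' κ', A.IsCalibrated m n ε' w' κ' →
      ∀ q, ‖gradient w' q - gradient w q‖ < ρ := by
  have h1 : Tendsto (fun ε' : ℝ => A.β * √(8 * n * A.B * A.curv ε / A.α ^ 2 * |ε' - ε|) +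
      A.B * |ε' - ε|) (𝓝 ε) (𝓝 0) := by
    have : Continuous (fun ε' : ℝ => A.β * √(8 * n * A.B * A.curv ε / A.α ^ 2 * |ε' - ε|) +
      A.B * |ε' - ε|) := by fun_prop
    simpa using this.tendsto ε
  filter_upwards [h1.eventually (gt_mem_nhds hρ)] with ε' h w' κ' hc' q
  exact (hc.norm_gradient_sub_le' hc' hn q).trans_lt h

theorem exists_tendsto_of_bounded {ι F : Type*} [NormedAddCommGroup F] [ProperSpace F]
    (U : Ultrafilter ι) (f : ι → F) (C : ℝ) (hf : ∀ᶠ i in (U : Filter ι), ‖f i‖ ≤ C) :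
    ∃ x, Tendsto f U (𝓝 x) := by
  obtain ⟨x, -, hx⟩ := (isCompact_closedBall (0 : F) C).ultrafilter_le_nhds' (U.map f)
    (show f ⁻¹' Metric.closedBall 0 C ∈ (U : Filter ι) by
      filter_upwards [hf] with i hi
      simpa using hi)
  exact ⟨x, hx⟩

/-- Along a convergent sequence of parameters the gradients are uniformly bounded, so the normalized
functions `w - w 0`, the constants and the chains converge along an ultrafilter, and the relations
of calibration pass to the limit. -/
theorem isClosed_calibratedSet (hn : 0 < n) : IsClosed (A.calibratedSet m n) := by
  rw [← closure_subset_iff_isClosed]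
  intro ε₀ hε₀
  obtain ⟨ε₁, w₁, κ₁, hc₁⟩ := closure_nonempty_iff.1 ⟨ε₀, hε₀⟩
  have hne : (𝓝[A.calibratedSet m n] ε₀).NeBot := mem_closure_iff_nhdsWithin_neBot.1 hε₀
  set U := Ultrafilter.of (𝓝[A.calibratedSet m n] ε₀) with hU
  have hUle : (U : Filter ℝ) ≤ 𝓝[A.calibratedSet m n] ε₀ := Ultrafilter.of_le _
  have hchoice : ∀ ε : ℝ, ∃ (w : EuclideanSpace ℝ (Fin d) → ℝ) (κ : ℝ),
      ε ∈ A.calibratedSet m n → A.IsCalibrated m n ε w κ := fun ε => by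
    by_cases h : ε ∈ A.calibratedSet m n
    · obtain ⟨w, κ, hc⟩ := h
      exact ⟨w, κ, fun _ => hc⟩
    · exact ⟨0, 0, fun h' => absurd h' h⟩
  choose w κ hwκ using hchoice
  have hid : Tendsto (fun ε : ℝ => ε) U (𝓝 ε₀) := hUle.trans nhdsWithin_le_nhds
  have hcal : ∀ᶠ ε in (U : Filter ℝ), A.IsCalibrated m n ε (w ε) (κ ε) := by
    have : ∀ᶠ ε in (U : Filter ℝ), ε ∈ A.calibratedSet m n := hUle self_mem_nhdsWithin
    filter_upwards [this] with ε hε using hwκ ε hε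
  have hnear : ∀ᶠ ε in (U : Filter ℝ), |ε - ε₀| < 1 := by
    have : Tendsto (fun ε : ℝ => |ε - ε₀|) U (𝓝 |ε₀ - ε₀|) :=
      ((continuous_id.sub continuous_const).abs.tendsto ε₀).comp hid
    rw [sub_self, abs_zero] at this
    exact this.eventually (gt_mem_nhds one_pos)
  have hα := A.α_pos
  have hβ := A.β_pos
  have hB := A.B_nonneg
  -- One fixed calibrated parameter `ε₁`, possibly far from `ε₀`, serves as reference for the
  -- uniform gradient bound.
  obtain ⟨Γ₁, hΓ₁0, hΓ₁⟩ := exists_norm_le_of_periodic (hc₁.continuous_gradient hn)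
    (hc₁.gradient_periodic hn)
  set Δ := |ε₀ - ε₁| + 1 with hΔ
  set Γ := (A.β * √(8 * n * A.B * A.curv ε₁ / A.α ^ 2 * Δ) + A.B * Δ) + Γ₁ with hΓ
  have hΓ0 : 0 ≤ Γ := by positivity
  have hgrad : ∀ᶠ ε in (U : Filter ℝ), ∀ q, ‖gradient (w ε) q‖ ≤ Γ := by
    filter_upwards [hcal, hnear] with ε hc hε q
    have h1 := hc₁.norm_gradient_sub_le' hc hn q
    have h2 : |ε - ε₁| ≤ Δ := by
      have := abs_add_le (ε - ε₀) (ε₀ - ε₁)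
      rw [sub_add_sub_cancel] at this
      linarith
    have hC := A.curv_pos ε₁
    have h3 : ‖gradient (w ε) q - gradient w₁ q‖ ≤
        A.β * √(8 * n * A.B * A.curv ε₁ / A.α ^ 2 * Δ) + A.B * Δ := by
      refine h1.trans ?_
      gcongr
    calc ‖gradient (w ε) q‖ = ‖(gradient (w ε) q - gradient w₁ q) + gradient w₁ q‖ := by
          rw [sub_add_cancel]
      _ ≤ _ := (norm_add_le _ _).trans (add_le_add h3 (hΓ₁ q))
  have hlip : ∀ᶠ ε in (U : Filter ℝ), ∀ q Q, |w ε Q - w ε q| ≤ Γ * ‖Q - q‖ := by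
    filter_upwards [hcal, hgrad] with ε hc hg
    exact abs_sub_le_of_norm_gradient_le (hc.hasGradientAt hn) hg
  set T : ℝ → EuclideanSpace ℝ (Fin d) → EuclideanSpace ℝ (Fin d) :=
    fun ε => A.graphMap ε (gradient (w ε)) with hT
  set R := ‖A.L 0‖ + A.α⁻¹ * (Γ + (|ε₀| + 1) * A.B) with hR
  have hεabs : ∀ ε, |ε - ε₀| < 1 → |ε| ≤ |ε₀| + 1 := fun ε hε => by
    have := abs_add_le (ε - ε₀) ε₀
    rw [sub_add_cancel] at this
    linarith
  have hdisp : ∀ᶠ ε in (U : Filter ℝ), ∀ q, ‖T ε q - q‖ ≤ R := by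
    filter_upwards [hgrad, hnear] with ε hg hε q
    simp only [hT, graphMap, add_sub_cancel_left]
    have h1 := A.L_lipschitz (gradient (w ε) q + ε • A.g q) 0
    have h2 : ‖gradient (w ε) q + ε • A.g q‖ ≤ Γ + (|ε₀| + 1) * A.B := by
      refine (norm_add_le _ _).trans (add_le_add (hg q) ?_)
      rw [norm_smul, Real.norm_eq_abs]
      have := hεabs ε hε
      have := A.g_bound q
      gcongr
    rw [sub_zero] at h1
    have h3 : ‖A.L (gradient (w ε) q + ε • A.g q)‖ ≤
        ‖A.L 0‖ + ‖A.L (gradient (w ε) q + ε • A.g q) - A.L 0‖ := by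
      simpa using norm_add_le (A.L 0) (A.L (gradient (w ε) q + ε • A.g q) - A.L 0)
    refine h3.trans (add_le_add_right (h1.trans ?_) _)
    gcongr
  have hWex : ∀ q, ∃ y, Tendsto (fun ε => w ε q - w ε 0) U (𝓝 y) := fun q =>
    exists_tendsto_of_bounded U _ (Γ * ‖q - 0‖) (by
      filter_upwards [hlip] with ε h using h 0 q)
  choose W hW using hWex
  have hXex : ∀ q i, ∃ x, Tendsto (fun ε => (T ε)^[i] q) U (𝓝 x) := fun q i =>
    exists_tendsto_of_bounded U _ (‖q‖ + i * R) (by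
      filter_upwards [hdisp] with ε h
      induction i with
      | zero => simp
      | succ i ih =>
        rw [Function.iterate_succ_apply']
        have h1 := h ((T ε)^[i] q)
        have h2 := norm_add_le ((T ε)^[i] q) (T ε ((T ε)^[i] q) - (T ε)^[i] q)
        rw [add_sub_cancel] at h2
        push_cast
        linarith)
  choose X hX using hXex
  have hstep : ∀ {a b : ℝ → EuclideanSpace ℝ (Fin d)} {a₀ b₀ : EuclideanSpace ℝ (Fin d)},
      Tendsto a U (𝓝 a₀) → Tendsto b U (𝓝 b₀) →
      Tendsto (fun ε => A.step ε (a ε) (b ε)) U (𝓝 (A.step ε₀ a₀ b₀)) := by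
    intro a b a₀ b₀ ha hb
    exact ((A.continuous_h.tendsto _).comp (hb.sub ha)).add
      (hid.mul ((A.continuous_G.tendsto _).comp ha))
  have hWmove : ∀ {a : ℝ → EuclideanSpace ℝ (Fin d)} {a₀ : EuclideanSpace ℝ (Fin d)},
      Tendsto a U (𝓝 a₀) → Tendsto (fun ε => w ε (a ε) - w ε 0) U (𝓝 (W a₀)) := by
    intro a a₀ ha
    have h1 : Tendsto (fun ε => w ε (a ε) - w ε a₀) U (𝓝 0) := by
      refine squeeze_zero_norm' (a := fun ε => Γ * ‖a ε - a₀‖) ?_ ?_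
      · filter_upwards [hlip] with ε h using h a₀ (a ε)
      · have := (ha.sub_const a₀).norm.const_mul Γ
        simpa using this
    have := h1.add (hW a₀)
    simpa using this
  -- The constant is recovered from the calibrated link that starts at `0`, so its convergence
  -- follows from that of `w` and of the chain.
  have hκeq : ∀ᶠ ε in (U : Filter ℝ),
      (w ε (T ε 0) - w ε 0) - A.step ε 0 (T ε 0) = κ ε := by
    filter_upwards [hcal] with ε hc
    have := hc.graphMap_step hn 0
    simp only [hT]
    linarith
  have hκ : Tendsto κ U (𝓝 (W (X 0 1) - A.step ε₀ 0 (X 0 1))) :=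
    ((hWmove (hX 0 1)).sub (hstep tendsto_const_nhds (hX 0 1))).congr' hκeq
  refine ⟨W, W (X 0 1) - A.step ε₀ 0 (X 0 1), ?_, ?_, ?_⟩
  · intro k q q'
    refine tendsto_nhds_unique ((hW (q + intVec ℝ k)).sub (hW q))
      (((hW (q' + intVec ℝ k)).sub (hW q')).congr' ?_)
    filter_upwards [hcal] with ε hc
    have := hc.shift k q q'
    linarith
  · intro q Q
    refine le_of_tendsto_of_tendsto ((hW Q).sub (hW q))
      ((hstep (a₀ := q) (b₀ := Q) tendsto_const_nhds tendsto_const_nhds).add hκ) ?_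
    filter_upwards [hcal] with ε hc
    have := hc.le q Q
    linarith
  · intro q
    refine ⟨X q, ?_, ?_, fun i _ => ?_⟩
    · exact tendsto_nhds_unique (hX q 0) tendsto_const_nhds
    · refine tendsto_nhds_unique (hX q n) (tendsto_const_nhds.congr' ?_)
      filter_upwards [hcal] with ε hc using (hc.graphMap_iterate hn q).symm
    · refine tendsto_nhds_unique ((hWmove (hX q (i + 1))).sub (hWmove (hX q i)))
        (((hstep (hX q i) (hX q (i + 1))).add hκ).congr' ?_)
      filter_upwards [hcal] with ε hc
      have := hc.graphMap_step hn ((T ε)^[i] q)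
      simp only [Function.iterate_succ_apply']
      linarith

end StandardFamily

/-! ### Potentials of continuous fields with vanishing loop integrals. -/

section Potential

variable {V : Type*} [NormedAddCommGroup V] [InnerProductSpace ℝ V] [CompleteSpace V]

/-- A smooth step from `0` to `1` on `[-1/2, 1/2]`. -/
noncomputable def smoothStep (z : ℝ) : ℝ := Real.smoothTransition (z + 1 / 2)

theorem contDiff_smoothStep : ContDiff ℝ 1 smoothStep :=
  Real.smoothTransition.contDiff.comp (contDiff_id.add contDiff_const)

theorem smoothStep_eq_one {z : ℝ} (h : 1 / 2 ≤ z) : smoothStep z = 1 :=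
  Real.smoothTransition.one_of_one_le (by linarith)

theorem smoothStep_eq_zero {z : ℝ} (h : z ≤ -(1 / 2)) : smoothStep z = 0 :=
  Real.smoothTransition.zero_of_nonpos (by linarith)

theorem half_lt_cos {θ : ℝ} (h : |θ| ≤ Real.pi / 4) : 1 / 2 < Real.cos θ := by
  have h1 := Real.cos_le_cos_of_nonneg_of_le_pi (abs_nonneg θ) (by linarith [Real.pi_pos]) h
  rw [Real.cos_abs, Real.cos_pi_div_four] at h1
  have h2 : 1 < √2 := by
    rw [Real.lt_sqrt] <;> norm_num
  linarith

theorem integral_inner_deriv_of_segment {γ : V → V} (hγ : Continuous γ) {ν : ℝ → V} {s : ℝ → ℝ}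
    (hs : ContDiff ℝ 1 s) {t₀ t₁ : ℝ} (a e : V)
    (h : ∀ t ∈ Set.uIcc t₀ t₁, ν =ᶠ[𝓝 t] fun t => a + s t • e) :
    ∫ t in t₀..t₁, inner ℝ (γ (ν t)) (deriv ν t) =
      ∫ r in s t₀..s t₁, inner ℝ (γ (a + r • e)) e := by
  have h1 := intervalIntegral.integral_comp_mul_deriv (a := t₀) (b := t₁) (f := s) (f' := deriv s)
    (g := fun r => inner ℝ (γ (a + r • e)) e)
    (fun t _ => (hs.differentiable one_ne_zero t).hasDerivAt)
    (hs.continuous_deriv le_rfl).continuousOn (by fun_prop)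
  rw [← h1]
  refine intervalIntegral.integral_congr fun t ht => ?_
  have h2 : HasDerivAt (fun t => a + s t • e) (deriv s t • e) t :=
    ((hs.differentiable one_ne_zero t).hasDerivAt.smul_const e).const_add a
  simp only [(h t ht).deriv_eq, h2.deriv, (h t ht).eq_of_nhds, inner_smul_right,
    Function.comp_apply]
  ring

/-- If the integral of `γ` along every `C¹` loop vanishes, so does its integral along triangles. -/
theorem integral_triangle {γ : V → V} (hγ : Continuous γ)
    (hloop : ∀ ν : ℝ → V, ContDiff ℝ 1 ν → Function.Periodic ν 1 →
      ∫ t in (0 : ℝ)..1, inner ℝ (γ (ν t)) (deriv ν t) = 0) (b c : V) :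
    ∫ r in (0 : ℝ)..1, inner ℝ (γ (b + r • (c - b))) (c - b) =
      (∫ r in (0 : ℝ)..1, inner ℝ (γ (r • c)) c) - ∫ r in (0 : ℝ)..1, inner ℝ (γ (r • b)) b := by
  -- The pair `(x, y)` runs around the boundary of the unit square and moves one coordinate at a
  -- time. Under `(x, y) ↦ x • (b + y • (c - b))` the side `x = 0` collapses to the origin, so `ν`
  -- is a `C¹` parametrization of the triangle `0, b, c` that stops at the vertices.
  set x : ℝ → ℝ := fun t => smoothStep (Real.cos (2 * Real.pi * t)) with hx
  set y : ℝ → ℝ := fun t => smoothStep (Real.sin (2 * Real.pi * t)) with hy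
  have hxd : ContDiff ℝ 1 x :=
    contDiff_smoothStep.comp (Real.contDiff_cos.comp (contDiff_const.mul contDiff_id))
  have hyd : ContDiff ℝ 1 y :=
    contDiff_smoothStep.comp (Real.contDiff_sin.comp (contDiff_const.mul contDiff_id))
  set ν : ℝ → V := fun t => x t • (b + y t • (c - b)) with hν
  have hνd : ContDiff ℝ 1 ν := hxd.smul (contDiff_const.add (hyd.smul contDiff_const))
  have hper : Function.Periodic ν 1 := by
    intro t
    simp only [hν, hx, hy, mul_add, mul_one, Real.cos_add_two_pi, Real.sin_add_two_pi]
  have hπ := Real.pi_pos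
  have hcos : ∀ t : ℝ, |t| ≤ 1 / 8 → 1 / 2 < Real.cos (2 * Real.pi * t) := fun t ht => by
    refine half_lt_cos ?_
    rw [abs_mul, abs_of_pos (by positivity : 0 < 2 * Real.pi)]
    nlinarith
  have hcc : Continuous fun t : ℝ => Real.cos (2 * Real.pi * t) := by fun_prop
  have hsc : Continuous fun t : ℝ => Real.sin (2 * Real.pi * t) := by fun_prop
  have hx1 : ∀ t : ℝ, |t| ≤ 1 / 8 → ∀ᶠ s in 𝓝 t, x s = 1 := fun t ht => by
    filter_upwards [hcc.continuousAt.eventually (lt_mem_nhds (hcos t ht))] with s hs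
    exact smoothStep_eq_one hs.le
  have hy1 : ∀ t : ℝ, |t - 1 / 4| ≤ 1 / 8 → ∀ᶠ s in 𝓝 t, y s = 1 := fun t ht => by
    have h1 := hcos _ ht
    rw [show 2 * Real.pi * (t - 1 / 4) = 2 * Real.pi * t - Real.pi / 2 by ring,
      Real.cos_sub_pi_div_two] at h1
    filter_upwards [hsc.continuousAt.eventually (lt_mem_nhds h1)] with s hs
    exact smoothStep_eq_one hs.le
  have hx0 : ∀ t : ℝ, |t - 1 / 2| ≤ 1 / 8 → ∀ᶠ s in 𝓝 t, x s = 0 := fun t ht => by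
    have h1 := hcos _ ht
    rw [show 2 * Real.pi * (t - 1 / 2) = 2 * Real.pi * t - Real.pi by ring,
      Real.cos_sub_pi, lt_neg] at h1
    filter_upwards [hcc.continuousAt.eventually (gt_mem_nhds h1)] with s hs
    exact smoothStep_eq_zero hs.le
  have hy0 : ∀ t : ℝ, |t - 3 / 4| ≤ 1 / 8 → ∀ᶠ s in 𝓝 t, y s = 0 := fun t ht => by
    have h1 := hcos _ ht
    rw [show 2 * Real.pi * (t - 3 / 4) = 2 * Real.pi * t + Real.pi / 2 - 2 * Real.pi by ring,
      Real.cos_sub_two_pi, Real.cos_add_pi_div_two, lt_neg] at h1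
    filter_upwards [hsc.continuousAt.eventually (gt_mem_nhds h1)] with s hs
    exact smoothStep_eq_zero hs.le
  have hint : Continuous fun t => inner ℝ (γ (ν t)) (deriv ν t) :=
    (hγ.comp hνd.continuous).inner (hνd.continuous_deriv le_rfl)
  have hperint : Function.Periodic (fun t => (inner ℝ (γ (ν t)) (deriv ν t) : ℝ)) 1 := by
    intro t
    have : deriv ν (t + 1) = deriv ν t := by
      rw [← deriv_comp_add_const]
      exact congrArg (fun f => deriv f t) (funext hper)
    simp only [hper t, this]
  have hyper : ∀ t, y (t + 1) = y t := fun t => by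
    simp only [hy, mul_add, mul_one, Real.sin_add_two_pi]
  have h0 := hloop ν hνd hper
  -- Starting the period at `-1/8` makes the four quarter periods correspond to the sides of the
  -- square: `b` to `c`, `c` to `0`, rest at `0`, `0` to `b`.
  have hshift := hperint.intervalIntegral_add_eq 0 (-(1 / 8))
  rw [zero_add, h0] at hshift
  have ii : ∀ u v : ℝ, IntervalIntegrable (fun t => (inner ℝ (γ (ν t)) (deriv ν t) : ℝ))
    MeasureTheory.volume u v := fun u v => hint.intervalIntegrable u v
  rw [← intervalIntegral.integral_add_adjacent_intervals (ii _ (1 / 8)) (ii (1 / 8) _),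
    ← intervalIntegral.integral_add_adjacent_intervals (ii (1 / 8) (3 / 8)) (ii (3 / 8) _),
    ← intervalIntegral.integral_add_adjacent_intervals (ii (3 / 8) (5 / 8)) (ii (5 / 8) _)]
    at hshift
  have s1 : ∫ t in (-(1 / 8) : ℝ)..1 / 8, inner ℝ (γ (ν t)) (deriv ν t) =
      ∫ r in y (-(1 / 8))..y (1 / 8), inner ℝ (γ (b + r • (c - b))) (c - b) := by
    refine integral_inner_deriv_of_segment hγ hyd _ _ fun t ht => ?_
    rw [Set.uIcc_of_le (by norm_num)] at ht
    filter_upwards [hx1 t (abs_le.2 ht)] with s hs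
    simp only [hν, hs, one_smul]
  have s2 : ∫ t in (1 / 8 : ℝ)..3 / 8, inner ℝ (γ (ν t)) (deriv ν t) =
      ∫ r in x (1 / 8)..x (3 / 8), inner ℝ (γ (0 + r • c)) c := by
    refine integral_inner_deriv_of_segment hγ hxd _ _ fun t ht => ?_
    rw [Set.uIcc_of_le (by norm_num)] at ht
    filter_upwards [hy1 t (abs_le.2 ⟨by linarith [ht.1], by linarith [ht.2]⟩)] with s hs
    simp only [hν, hs, one_smul, add_sub_cancel, zero_add]
  have s3 : ∫ t in (3 / 8 : ℝ)..5 / 8, inner ℝ (γ (ν t)) (deriv ν t) =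
      ∫ r in (0 : ℝ)..0, inner ℝ (γ (0 + r • c)) c := by
    refine integral_inner_deriv_of_segment (s := fun _ => 0) hγ contDiff_const _ _ fun t ht => ?_
    rw [Set.uIcc_of_le (by norm_num)] at ht
    filter_upwards [hx0 t (abs_le.2 ⟨by linarith [ht.1], by linarith [ht.2]⟩)] with s hs
    simp only [hν, hs, zero_smul, add_zero]
  have s4 : ∫ t in (5 / 8 : ℝ)..(-(1 / 8) + 1), inner ℝ (γ (ν t)) (deriv ν t) =
      ∫ r in x (5 / 8)..x (-(1 / 8) + 1), inner ℝ (γ (0 + r • b)) b := by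
    refine integral_inner_deriv_of_segment hγ hxd _ _ fun t ht => ?_
    rw [Set.uIcc_of_le (by norm_num)] at ht
    filter_upwards [hy0 t (abs_le.2 ⟨by linarith [ht.1], by linarith [ht.2]⟩)] with s hs
    simp only [hν, hs, zero_smul, add_zero, zero_add]
  have hxper : x (-(1 / 8) + 1) = x (-(1 / 8)) := by
    simp only [hx, mul_add, mul_one, Real.cos_add_two_pi]
  have v1 : y (1 / 8) = 1 := (hy1 _ (by rw [abs_le]; norm_num)).self_of_nhds
  have v2 : y (-(1 / 8)) = 0 := by
    rw [← hyper]; exact (hy0 _ (by rw [abs_le]; norm_num)).self_of_nhds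
  have v3 : x (1 / 8) = 1 := (hx1 _ (by rw [abs_le]; norm_num)).self_of_nhds
  have v4 : x (3 / 8) = 0 := (hx0 _ (by rw [abs_le]; norm_num)).self_of_nhds
  have v5 : x (5 / 8) = 0 := (hx0 _ (by rw [abs_le]; norm_num)).self_of_nhds
  have v6 : x (-(1 / 8)) = 1 := (hx1 _ (by rw [abs_le]; norm_num)).self_of_nhds
  rw [s1, s2, s3, s4, hxper, v1, v2, v3, v4, v5, v6, intervalIntegral.integral_same,
    intervalIntegral.integral_symm 0 1] at hshift
  simp only [zero_add] at hshift
  linarith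

/-- A continuous field whose integral along every `C¹` loop vanishes is a gradient. -/
theorem exists_potential_of_loops {γ : V → V} (hγ : Continuous γ)
    (hloop : ∀ ν : ℝ → V, ContDiff ℝ 1 ν → Function.Periodic ν 1 →
      ∫ t in (0 : ℝ)..1, inner ℝ (γ (ν t)) (deriv ν t) = 0) :
    ∃ w : V → ℝ, ∀ q, HasGradientAt w (γ q) q := by
  refine ⟨fun q => ∫ r in (0 : ℝ)..1, inner ℝ (γ (r • q)) q, fun b => ?_⟩
  rw [hasGradientAt_iff_isLittleO, Asymptotics.isLittleO_iff]
  intro η hη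
  obtain ⟨δ, hδ, hball⟩ := Metric.continuousAt_iff.1 (hγ.continuousAt (x := b)) η hη
  filter_upwards [Metric.ball_mem_nhds b hδ] with c hc
  rw [← integral_triangle hγ hloop b c]
  have h1 : (inner ℝ (γ b) (c - b) : ℝ) = ∫ r in (0 : ℝ)..1, inner ℝ (γ b) (c - b) := by simp
  have i1 : Continuous fun r : ℝ => (inner ℝ (γ (b + r • (c - b))) (c - b) : ℝ) := by fun_prop
  rw [h1, ← intervalIntegral.integral_sub (i1.intervalIntegrable _ _)
    (continuous_const.intervalIntegrable _ _)]
  have := intervalIntegral.norm_integral_le_of_norm_le_const (a := (0 : ℝ)) (b := 1)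
    (C := η * ‖c - b‖)
    (f := fun r : ℝ => (inner ℝ (γ (b + r • (c - b))) (c - b) - inner ℝ (γ b) (c - b) : ℝ)) ?_
  · simpa using this
  · intro r hr
    rw [Set.uIoc_of_le zero_le_one] at hr
    rw [← inner_sub_left]
    refine (norm_inner_le_norm _ _).trans (mul_le_mul_of_nonneg_right ?_ (norm_nonneg _))
    rw [← dist_eq_norm]
    refine (hball ?_).le
    rw [dist_eq_norm, add_sub_cancel_left, norm_smul, Real.norm_eq_abs, abs_of_pos hr.1]
    rw [mem_ball_iff_norm] at hc
    exact (mul_le_of_le_one_left (norm_nonneg _) hr.2).trans_lt hc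

end Potential

/-! ### Twist of the iterates for small parameters. -/

namespace StandardFamily

variable {d : ℕ} (A : StandardFamily d)

/-- At `ε = 0` momenta are conserved. Each kick alters their difference by at most `|ε| * M` times
the difference of positions, so over `n` steps the deviation remains of order `|ε|`. -/
theorem exists_iterate_bound (n : ℕ) : ∃ C, 0 ≤ C ∧ ∀ i ≤ n, ∀ ε : ℝ, |ε| ≤ 1 →
    ∀ q p p' : EuclideanSpace ℝ (Fin d),
      ‖((A.map ε)^[i] (q, p)).1 - ((A.map ε)^[i] (q, p')).1‖ ≤ C * ‖p - p'‖ ∧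
      ‖((A.map ε)^[i] (q, p)).2 - ((A.map ε)^[i] (q, p')).2 - (p - p')‖ ≤ |ε| * (C * ‖p - p'‖) := by
  have hα := A.α_pos
  have hM := A.M_nonneg
  induction n with
  | zero =>
    refine ⟨0, le_rfl, fun i hi ε _ q p p' => ?_⟩
    obtain rfl : i = 0 := by omega
    simp
  | succ n ih =>
    obtain ⟨C, hC0, hC⟩ := ih
    refine ⟨C + A.M * C + A.α⁻¹ * (1 + C + A.M * C), by positivity, fun i hi ε hε q p p' => ?_⟩
    have hu := norm_nonneg (p - p')
    have hle : C ≤ C + A.M * C + A.α⁻¹ * (1 + C + A.M * C) := by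
      have : 0 ≤ A.M * C + A.α⁻¹ * (1 + C + A.M * C) := by positivity
      linarith
    rcases Nat.lt_or_ge n i with hin | hin
    · obtain rfl : i = n + 1 := by omega
      obtain ⟨h1, h2⟩ := hC n le_rfl ε hε q p p'
      rw [Function.iterate_succ_apply', Function.iterate_succ_apply']
      set x := (A.map ε)^[n] (q, p)
      set x' := (A.map ε)^[n] (q, p')
      have h3 : ‖(x.2 + ε • A.g x.1) - (x'.2 + ε • A.g x'.1) - (p - p')‖ ≤
          |ε| * ((C + A.M * C) * ‖p - p'‖) := by
        have e : (x.2 + ε • A.g x.1) - (x'.2 + ε • A.g x'.1) - (p - p') =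
            (x.2 - x'.2 - (p - p')) + ε • (A.g x.1 - A.g x'.1) := by
          rw [smul_sub]; abel
        rw [e]
        refine (norm_add_le _ _).trans ?_
        rw [norm_smul, Real.norm_eq_abs]
        have h4 := (A.g_lipschitz x.1 x'.1).trans (mul_le_mul_of_nonneg_left h1 hM)
        have h5 := mul_le_mul_of_nonneg_left h4 (abs_nonneg ε)
        nlinarith
      have h4 : ‖(x.2 + ε • A.g x.1) - (x'.2 + ε • A.g x'.1)‖ ≤
          (1 + C + A.M * C) * ‖p - p'‖ := by
        have h5 := norm_add_le ((x.2 + ε • A.g x.1) - (x'.2 + ε • A.g x'.1) - (p - p')) (p - p')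
        rw [sub_add_cancel] at h5
        have h6 : |ε| * ((C + A.M * C) * ‖p - p'‖) ≤ (C + A.M * C) * ‖p - p'‖ :=
          mul_le_of_le_one_left (by positivity) hε
        linarith
      constructor
      · simp only [map]
        have e : x.1 + A.L (x.2 + ε • A.g x.1) - (x'.1 + A.L (x'.2 + ε • A.g x'.1)) =
            (x.1 - x'.1) + (A.L (x.2 + ε • A.g x.1) - A.L (x'.2 + ε • A.g x'.1)) := by abel
        rw [e]
        refine (norm_add_le _ _).trans ?_
        have h5 := (A.L_lipschitz (x.2 + ε • A.g x.1) (x'.2 + ε • A.g x'.1)).trans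
          (mul_le_mul_of_nonneg_left h4 (inv_nonneg.2 hα.le))
        have h6 : 0 ≤ A.M * C * ‖p - p'‖ := by positivity
        nlinarith
      · simp only [map]
        refine h3.trans
          (mul_le_mul_of_nonneg_left (mul_le_mul_of_nonneg_right ?_ hu) (abs_nonneg _))
        have : 0 ≤ A.α⁻¹ * (1 + C + A.M * C) := by positivity
        linarith
    · obtain ⟨h1, h2⟩ := hC i hin ε hε q p p'
      exact ⟨h1.trans (by gcongr), h2.trans (by gcongr)⟩

/-- The twist condition for the iterates of the maps with small parameter. -/
theorem exists_pos_iterate_injective {n : ℕ} (hn : 0 < n) : ∃ ε₁ > 0, ∀ ε : ℝ, |ε| < ε₁ →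
    ∀ q p p' : EuclideanSpace ℝ (Fin d),
      ((A.map ε)^[n] (q, p)).1 = ((A.map ε)^[n] (q, p')).1 → p = p' := by
  obtain ⟨C, hC0, hC⟩ := A.exists_iterate_bound n
  have hα := A.α_pos
  have hβ := A.β_pos
  set c := A.α / A.β ^ 2 with hc
  have hc0 : 0 < c := by positivity
  -- With `δ ≤ 1 / 2`, momentum differences stay between `u / 2` and `3 * u / 2`. With `δ ≤ c * α /
  -- 12`, the error `α⁻¹ * (3 / 2 * u) * (δ * u)` is at most `c / 8 * u ^ 2`, half of the gain `c /
  -- 4 * u ^ 2` per step.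
  set δ := min (1 / 2) (c * A.α / 12) with hδ
  have hδ0 : 0 < δ := by positivity
  refine ⟨min 1 (δ / (C + 1)), by positivity, fun ε hε q p p' heq => ?_⟩
  have hε1 : |ε| ≤ 1 := (hε.trans_le (min_le_left _ _)).le
  have hεC : |ε| * C ≤ δ := by
    have h1 := (hε.trans_le (min_le_right _ _)).le
    rw [le_div_iff₀ (by positivity)] at h1
    nlinarith [abs_nonneg ε]
  have hδ1 : δ ≤ 1 / 2 := min_le_left _ _
  have hδ2 : δ ≤ c * A.α / 12 := min_le_right _ _
  set u := ‖p - p'‖ with hu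
  have hu0 : 0 ≤ u := norm_nonneg _
  have key : ∀ i ≤ n, i * (c / 8 * u ^ 2) ≤
      ⟪((A.map ε)^[i] (q, p)).1 - ((A.map ε)^[i] (q, p')).1, p - p'⟫ := by
    intro i
    induction i with
    | zero => simp
    | succ i ih =>
      intro hi
      obtain ⟨-, h2⟩ := hC (i + 1) hi ε hε1 q p p'
      have h1 := ih (by omega)
      rw [Function.iterate_succ_apply', Function.iterate_succ_apply'] at h2 ⊢
      set x := (A.map ε)^[i] (q, p)
      set x' := (A.map ε)^[i] (q, p')
      simp only [map] at h2 ⊢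
      set P := x.2 + ε • A.g x.1
      set P' := x'.2 + ε • A.g x'.1
      have e : x.1 + A.L P - (x'.1 + A.L P') = (x.1 - x'.1) + (A.L P - A.L P') := by abel
      have h3 := A.L_mono P P'
      have h4 := A.L_lipschitz P P'
      have h5 : ‖P - P' - (p - p')‖ ≤ δ * u := by
        refine h2.trans ?_
        rw [← mul_assoc]
        gcongr
      have h6 : ‖P - P'‖ ≤ 3 / 2 * u := by
        have := norm_add_le (P - P' - (p - p')) (p - p')
        rw [sub_add_cancel] at this
        nlinarith
      have h7 : 1 / 2 * u ≤ ‖P - P'‖ := by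
        have := norm_sub_norm_le (p - p') (p - p' - (P - P'))
        rw [sub_sub_cancel, norm_sub_rev (p - p')] at this
        nlinarith
      have h8 := neg_le_of_abs_le (abs_real_inner_le_norm (A.L P - A.L P') (p - p' - (P - P')))
      rw [norm_sub_rev (p - p')] at h8
      have h9 : ‖A.L P - A.L P'‖ * ‖P - P' - (p - p')‖ ≤ c / 8 * u ^ 2 := by
        calc _ ≤ (A.α⁻¹ * (3 / 2 * u)) * ((c * A.α / 12) * u) :=
              mul_le_mul (h4.trans (by gcongr)) (h5.trans (by gcongr)) (norm_nonneg _)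
                (by positivity)
          _ = _ := by field_simp; ring
      have h10 : c * (1 / 4 * u ^ 2) ≤ c * ‖P - P'‖ ^ 2 := by
        refine mul_le_mul_of_nonneg_left ?_ hc0.le
        nlinarith
      rw [e, inner_add_left]
      rw [inner_sub_right _ (p - p')] at h8
      push_cast
      linarith
  have h1 := key n le_rfl
  rw [heq, sub_self, inner_zero_left] at h1
  have hn' : (0 : ℝ) < n := by exact_mod_cast hn
  have h2 : u ^ 2 ≤ 0 := by
    by_contra h
    push Not at h
    have : 0 < n * (c / 8 * u ^ 2) := by positivity
    linarith
  have h3 : u = 0 := by nlinarith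
  exact sub_eq_zero.1 (norm_eq_zero.1 h3)

theorem map_graph (ε : ℝ) {γ : EuclideanSpace ℝ (Fin d) → EuclideanSpace ℝ (Fin d)}
    (hinv : ∀ q, γ (A.graphMap ε γ q) = γ q + ε • A.g q) (i : ℕ) (q : EuclideanSpace ℝ (Fin d)) :
    (A.map ε)^[i] (q, γ q) = ((A.graphMap ε γ)^[i] q, γ ((A.graphMap ε γ)^[i] q)) := by
  induction i with
  | zero => rfl
  | succ i ih =>
    rw [Function.iterate_succ_apply', Function.iterate_succ_apply', ih, hinv]
    rfl

/-- For small parameters, a Lipschitz Lagrangian periodic graph is calibrated. -/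
theorem exists_pos_mem_calibratedSet (m : Fin d → ℤ) {n : ℕ} (hn : 0 < n) :
    ∃ ε₁ > 0, ∀ ε : ℝ, |ε| < ε₁ → HasLipschitzLagrangianPeriodicGraph (A.map ε) m n →
      ε ∈ A.calibratedSet m n := by
  obtain ⟨ε₁, hε₁, hinj⟩ := A.exists_pos_iterate_injective hn
  refine ⟨ε₁, hε₁, fun ε hε ⟨γ, ⟨K, hK⟩, hlag, hper⟩ => ?_⟩
  obtain ⟨w, hw⟩ := exists_potential_of_loops hper.continuous hlag
  -- The point of the graph above `T q` and the image of `(q, γ q)` have the same position, and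
  -- after `n` steps both have position `T q + m`. Injectivity in the momentum identifies them.
  have hinv : ∀ q, γ (A.graphMap ε γ q) = γ q + ε • A.g q := by
    intro q
    refine hinj ε hε (A.graphMap ε γ q) _ _ ?_
    have h1 : A.map ε (q, γ q) = (A.graphMap ε γ q, γ q + ε • A.g q) := rfl
    rw [hper.iterate, ← h1, ← Function.iterate_succ_apply, Function.iterate_succ_apply',
      hper.iterate, A.map_add_intVec, h1]
  have hit : ∀ q, (A.graphMap ε γ)^[n] q = q + intVec ℝ m := fun q => by
    have := hper.iterate q
    rw [A.map_graph ε hinv] at this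
    exact congrArg Prod.fst this
  obtain ⟨κ, hκ⟩ := A.exists_isCalibrated_of_graph hw hper.continuous hper.periodic hinv hit
    (fun q => by
      refine Asymptotics.IsBigO.of_bound (1 + A.α⁻¹ * (K + |ε| * A.M))
        (Filter.Eventually.of_forall fun q' => ?_)
      have e : A.graphMap ε γ q' - A.graphMap ε γ q = (q' - q) +
          (A.L (γ q' + ε • A.g q') - A.L (γ q + ε • A.g q)) := by
        simp only [graphMap]; abel
      have e2 : γ q' + ε • A.g q' - (γ q + ε • A.g q) = (γ q' - γ q) + ε • (A.g q' - A.g q) := by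
        rw [smul_sub]; abel
      have h1 := A.L_lipschitz (γ q' + ε • A.g q') (γ q + ε • A.g q)
      have h2 : ‖γ q' - γ q‖ ≤ K * ‖q' - q‖ := by
        simpa [dist_eq_norm] using hK.dist_le_mul q' q
      have h3 : ‖γ q' + ε • A.g q' - (γ q + ε • A.g q)‖ ≤ (K + |ε| * A.M) * ‖q' - q‖ := by
        rw [e2]
        refine (norm_add_le _ _).trans ?_
        rw [norm_smul, Real.norm_eq_abs]
        have := mul_le_mul_of_nonneg_left (A.g_lipschitz q' q) (abs_nonneg ε)
        linarith
      have h4 := h1.trans (mul_le_mul_of_nonneg_left h3 (inv_nonneg.2 A.α_pos.le))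
      rw [e]
      have := norm_add_le (q' - q) (A.L (γ q' + ε • A.g q') - A.L (γ q + ε • A.g q))
      linarith)
  exact ⟨w, κ, hκ⟩

end StandardFamily

/-! ### Periodic implicit function theorem and identity theorem. -/

section Implicit

variable {d : ℕ}

/-- A nondegenerate periodic family of zeros persists, smoothly in the parameters. -/
theorem exists_periodic_implicit
    {Θ : (ℝ × EuclideanSpace ℝ (Fin d)) × EuclideanSpace ℝ (Fin d) → EuclideanSpace ℝ (Fin d)}
    (hΘ : ContDiff ℝ ω Θ)
    (hΘper : ∀ ε (k : Fin d → ℤ) q p, Θ ((ε, q + intVec ℝ k), p) = Θ ((ε, q), p)) {ε₀ : ℝ}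
    {γ : EuclideanSpace ℝ (Fin d) → EuclideanSpace ℝ (Fin d)} (hγ : Continuous γ)
    (hper : ∀ (k : Fin d → ℤ) q, γ (q + intVec ℝ k) = γ q) (hzero : ∀ q, Θ ((ε₀, q), γ q) = 0)
    (hnd : ∀ q η, fderiv ℝ Θ ((ε₀, q), γ q) (0, η) = 0 → η = 0) :
    ∃ ρ > 0, ∃ Γ : ℝ × EuclideanSpace ℝ (Fin d) → EuclideanSpace ℝ (Fin d),
      (∀ ε (k : Fin d → ℤ) q, Γ (ε, q + intVec ℝ k) = Γ (ε, q)) ∧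
      ∀ᶠ ε in 𝓝 ε₀, ∀ q, ContDiffAt ℝ ω Γ (ε, q) ∧ Θ ((ε, q), Γ (ε, q)) = 0 ∧
        ∀ p, ‖p - γ q‖ < ρ → Θ ((ε, q), p) = 0 → p = Γ (ε, q) := by
  have hinv : ∀ q, (fderiv ℝ Θ ((ε₀, q), γ q) ∘L
      .inr ℝ (ℝ × EuclideanSpace ℝ (Fin d)) (EuclideanSpace ℝ (Fin d))).IsInvertible := by
    intro q
    set D := fderiv ℝ Θ ((ε₀, q), γ q) ∘L
      .inr ℝ (ℝ × EuclideanSpace ℝ (Fin d)) (EuclideanSpace ℝ (Fin d)) with hD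
    have hker : Function.Injective (D : EuclideanSpace ℝ (Fin d) →ₗ[ℝ] EuclideanSpace ℝ (Fin d)) :=
      (injective_iff_map_eq_zero _).2 fun η hη => hnd q η (by simpa [hD] using hη)
    refine ⟨(LinearEquiv.ofInjectiveEndo _ hker).toContinuousLinearEquiv, ?_⟩
    ext η
    rfl
  have hone : (ω : WithTop ℕ∞) ≠ 0 := by simp
  set ψ := fun q => (hΘ.contDiffAt (x := ((ε₀, q), γ q))).implicitFunction hone (hinv q) with hψ
  have hψself : ∀ q, ψ q (ε₀, q) = γ q := fun q =>
    (hΘ.contDiffAt (x := ((ε₀, q), γ q))).implicitFunction_apply_self hone (hinv q)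
  have hψd : ∀ q, ContDiffAt ℝ ω (ψ q) (ε₀, q) := fun q =>
    (hΘ.contDiffAt (x := ((ε₀, q), γ q))).contDiffAt_implicitFunction hone (hinv q)
  have hψzero : ∀ q, ∀ᶠ z in 𝓝 (ε₀, q), Θ (z, ψ q z) = 0 := fun q => by
    have := (hΘ.contDiffAt (x := ((ε₀, q), γ q))).eventually_apply_implicitFunction hone (hinv q)
    rwa [hzero] at this
  have hψuniq : ∀ q, ∀ᶠ v in 𝓝 ((ε₀, q), γ q), Θ v = 0 ↔ ψ q v.1 = v.2 := fun q => by
    have := (hΘ.contDiffAt (x := ((ε₀, q), γ q))).eventually_apply_eq_iff_implicitFunction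
      hone (hinv q)
    rwa [hzero] at this
  -- Local uniqueness is made uniform in `q`: two zeros close to `γ q` coincide, with a radius
  -- independent of `q` by compactness modulo the lattice.
  have huniq : ∀ᶠ x : ℝ × EuclideanSpace ℝ (Fin d) × EuclideanSpace ℝ (Fin d) in 𝓝 (ε₀, 0, 0),
      ∀ q, Θ ((x.1, q), γ q + x.2.1) = 0 → Θ ((x.1, q), γ q + x.2.2) = 0 → x.2.1 = x.2.2 := by
    refine eventually_forall_of_periodic (P := fun (x : ℝ × EuclideanSpace ℝ (Fin d) × EuclideanSpace ℝ (Fin d))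
      q => Θ ((x.1, q), γ q + x.2.1) = 0 →
      Θ ((x.1, q), γ q + x.2.2) = 0 → x.2.1 = x.2.2) (fun x k q => ?_) fun q => ?_
    · simp only [hΘper, hper]
      exact id
    · have c1 : Tendsto (fun z : (ℝ × EuclideanSpace ℝ (Fin d) × EuclideanSpace ℝ (Fin d)) ×
          EuclideanSpace ℝ (Fin d) => ((z.1.1, z.2), γ z.2 + z.1.2.1)) (𝓝 ((ε₀, 0, 0), q))
          (𝓝 ((ε₀, q), γ q)) := by
        have : Continuous (fun z : (ℝ × EuclideanSpace ℝ (Fin d) × EuclideanSpace ℝ (Fin d)) ×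
          EuclideanSpace ℝ (Fin d) => ((z.1.1, z.2), γ z.2 + z.1.2.1)) := by fun_prop
        simpa using this.tendsto ((ε₀, 0, 0), q)
      have c2 : Tendsto (fun z : (ℝ × EuclideanSpace ℝ (Fin d) × EuclideanSpace ℝ (Fin d)) ×
          EuclideanSpace ℝ (Fin d) => ((z.1.1, z.2), γ z.2 + z.1.2.2)) (𝓝 ((ε₀, 0, 0), q))
          (𝓝 ((ε₀, q), γ q)) := by
        have : Continuous (fun z : (ℝ × EuclideanSpace ℝ (Fin d) × EuclideanSpace ℝ (Fin d)) ×
          EuclideanSpace ℝ (Fin d) => ((z.1.1, z.2), γ z.2 + z.1.2.2)) := by fun_prop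
        simpa using this.tendsto ((ε₀, 0, 0), q)
      filter_upwards [c1.eventually (hψuniq q), c2.eventually (hψuniq q)] with z h1 h2 h3 h4
      have h5 := h1.1 h3
      have h6 := h2.1 h4
      exact add_left_cancel (h5.symm.trans h6)
  obtain ⟨ρ, hρ, hball⟩ := Metric.eventually_nhds_iff.1 huniq
  have huniq' : ∀ ε, dist ε ε₀ < ρ → ∀ q p p', ‖p - γ q‖ < ρ → ‖p' - γ q‖ < ρ →
      Θ ((ε, q), p) = 0 → Θ ((ε, q), p') = 0 → p = p' := by
    intro ε hε q p p' hp hp' h h'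
    have := hball (y := (ε, p - γ q, p' - γ q)) (by
      simp only [Prod.dist_eq, dist_zero_right]
      exact max_lt hε (max_lt hp hp')) q
    simp only [add_sub_cancel] at this
    exact sub_left_injective (this h h')
  -- A choice that depends only on a periodic predicate is itself periodic. Smoothness comes from
  -- agreement with the local implicit functions, by uniqueness.
  set Γ : ℝ × EuclideanSpace ℝ (Fin d) → EuclideanSpace ℝ (Fin d) :=
    fun z => Classical.epsilon fun p => ‖p - γ z.2‖ < ρ ∧ Θ (z, p) = 0 with hΓ
  have hΓper : ∀ ε (k : Fin d → ℤ) q, Γ (ε, q + intVec ℝ k) = Γ (ε, q) := fun ε k q => by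
    simp only [hΓ, hper, hΘper]
  have hex : ∀ q, ∀ᶠ z : ℝ × EuclideanSpace ℝ (Fin d) in 𝓝 (ε₀, q),
      ‖ψ q z - γ z.2‖ < ρ ∧ Θ (z, ψ q z) = 0 := fun q => by
    have c1 : ContinuousAt (fun z : ℝ × EuclideanSpace ℝ (Fin d) => ‖ψ q z - γ z.2‖) (ε₀, q) :=
      ((hψd q).continuousAt.sub (hγ.comp continuous_snd).continuousAt).norm
    have c2 : ‖ψ q (ε₀, q) - γ (ε₀, q).2‖ < ρ := by rw [hψself, sub_self, norm_zero]; exact hρ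
    exact (c1.eventually (gt_mem_nhds c2)).and (hψzero q)
  have hΓspec : ∀ᶠ ε in 𝓝 ε₀, ∀ q, ‖Γ (ε, q) - γ q‖ < ρ ∧ Θ ((ε, q), Γ (ε, q)) = 0 := by
    refine eventually_forall_of_periodic
      (P := fun ε q => ‖Γ (ε, q) - γ q‖ < ρ ∧ Θ ((ε, q), Γ (ε, q)) = 0) (fun ε k q => ?_) fun q => ?_
    · simp only [hΓper, hper, hΘper]
      exact id
    · filter_upwards [hex q] with z hz
      exact Classical.epsilon_spec (p := fun p => ‖p - γ z.2‖ < ρ ∧ Θ (z, p) = 0) ⟨_, hz⟩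
  have hΓd : ∀ᶠ ε in 𝓝 ε₀, ∀ q, ContDiffAt ℝ ω Γ (ε, q) := by
    refine eventually_forall_of_periodic (P := fun ε q => ContDiffAt ℝ ω Γ (ε, q))
      (fun ε k q h => ?_) fun q => ?_
    · have h2 : Γ = Γ ∘ fun z => (z.1, z.2 + intVec ℝ k) := by
        funext z
        exact (hΓper z.1 k z.2).symm
      rw [h2]
      exact ContDiffAt.comp (ε, q) h
        (contDiffAt_fst.prodMk (contDiffAt_snd.add contDiffAt_const))
    · have h1 : Γ =ᶠ[𝓝 (ε₀, q)] ψ q := by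
        have c1 : ∀ᶠ z : ℝ × EuclideanSpace ℝ (Fin d) in 𝓝 (ε₀, q), dist z.1 ε₀ < ρ :=
          (continuous_fst.tendsto (ε₀, q)).eventually (Metric.ball_mem_nhds ε₀ hρ)
        filter_upwards [hex q, c1] with z hz hz1
        have := Classical.epsilon_spec (p := fun p => ‖p - γ z.2‖ < ρ ∧ Θ (z, p) = 0) ⟨_, hz⟩
        exact huniq' z.1 hz1 z.2 _ _ this.1 hz.1 this.2 hz.2
      exact ((hψd q).congr_of_eventuallyEq h1).eventually (by simp)
  refine ⟨ρ, hρ, Γ, hΓper, ?_⟩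
  filter_upwards [hΓspec, hΓd, Metric.ball_mem_nhds ε₀ hρ] with ε h1 h2 h3 q
  exact ⟨h2 q, (h1 q).2, fun p hp hp0 => huniq' ε h3 q _ _ hp (h1 q).1 hp0 (h1 q).2⟩

/-- The identity theorem, for a function that vanishes on a set accumulating at the centre. -/
theorem eq_zero_of_accPt {F : Type*} [NormedAddCommGroup F] [NormedSpace ℝ F] {f : ℝ → F}
    {ε₀ δ : ℝ} (hδ : 0 < δ) {E : Set ℝ} (hE : AccPt ε₀ (𝓟 E))
    (hf : ∀ ε ∈ Metric.ball ε₀ δ, ContDiffAt ℝ ω f ε)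
    (h0 : ∀ ε ∈ Metric.ball ε₀ δ, ε ∈ E → f ε = 0) : ∀ ε ∈ Metric.ball ε₀ δ, f ε = 0 := by
  have h1 : AnalyticOnNhd ℝ f (Metric.ball ε₀ δ) := fun ε hε => (hf ε hε).analyticAt
  refine h1.eqOn_zero_of_preconnected_of_frequently_eq_zero
    (convex_ball ε₀ δ).isPreconnected (Metric.mem_ball_self hδ) ?_
  rw [accPt_iff_frequently_nhdsNE] at hE
  have h2 : ∀ᶠ ε in 𝓝[≠] ε₀, ε ∈ Metric.ball ε₀ δ :=
    nhdsWithin_le_nhds (Metric.ball_mem_nhds ε₀ hδ)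
  exact (hE.and_eventually h2).mono fun ε h => h0 ε h.2 h.1

end Implicit

/-! ### Absence of conjugate points. -/

namespace StandardFamily

variable {d : ℕ} {A : StandardFamily d} {m : Fin d → ℤ} {n : ℕ} {ε : ℝ}
  {w : EuclideanSpace ℝ (Fin d) → ℝ} {κ : ℝ}

theorem contDiff_map_iterate (hL : ContDiff ℝ ω A.L) (hg : ContDiff ℝ ω A.g) (i : ℕ) :
    ContDiff ℝ ω (fun z : ℝ × (EuclideanSpace ℝ (Fin d) × EuclideanSpace ℝ (Fin d)) =>
      (A.map z.1)^[i] z.2) := by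
  induction i with
  | zero => exact contDiff_snd
  | succ i ih =>
    simp only [Function.iterate_succ_apply']
    unfold map
    fun_prop

set_option maxHeartbeats 1000000 in
/-- Along a calibrated graph there are no conjugate points: the position after `n` steps depends
on the initial momentum in a nondegenerate way. -/
theorem IsCalibrated.eq_zero_of_hasDerivAt (hL : ContDiff ℝ ω A.L) (hg : ContDiff ℝ ω A.g)
    (hc : A.IsCalibrated m n ε w κ) (hn : 0 < n) (q η : EuclideanSpace ℝ (Fin d))
    (hη : HasDerivAt (fun s : ℝ => ((A.map ε)^[n] (q, gradient w q + s • η)).1) 0 0) : η = 0 := by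
  set T := A.graphMap ε (gradient w) with hT
  set O : ℕ → ℝ → EuclideanSpace ℝ (Fin d) × EuclideanSpace ℝ (Fin d) :=
    fun i s => (A.map ε)^[i] (q, gradient w q + s • η) with hO
  have hOd : ∀ i, Differentiable ℝ (O i) := fun i => by
    have h1 := (contDiff_map_iterate hL hg i).differentiable (by simp)
    have h2 : Differentiable ℝ fun s : ℝ => (ε, (q, gradient w q + s • η)) := by fun_prop
    exact h1.comp h2
  -- `ξ` and `ζ` are the variations of position and momentum: a discrete Jacobi field along the
  -- orbit with `ξ 0 = ξ n = 0` and `ζ 0 = η`.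
  set ξ : ℕ → EuclideanSpace ℝ (Fin d) := fun i => deriv (fun s => (O i s).1) 0 with hξ
  set ζ : ℕ → EuclideanSpace ℝ (Fin d) := fun i => deriv (fun s => (O i s).2) 0 with hζ
  have hξd : ∀ i, HasDerivAt (fun s => (O i s).1) (ξ i) 0 := fun i =>
    ((hOd i).fst 0).hasDerivAt
  have hζd : ∀ i, HasDerivAt (fun s => (O i s).2) (ζ i) 0 := fun i =>
    ((hOd i).snd 0).hasDerivAt
  have hO0 : ∀ i, O i 0 = (T^[i] q, gradient w (T^[i] q)) := fun i => by
    simp only [hO, zero_smul, add_zero]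
    exact A.map_graph ε (hc.gradient_graphMap hn) i q
  have hOsucc : ∀ i s, O (i + 1) s = A.map ε (O i s) := fun i s =>
    Function.iterate_succ_apply' _ _ _
  have hgd : ∀ x, HasFDerivAt A.g (fderiv ℝ A.g x) x := fun x =>
    (hg.differentiable (by simp) x).hasFDerivAt
  have hHd : ∀ x, HasFDerivAt A.H (fderiv ℝ A.H x) x := fun x =>
    (A.contDiff_H.differentiable one_ne_zero x).hasFDerivAt
  have hξ0 : ξ 0 = 0 := (hξd 0).unique (hasDerivAt_const _ _)
  have hζ0 : ζ 0 = η := by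
    refine (hζd 0).unique ?_
    simpa [hO] using ((hasDerivAt_id (0 : ℝ)).smul_const η).const_add (gradient w q)
  have hξn : ξ n = 0 := (hξd n).unique hη
  have hζsucc : ∀ i, ζ (i + 1) = ζ i + ε • fderiv ℝ A.g (T^[i] q) (ξ i) := by
    intro i
    have h1 : HasDerivAt (fun s => A.g (O i s).1) (fderiv ℝ A.g (T^[i] q) (ξ i)) 0 := by
      have := hgd (O i 0).1
      rw [hO0] at this
      exact HasFDerivAt.comp_hasDerivAt_of_eq (0 : ℝ) this (hξd i) (by rw [hO0])
    refine (hζd (i + 1)).unique (((hζd i).add (h1.const_smul ε)).congr_of_eventuallyEq ?_)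
    exact Filter.Eventually.of_forall fun s => by simp only [hOsucc, map]; rfl
  have hξsucc : ∀ i, fderiv ℝ A.H (T^[i + 1] q - T^[i] q) (ξ (i + 1) - ξ i) = ζ (i + 1) := by
    intro i
    have h1 : HasDerivAt (fun s => A.H ((O (i + 1) s).1 - (O i s).1))
        (fderiv ℝ A.H (T^[i + 1] q - T^[i] q) (ξ (i + 1) - ξ i)) 0 :=
      HasFDerivAt.comp_hasDerivAt_of_eq (0 : ℝ) (hHd _) ((hξd (i + 1)).sub (hξd i))
        (by simp only [hO0])
    refine h1.unique ((hζd (i + 1)).congr_of_eventuallyEq ?_)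
    exact Filter.Eventually.of_forall fun s => by
      simp only [hOsucc, map, add_sub_cancel_left, A.H_L]
  set c := A.α ^ 2 / (4 * A.curv ε) with hcdef
  have hc0 : 0 < c := by
    have := A.curv_pos ε
    have := A.α_pos
    positivity
  set x : ℕ → EuclideanSpace ℝ (Fin d) := fun i => T^[i] q with hx
  have hxn : x n = x 0 + intVec ℝ m := hc.graphMap_iterate hn q
  have hzd : ∀ i s, HasDerivAt (fun s : ℝ => x i + s • ξ i) (ξ i) s := fun i s => by
    simpa using ((hasDerivAt_id s).smul_const (ξ i)).const_add (x i)
  -- The action of the chain varied along the Jacobi field, minus the quadratic excess forced by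
  -- `sq_norm_first_sub_le`. It has a minimum at `s = 0`, so its second derivative there is
  -- nonnegative.
  set f : ℝ → ℝ := fun s => ∑ i ∈ Finset.range n,
    A.step ε (x i + s • ξ i) (x (i + 1) + s • ξ (i + 1)) - c * ‖ξ 1‖ ^ 2 * s ^ 2 with hf
  set f' : ℝ → ℝ := fun s => ∑ i ∈ Finset.range n,
    (⟪A.H ((x (i + 1) + s • ξ (i + 1)) - (x i + s • ξ i)), ξ (i + 1) - ξ i⟫ +
      ε * ⟪A.g (x i + s • ξ i), ξ i⟫) - c * ‖ξ 1‖ ^ 2 * (2 * s) with hf'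
  have hfd : ∀ s, HasDerivAt f (f' s) s := by
    intro s
    have h1 : ∀ i ∈ Finset.range n, HasDerivAt
        (fun s : ℝ => A.step ε (x i + s • ξ i) (x (i + 1) + s • ξ (i + 1)))
        (⟪A.H ((x (i + 1) + s • ξ (i + 1)) - (x i + s • ξ i)), ξ (i + 1) - ξ i⟫ +
          ε * ⟪A.g (x i + s • ξ i), ξ i⟫) s := fun i _ =>
      ((A.hasGradientAt_h _).comp_hasDerivAt ((hzd (i + 1) s).sub (hzd i s))).add
        (((A.hasGradientAt_G _).comp_hasDerivAt (hzd i s)).const_mul ε)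
    have h2 := (((hasDerivAt_id s).pow 2).const_mul (c * ‖ξ 1‖ ^ 2))
    have h3 := (HasDerivAt.fun_sum h1).sub h2
    refine h3.congr_deriv ?_
    simp [hf']
  have hf'd : HasDerivAt f' (∑ i ∈ Finset.range n,
      (⟪fderiv ℝ A.H (x (i + 1) - x i) (ξ (i + 1) - ξ i), ξ (i + 1) - ξ i⟫ +
        ε * ⟪fderiv ℝ A.g (x i) (ξ i), ξ i⟫) - c * ‖ξ 1‖ ^ 2 * 2) 0 := by
    have h1 : ∀ i ∈ Finset.range n, HasDerivAt (fun s : ℝ =>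
        (⟪A.H ((x (i + 1) + s • ξ (i + 1)) - (x i + s • ξ i)), ξ (i + 1) - ξ i⟫ +
          ε * ⟪A.g (x i + s • ξ i), ξ i⟫))
        (⟪fderiv ℝ A.H (x (i + 1) - x i) (ξ (i + 1) - ξ i), ξ (i + 1) - ξ i⟫ +
          ε * ⟪fderiv ℝ A.g (x i) (ξ i), ξ i⟫) 0 := by
      intro i _
      have a1 : HasDerivAt (fun s : ℝ => A.H ((x (i + 1) + s • ξ (i + 1)) - (x i + s • ξ i)))
          (fderiv ℝ A.H (x (i + 1) - x i) (ξ (i + 1) - ξ i)) 0 :=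
        HasFDerivAt.comp_hasDerivAt_of_eq (0 : ℝ) (hHd _) ((hzd (i + 1) 0).sub (hzd i 0))
          (by simp)
      have a2 : HasDerivAt (fun s : ℝ => A.g (x i + s • ξ i)) (fderiv ℝ A.g (x i) (ξ i)) 0 :=
        HasFDerivAt.comp_hasDerivAt_of_eq (0 : ℝ) (hgd _) (hzd i 0) (by simp)
      have b1 := a1.inner ℝ (hasDerivAt_const (0 : ℝ) (ξ (i + 1) - ξ i))
      have b2 := a2.inner ℝ (hasDerivAt_const (0 : ℝ) (ξ i))
      refine (b1.add (b2.const_mul ε)).congr_deriv ?_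
      simp
    have h2 := ((hasDerivAt_id (0 : ℝ)).const_mul 2).const_mul (c * ‖ξ 1‖ ^ 2)
    refine ((HasDerivAt.fun_sum h1).sub h2).congr_deriv ?_
    simp
  have hmin : ∀ s, f 0 ≤ f s := by
    intro s
    have h1 := hc.sq_norm_first_sub_le hn (x := fun i => x i + s • ξ i)
      (by simp [hxn, hξ0, hξn])
    have h2 : A.graphMap ε (gradient w) (x 0 + s • ξ 0) = x 1 := by
      rw [hξ0, smul_zero, add_zero]; rfl
    rw [h2, add_sub_cancel_left, norm_smul, mul_pow, Real.norm_eq_abs, sq_abs] at h1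
    have h3 : w (intVec ℝ m) - w 0 =
        ∑ i ∈ Finset.range n, A.step ε (x i) (x (i + 1)) + n * κ := by
      obtain ⟨y, hy0, -, hy, hya⟩ := hc.exists_action_eq q
      rw [hya]
      congr 1
      refine Finset.sum_congr rfl fun i hi => ?_
      have hi' := Finset.mem_range.1 hi
      rw [hc.chain_eq_iterate hn hy i hi'.le, hc.chain_eq_iterate hn hy (i + 1) hi', hy0]
    simp only [hf, zero_smul, add_zero]
    linarith
  have hD := second_deriv_nonneg_of_min hfd hf'd hmin
  -- By the Jacobi equations the second variation of the action telescopes to `⟪ζ n, ξ n⟫ - ⟪ζ 0, ξ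
  -- 0⟫`, which is zero. Only the subtracted square remains, so `ξ 1 = 0`; then `ζ 1 = 0` and `η = ζ
  -- 0 = 0`.
  have htel : ∑ i ∈ Finset.range n,
      (⟪fderiv ℝ A.H (x (i + 1) - x i) (ξ (i + 1) - ξ i), ξ (i + 1) - ξ i⟫ +
        ε * ⟪fderiv ℝ A.g (x i) (ξ i), ξ i⟫) = 0 := by
    have h1 : ∀ i ∈ Finset.range n,
        (⟪fderiv ℝ A.H (x (i + 1) - x i) (ξ (i + 1) - ξ i), ξ (i + 1) - ξ i⟫ +
          ε * ⟪fderiv ℝ A.g (x i) (ξ i), ξ i⟫) = ⟪ζ (i + 1), ξ (i + 1)⟫ - ⟪ζ i, ξ i⟫ := by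
      intro i _
      rw [show fderiv ℝ A.H (x (i + 1) - x i) (ξ (i + 1) - ξ i) = ζ (i + 1) from hξsucc i,
        inner_sub_right, ← real_inner_smul_left,
        show ε • fderiv ℝ A.g (x i) (ξ i) = ζ (i + 1) - ζ i by rw [hζsucc i, add_sub_cancel_left],
        inner_sub_left]
      ring
    rw [Finset.sum_congr rfl h1, Finset.sum_range_sub (fun i => ⟪ζ i, ξ i⟫), hξn, hξ0]
    simp
  rw [htel] at hD
  have hξ1 : ξ 1 = 0 := by
    have : ‖ξ 1‖ ^ 2 ≤ 0 := by
      by_contra h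
      push Not at h
      have := mul_pos hc0 h
      linarith
    exact norm_eq_zero.1 (pow_eq_zero_iff two_ne_zero |>.1 (le_antisymm this (sq_nonneg _)))
  have h1 := hξsucc 0
  rw [zero_add, hξ1, hξ0, sub_zero, map_zero] at h1
  have h2 := hζsucc 0
  rw [zero_add, ← h1, hξ0, hζ0, map_zero, smul_zero, add_zero] at h2
  exact h2.symm

end StandardFamily

/-! ### Analytic continuation of calibration in the parameter. -/

namespace StandardFamily

variable {d : ℕ} {A : StandardFamily d} {m : Fin d → ℤ} {n : ℕ} {ε : ℝ}
  {w : EuclideanSpace ℝ (Fin d) → ℝ} {κ : ℝ}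

/-- Calibration persists near a parameter where it accumulates, in the analytic case. -/
theorem calibratedSet_mem_nhds (hL : ContDiff ℝ ω A.L) (hg : ContDiff ℝ ω A.g) (hn : 0 < n)
    {ε₀ : ℝ} (h₀ : ε₀ ∈ A.calibratedSet m n) (hacc : AccPt ε₀ (𝓟 (A.calibratedSet m n))) :
    A.calibratedSet m n ∈ 𝓝 ε₀ := by
  obtain ⟨w, κ, hc⟩ := h₀
  -- Zeros of `Θ` are the initial momenta for which the position returns to `q + m` after `n` steps.
  -- Gradients of calibrated functions are such zeros, and near `∇w` they are the only ones.
  set Θ : (ℝ × EuclideanSpace ℝ (Fin d)) × EuclideanSpace ℝ (Fin d) → EuclideanSpace ℝ (Fin d) :=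
    fun z => ((A.map z.1.1)^[n] (z.1.2, z.2)).1 - z.1.2 - intVec ℝ m with hΘ
  have hΘd : ContDiff ℝ ω Θ := by
    have h1 := contDiff_map_iterate hL hg n
    have h2 : ContDiff ℝ ω fun z : (ℝ × EuclideanSpace ℝ (Fin d)) × EuclideanSpace ℝ (Fin d) =>
        (z.1.1, (z.1.2, z.2)) := by fun_prop
    exact ((h1.comp h2).fst.sub contDiff_fst.snd).sub contDiff_const
  have hΘper : ∀ ε (k : Fin d → ℤ) q p, Θ ((ε, q + intVec ℝ k), p) = Θ ((ε, q), p) := by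
    intro ε k q p
    simp only [hΘ, map_iterate_add_intVec]
    abel
  have hΘgraph : ∀ ε γ, (∀ q, γ (A.graphMap ε γ q) = γ q + ε • A.g q) → ∀ q,
      Θ ((ε, q), γ q) = (A.graphMap ε γ)^[n] q - (q + intVec ℝ m) := by
    intro ε γ hinv q
    simp only [hΘ, A.map_graph ε hinv]
    abel
  have hΘcal : ∀ ε w κ, A.IsCalibrated m n ε w κ → ∀ q, Θ ((ε, q), gradient w q) = 0 := by
    intro ε w κ hc q
    rw [hΘgraph _ _ (hc.gradient_graphMap hn), hc.graphMap_iterate hn, sub_self]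
  obtain ⟨ρ, hρ, Γ, hΓper, hΓ⟩ := exists_periodic_implicit hΘd hΘper (hc.continuous_gradient hn)
    (hc.gradient_periodic hn) (hΘcal ε₀ w κ hc) (fun q η hη => by
      refine hc.eq_zero_of_hasDerivAt hL hg hn q η ?_
      have h1 : HasDerivAt (fun s : ℝ => ((ε₀, q), gradient w q + s • η)) (0, η) 0 := by
        have := ((hasDerivAt_id (0 : ℝ)).smul_const η).const_add (gradient w q)
        simpa using (hasDerivAt_const (0 : ℝ) (ε₀, q)).prodMk this
      have h2 := (hΘd.differentiable (by simp) ((ε₀, q), gradient w q)).hasFDerivAt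
      have h3 : HasDerivAt (fun s : ℝ => Θ ((ε₀, q), gradient w q + s • η)) 0 0 := by
        rw [← hη]
        exact HasFDerivAt.comp_hasDerivAt_of_eq (0 : ℝ) h2 h1 (by simp)
      have h4 := (h3.add_const (intVec ℝ m)).add_const q
      refine h4.congr_of_eventuallyEq (Filter.Eventually.of_forall fun s => ?_)
      simp [hΘ])
  obtain ⟨δ, hδ, hball⟩ := Metric.eventually_nhds_iff_ball.1
    (hΓ.and (hc.eventually_norm_gradient_sub_lt hn hρ))
  have hΓd : ∀ ε ∈ Metric.ball ε₀ δ, ∀ q, ContDiffAt ℝ ω Γ (ε, q) := fun ε hε q =>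
    ((hball ε hε).1 q).1
  have hΓeq : ∀ ε ∈ Metric.ball ε₀ δ, ∀ w κ, A.IsCalibrated m n ε w κ →
      ∀ q, gradient w q = Γ (ε, q) := fun ε hε w' κ' hc' q =>
    ((hball ε hε).1 q).2.2 _ ((hball ε hε).2 w' κ' hc' q) (hΘcal ε w' κ' hc' q)
  have hΓ1 : ∀ ε ∈ Metric.ball ε₀ δ, ∀ q, ContDiffAt ℝ ω (fun e => Γ (e, q)) ε := fun ε hε q =>
    (hΓd ε hε q).comp ε (contDiffAt_id.prodMk contDiffAt_const)
  -- Invariance of the continued graph is, for fixed `q`, an analytic equation in `ε`. It holds at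
  -- the calibrated parameters, which accumulate at `ε₀`, hence on the whole ball.
  have hinv : ∀ q, ∀ ε ∈ Metric.ball ε₀ δ,
      Γ (ε, A.graphMap ε (fun q => Γ (ε, q)) q) - (Γ (ε, q) + ε • A.g q) = 0 := by
    intro q
    refine eq_zero_of_accPt hδ hacc (fun ε hε => ?_) (fun ε hε hεE => ?_)
    · have h1 := hΓ1 ε hε q
      have h2 : ContDiffAt ℝ ω (fun e : ℝ => A.graphMap e (fun q => Γ (e, q)) q) ε := by
        unfold graphMap
        fun_prop
      have h3 : ContDiffAt ℝ ω (fun e : ℝ => Γ (e, A.graphMap e (fun q => Γ (e, q)) q)) ε :=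
        (hΓd ε hε (A.graphMap ε (fun q => Γ (ε, q)) q)).comp ε (contDiffAt_id.prodMk h2)
      fun_prop
    · obtain ⟨w', κ', hc'⟩ := hεE
      have h1 : gradient w' = fun q => Γ (ε, q) := funext (hΓeq ε hε w' κ' hc')
      have h2 := hc'.gradient_graphMap hn q
      rw [h1] at h2
      exact sub_eq_zero.2 h2
  have hDΓ : ∀ ε ∈ Metric.ball ε₀ δ, ∀ q, HasFDerivAt (fun q => Γ (ε, q))
      ((fderiv ℝ Γ (ε, q)).comp (.inr ℝ ℝ (EuclideanSpace ℝ (Fin d)))) q := fun ε hε q =>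
    ((hΓd ε hε q).differentiableAt (by simp)).hasFDerivAt.comp q (hasFDerivAt_prodMk_right ε q)
  -- The same principle for the symmetry of the derivative of `Γ (ε, ·)`, which keeps the graph
  -- Lagrangian and gives it a potential.
  have hsym : ∀ q u v, ∀ ε ∈ Metric.ball ε₀ δ,
      ⟪fderiv ℝ Γ (ε, q) (0, u), v⟫ - ⟪fderiv ℝ Γ (ε, q) (0, v), u⟫ = 0 := by
    intro q u v
    refine eq_zero_of_accPt hδ hacc (fun ε hε => ?_) (fun ε hε hεE => ?_)
    · have h1 : ContDiffAt ℝ ω (fun e => fderiv ℝ Γ (e, q)) ε :=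
        ((hΓd ε hε q).fderiv_right (m := ω) (by simp)).comp ε
          (contDiffAt_id.prodMk contDiffAt_const)
      have h2 : ∀ u, ContDiffAt ℝ ω (fun e => fderiv ℝ Γ (e, q) (0, u)) ε := fun u =>
        h1.clm_apply contDiffAt_const
      exact ((h2 u).inner ℝ contDiffAt_const).sub ((h2 v).inner ℝ contDiffAt_const)
    · obtain ⟨w', κ', hc'⟩ := hεE
      have h1 : ∀ y, HasFDerivAt w' (InnerProductSpace.toDual ℝ _ (Γ (ε, y))) y := fun y => by
        rw [← hΓeq ε hε w' κ' hc']
        exact (hc'.hasGradientAt hn y).hasFDerivAt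
      have h2 := ((InnerProductSpace.toDual ℝ (EuclideanSpace ℝ
        (Fin d))).toContinuousLinearEquiv.toContinuousLinearMap.hasFDerivAt.comp q (hDΓ ε hε q))
      have h3 := second_derivative_symmetric h1 h2 u v
      simpa [sub_eq_zero] using h3
  refine Filter.mem_of_superset (Metric.ball_mem_nhds ε₀ hδ) fun ε hε => ?_
  set γ : EuclideanSpace ℝ (Fin d) → EuclideanSpace ℝ (Fin d) := fun q => Γ (ε, q) with hγ
  have hγd : Differentiable ℝ γ := fun q => (hDΓ ε hε q).differentiableAt
  have hpot : ∃ w : EuclideanSpace ℝ (Fin d) → ℝ, ∀ q, HasGradientAt w (γ q) q := by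
    have h2 : ∀ q, HasFDerivAt (fun q => InnerProductSpace.toDual ℝ _ (γ q)) _ q := fun q =>
      ((InnerProductSpace.toDual ℝ (EuclideanSpace ℝ
        (Fin d))).toContinuousLinearEquiv.toContinuousLinearMap.hasFDerivAt.comp q (hDΓ ε hε q))
    obtain ⟨w, hw⟩ := convex_univ.exists_forall_hasFDerivAt_of_fderiv_symmetric isOpen_univ
      (fun q _ => (h2 q).differentiableAt.differentiableWithinAt) (fun q _ u v => by
        rw [(h2 q).fderiv]
        simpa [sub_eq_zero] using hsym q u v ε hε)
    exact ⟨w, fun q => hasGradientAt_iff_hasFDerivAt.2 (hw q (Set.mem_univ q))⟩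
  obtain ⟨w', hw'⟩ := hpot
  have hinv' : ∀ q, γ (A.graphMap ε γ q) = γ q + ε • A.g q := fun q =>
    sub_eq_zero.1 (hinv q ε hε)
  obtain ⟨κ', hκ'⟩ := A.exists_isCalibrated_of_graph (m := m) (n := n) hw' hγd.continuous
    (fun k q => hΓper ε k q) hinv' (fun q => by
      have := hΘgraph ε γ hinv' q
      rw [((hball ε hε).1 q).2.1] at this
      exact (sub_eq_zero.1 this.symm)) (fun q => by
      have h1 : Differentiable ℝ (A.graphMap ε γ) := by
        have := hL.differentiable (by simp)
        have := hg.differentiable (by simp)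
        unfold graphMap
        fun_prop
      exact (h1 q).isBigO_sub)
  exact ⟨w', κ', hκ'⟩

/-- In the analytic case, calibration at parameters accumulating somewhere implies calibration
for all parameters. -/
theorem calibratedSet_eq_univ (hL : ContDiff ℝ ω A.L) (hg : ContDiff ℝ ω A.g) (hn : 0 < n)
    {ε₀ : ℝ} (hacc : AccPt ε₀ (𝓟 (A.calibratedSet m n))) : A.calibratedSet m n = Set.univ := by
  have hcl := isClosed_calibratedSet (A := A) (m := m) hn
  have hsub : derivedSet (A.calibratedSet m n) ⊆ A.calibratedSet m n :=
    (isClosed_iff_derivedSet_subset _).1 hcl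
  -- The argument is run on the derived set, because the neighbourhood property is available only at
  -- accumulation points; an isolated calibrated parameter need not persist.
  have hopen : IsOpen (derivedSet (A.calibratedSet m n)) := by
    rw [isOpen_iff_mem_nhds]
    intro ε hε
    have h1 := calibratedSet_mem_nhds hL hg hn (hsub hε) hε
    filter_upwards [eventually_mem_nhds_iff.2 h1] with ε' hε'
    rw [mem_derivedSet, accPt_iff_frequently_nhdsNE]
    exact (Filter.Eventually.frequently (nhdsWithin_le_nhds hε'))
  have huniv : derivedSet (A.calibratedSet m n) = Set.univ :=
    IsClopen.eq_univ ⟨isClosed_derivedSet _, hopen⟩ ⟨ε₀, hacc⟩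
  exact Set.eq_univ_of_univ_subset (huniv ▸ hsub)

end StandardFamily

/-! ### First order condition at zero and behaviour for large parameters. -/

namespace StandardFamily

variable {d : ℕ} {A : StandardFamily d} {m : Fin d → ℤ} {n : ℕ} {ε : ℝ}
  {w : EuclideanSpace ℝ (Fin d) → ℝ} {κ : ℝ}

theorem abs_G_sub_le (q q' : EuclideanSpace ℝ (Fin d)) : |A.G q' - A.G q| ≤ A.B * ‖q' - q‖ :=
  abs_sub_le_of_norm_gradient_le A.hasGradientAt_G A.g_bound q q'

/-- Comparison of a calibrated chain with a uniform chain. -/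
theorem IsCalibrated.exists_chain_near_uniform (hc : A.IsCalibrated m n ε w κ) (hn : 0 < n)
    (q q' : EuclideanSpace ℝ (Fin d)) :
    ∃ x : ℕ → EuclideanSpace ℝ (Fin d), x 0 = q ∧
      ε * (∑ i ∈ Finset.range n, A.G (x i) -
        ∑ i ∈ Finset.range n, A.G (q' + (i : ℝ) • ((n : ℝ)⁻¹ • intVec ℝ m))) +
      A.α / 2 * ∑ i ∈ Finset.range n, ‖x (i + 1) - x i - (n : ℝ)⁻¹ • intVec ℝ m‖ ^ 2 ≤ 0 := by
  have hn' : (n : ℝ) ≠ 0 := by exact_mod_cast hn.ne'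
  set v := (n : ℝ)⁻¹ • intVec ℝ m with hv
  obtain ⟨x, hx0, hxn, -, hxa⟩ := hc.exists_action_eq q
  refine ⟨x, hx0, ?_⟩
  have h1 := hc.action_ge_of_eq (x := fun i : ℕ => q' + (i : ℝ) • v) (by
    simp [hv, smul_smul, mul_inv_cancel₀ hn'])
  have h2 : ∑ i ∈ Finset.range n, A.step ε (q' + (i : ℝ) • v) (q' + ((i + 1 : ℕ) : ℝ) • v) =
      n * A.h v + ε * ∑ i ∈ Finset.range n, A.G (q' + (i : ℝ) • v) := by
    rw [Finset.mul_sum, ← nsmul_eq_mul]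
    nth_rewrite 2 [← Finset.card_range n]
    rw [← Finset.sum_const, ← Finset.sum_add_distrib]
    refine Finset.sum_congr rfl fun i _ => ?_
    have e : q' + ((i + 1 : ℕ) : ℝ) • v - (q' + (i : ℝ) • v) = v := by
      push_cast
      rw [add_smul, one_smul]; abel
    rw [step, e]
  -- Strict convexity of `h` at `v`, summed over the chain. The linear terms cancel because the
  -- total displacement is `m = n • v`.
  have h3 : n * A.h v + A.α / 2 * ∑ i ∈ Finset.range n, ‖x (i + 1) - x i - v‖ ^ 2 ≤
      ∑ i ∈ Finset.range n, A.h (x (i + 1) - x i) := by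
    have h4 : ∀ i ∈ Finset.range n, A.h v + ⟪A.H v, x (i + 1) - x i - v⟫ +
        A.α / 2 * ‖x (i + 1) - x i - v‖ ^ 2 ≤ A.h (x (i + 1) - x i) := fun i _ => by
      have := A.h_lower v (x (i + 1) - x i - v)
      rwa [add_sub_cancel] at this
    have h5 := Finset.sum_le_sum h4
    rw [Finset.sum_add_distrib, Finset.sum_add_distrib, ← inner_sum, Finset.sum_sub_distrib,
      Finset.sum_range_sub, ← Finset.mul_sum, Finset.sum_const, Finset.sum_const,
      Finset.card_range, hxn, hx0, add_sub_cancel_left, nsmul_eq_mul] at h5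
    have h6 : intVec ℝ m - n • v = 0 := by
      rw [← Nat.cast_smul_eq_nsmul ℝ, hv, smul_smul, mul_inv_cancel₀ hn', one_smul, sub_self]
    rwa [h6, inner_zero_right, add_zero] at h5
  have h7 : ∑ i ∈ Finset.range n, A.step ε (x i) (x (i + 1)) =
      ∑ i ∈ Finset.range n, A.h (x (i + 1) - x i) + ε * ∑ i ∈ Finset.range n, A.G (x i) := by
    rw [Finset.mul_sum, ← Finset.sum_add_distrib]; rfl
  rw [h2] at h1
  rw [h7] at hxa
  linarith

/-- The calibrated chain from `q` stays within `n * r` of the uniform chain, with `r` of order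
`√|ε|`. Minimality against the uniform chain from `q'`, divided by `ε`, compares the sums of `G` up
to an error that tends to zero with `ε`. -/
theorem IsCalibrated.sum_G_le (hc : A.IsCalibrated m n ε w κ) (hn : 0 < n) (hε : ε ≠ 0)
    (q q' : EuclideanSpace ℝ (Fin d)) :
    ∑ i ∈ Finset.range n, A.G (q + (i : ℝ) • ((n : ℝ)⁻¹ • intVec ℝ m)) ≤
      ∑ i ∈ Finset.range n, A.G (q' + (i : ℝ) • ((n : ℝ)⁻¹ • intVec ℝ m)) +
        n * (A.B * (n * √(4 * n * A.B * |ε| / A.α))) := by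
  set v := (n : ℝ)⁻¹ • intVec ℝ m with hv
  have hα := A.α_pos
  have hB := A.B_nonneg
  set r := √(4 * n * A.B * |ε| / A.α) with hr
  set s : EuclideanSpace ℝ (Fin d) → ℝ := fun q => ∑ i ∈ Finset.range n, A.G (q + (i : ℝ) • v)
    with hs
  have habs : ∀ y : ℕ → EuclideanSpace ℝ (Fin d), |∑ i ∈ Finset.range n, A.G (y i)| ≤ n * A.B :=
    fun y => (Finset.abs_sum_le_sum_abs _ _).trans <| by
      calc _ ≤ ∑ i ∈ Finset.range n, A.B := Finset.sum_le_sum fun i _ => A.G_bound _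
        _ = _ := by simp
  have key : ∀ q q', ∃ g : ℝ, ε * (g - s q') ≤ 0 ∧ |g - s q| ≤ n * (A.B * (n * r)) := by
    intro q q'
    obtain ⟨x, hx0, hx⟩ := hc.exists_chain_near_uniform hn q q'
    rw [← hv] at hx
    have hsum : ∀ i ∈ Finset.range n, 0 ≤ ‖x (i + 1) - x i - v‖ ^ 2 := fun i _ => sq_nonneg _
    refine ⟨∑ i ∈ Finset.range n, A.G (x i), ?_, ?_⟩
    · have := mul_nonneg (half_pos hα).le (Finset.sum_nonneg hsum)
      simp only [hs]
      linarith
    · have h1 : ∀ i < n, ‖x (i + 1) - x i - v‖ ≤ r := by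
        intro i hi
        refine Real.le_sqrt_of_sq_le ?_
        have h2 := Finset.single_le_sum hsum (Finset.mem_range.2 hi)
        have h3 := mul_le_mul_of_nonneg_left h2 (half_pos hα).le
        have h4 : |ε * (∑ i ∈ Finset.range n, A.G (x i) - s q')| ≤ |ε| * (2 * n * A.B) := by
          rw [abs_mul]
          refine mul_le_mul_of_nonneg_left ?_ (abs_nonneg ε)
          have := abs_sub (∑ i ∈ Finset.range n, A.G (x i)) (s q')
          have := habs x
          have := habs fun i => q' + (i : ℝ) • v
          simp only [hs] at *
          linarith
        have h5 := neg_le_of_abs_le h4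
        rw [le_div_iff₀ hα]
        simp only [hs] at h5
        linarith
      have h2 : ∀ i ≤ n, ‖x i - (q + (i : ℝ) • v)‖ ≤ i * r := by
        intro i
        induction i with
        | zero => simp [hx0]
        | succ i ih =>
          intro hi
          have e : x (i + 1) - (q + ((i + 1 : ℕ) : ℝ) • v) =
              (x i - (q + (i : ℝ) • v)) + (x (i + 1) - x i - v) := by
            push_cast
            rw [add_smul, one_smul]; abel
          rw [e]
          have := norm_add_le (x i - (q + (i : ℝ) • v)) (x (i + 1) - x i - v)
          have := ih (by omega)
          have := h1 i (by omega)
          push_cast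
          linarith
      simp only [hs]
      rw [← Finset.sum_sub_distrib]
      refine (Finset.abs_sum_le_sum_abs _ _).trans ?_
      calc _ ≤ ∑ i ∈ Finset.range n, A.B * (n * r) := Finset.sum_le_sum fun i hi => by
            have hi' := Finset.mem_range.1 hi
            refine (abs_G_sub_le _ _).trans (mul_le_mul_of_nonneg_left ?_ hB)
            refine (h2 i hi'.le).trans (mul_le_mul_of_nonneg_right ?_ (Real.sqrt_nonneg _))
            exact_mod_cast hi'.le
        _ = _ := by simp
  -- Division by a negative `ε` reverses the inequality, which is repaired by exchanging `q` and
  -- `q'`.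
  rcases hε.lt_or_gt with h | h
  · obtain ⟨g, h1, h2⟩ := key q' q
    have h3 : 0 ≤ g - s q := by
      by_contra h4
      push Not at h4
      have := mul_pos_of_neg_of_neg h h4
      linarith
    have := le_of_abs_le h2
    simp only [hs] at *
    linarith
  · obtain ⟨g, h1, h2⟩ := key q q'
    have h3 : g - s q' ≤ 0 := by
      by_contra h4
      push Not at h4
      have := mul_pos h h4
      linarith
    have := neg_le_of_abs_le h2
    simp only [hs] at *
    linarith

/-- The first order condition for the persistence of periodic graphs: the average of `G` along the
unperturbed periodic orbits is constant. -/
theorem sum_G_eq_of_accPt (hn : 0 < n) (hacc : AccPt 0 (𝓟 (A.calibratedSet m n)))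
    (q q' : EuclideanSpace ℝ (Fin d)) :
    ∑ i ∈ Finset.range n, A.G (q + (i : ℝ) • ((n : ℝ)⁻¹ • intVec ℝ m)) =
      ∑ i ∈ Finset.range n, A.G (q' + (i : ℝ) • ((n : ℝ)⁻¹ • intVec ℝ m)) := by
  suffices key : ∀ q q' : EuclideanSpace ℝ (Fin d),
      ∑ i ∈ Finset.range n, A.G (q + (i : ℝ) • ((n : ℝ)⁻¹ • intVec ℝ m)) ≤
        ∑ i ∈ Finset.range n, A.G (q' + (i : ℝ) • ((n : ℝ)⁻¹ • intVec ℝ m)) from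
    le_antisymm (key q q') (key q' q)
  intro q q'
  by_contra hlt
  push Not at hlt
  have h1 : Tendsto (fun ε : ℝ =>
      ∑ i ∈ Finset.range n, A.G (q' + (i : ℝ) • ((n : ℝ)⁻¹ • intVec ℝ m)) +
        n * (A.B * (n * √(4 * n * A.B * |ε| / A.α)))) (𝓝 0)
      (𝓝 (∑ i ∈ Finset.range n, A.G (q' + (i : ℝ) • ((n : ℝ)⁻¹ • intVec ℝ m)))) := by
    have : Continuous (fun ε : ℝ =>
      ∑ i ∈ Finset.range n, A.G (q' + (i : ℝ) • ((n : ℝ)⁻¹ • intVec ℝ m)) +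
        n * (A.B * (n * √(4 * n * A.B * |ε| / A.α)))) := by fun_prop
    simpa using this.tendsto 0
  have h2 := nhdsWithin_le_nhds (s := {0}ᶜ) (h1.eventually (gt_mem_nhds hlt))
  rw [accPt_iff_frequently_nhdsNE] at hacc
  obtain ⟨ε, ⟨⟨w, κ, hc⟩, hε⟩, hε0⟩ :=
    ((hacc.and_eventually h2).and_eventually self_mem_nhdsWithin).exists
  exact absurd (hc.sum_G_le hn hε0 q q') (not_le.2 hε)

/-- If periodic graphs persist for all parameters, then the perturbation is constant. -/
theorem G_eq_of_calibratedSet_eq_univ (hn : 0 < n) (huniv : A.calibratedSet m n = Set.univ) :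
    ∃ c, ∀ q, A.G q = c := by
  obtain ⟨q₀, -, hq₀⟩ := (isCompact_closedBall (0 : EuclideanSpace ℝ (Fin d)) (√d)).exists_isMinOn
    ⟨0, Metric.mem_closedBall_self (Real.sqrt_nonneg _)⟩ A.continuous_G.continuousOn
  have hmin : ∀ q, A.G q₀ ≤ A.G q := fun q => by
    obtain ⟨k, hk⟩ := exists_add_intVec_mem_closedBall q
    rw [← A.G_periodic k q]
    exact hq₀ hk
  refine ⟨A.G q₀, fun q => le_antisymm ?_ (hmin q)⟩
  -- The competitor rests at the minimum `q₀` and makes the whole displacement `m` in the last step.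
  -- Its kinetic cost `C` does not depend on `ε`.
  set y : ℕ → EuclideanSpace ℝ (Fin d) := fun i => if i < n then q₀ else q₀ + intVec ℝ m with hy
  set C := ∑ i ∈ Finset.range n, A.h (y (i + 1) - y i) with hC
  have hh : ∀ v, A.h (A.L 0) ≤ A.h v := fun v => by
    have h1 := A.h_lower (A.L 0) (v - A.L 0)
    have h2 : 0 ≤ A.α / 2 * ‖v - A.L 0‖ ^ 2 := mul_nonneg (half_pos A.α_pos).le (sq_nonneg _)
    rw [A.H_L, inner_zero_left, add_sub_cancel] at h1
    linarith
  -- All calibrated chains have minimal action, so the one starting at `q` costs no more than the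
  -- competitor. The bound is uniform in `ε`, which forces `G q ≤ G q₀`.
  have key : ∀ ε : ℝ, 0 < ε → ε * (A.G q - A.G q₀) ≤ C - n * A.h (A.L 0) := by
    intro ε hε
    obtain ⟨w, κ, hc⟩ : ε ∈ A.calibratedSet m n := huniv ▸ Set.mem_univ ε
    obtain ⟨x, hx0, -, -, hxa⟩ := hc.exists_action_eq q
    have h1 := hc.action_ge_of_eq (x := y) (by simp [hy, hn])
    have h2 : ∑ i ∈ Finset.range n, A.step ε (y i) (y (i + 1)) = C + ε * (n * A.G q₀) := by
      have : ∀ i ∈ Finset.range n, A.step ε (y i) (y (i + 1)) =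
          A.h (y (i + 1) - y i) + ε * A.G q₀ := fun i hi => by
        rw [step]
        simp [hy, Finset.mem_range.1 hi]
      rw [Finset.sum_congr rfl this, Finset.sum_add_distrib, ← hC]
      simp
      ring
    have h3 : n * A.h (A.L 0) + ε * (n * A.G q₀) + ε * (A.G q - A.G q₀) ≤
        ∑ i ∈ Finset.range n, A.step ε (x i) (x (i + 1)) := by
      have h4 : ∀ i ∈ Finset.range n, (0 : ℝ) ≤
          A.step ε (x i) (x (i + 1)) - (A.h (A.L 0) + ε * A.G q₀) := fun i _ => by
        have := hh (x (i + 1) - x i)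
        have := mul_le_mul_of_nonneg_left (hmin (x i)) hε.le
        rw [step]
        linarith
      have h5 := Finset.single_le_sum h4 (Finset.mem_range.2 hn)
      rw [Finset.sum_sub_distrib, Finset.sum_const, Finset.card_range, nsmul_eq_mul, step] at h5
      have h6 := hh (x (0 + 1) - x 0)
      rw [hx0] at h5 h6
      linarith
    linarith
  by_contra hlt
  push Not at hlt
  have hgap : 0 < A.G q - A.G q₀ := by linarith
  obtain ⟨N, hN⟩ := exists_nat_gt ((C - n * A.h (A.L 0)) / (A.G q - A.G q₀))
  rw [div_lt_iff₀ hgap] at hN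
  have := key (N + 1) (by positivity)
  nlinarith

end StandardFamily

/-! ### Fourier coefficients and rational translations of the torus. -/

section FourierCoefficients

open UnitAddTorus MeasureTheory

variable {d : ℕ}

theorem torusProj_add (p q : EuclideanSpace ℝ (Fin d)) :
    torusProj (p + q) = torusProj p + torusProj q := by
  ext i
  simp [torusProj]

theorem torusProj_natCast_smul (i : ℕ) (q : EuclideanSpace ℝ (Fin d)) :
    torusProj ((i : ℝ) • q) = i • torusProj q := by
  ext l
  simp [torusProj, ← nsmul_eq_mul]

theorem torusProj_surjective : Function.Surjective (torusProj (d := d)) := by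
  intro θ
  choose x hx using fun i => QuotientAddGroup.mk_surjective (θ i)
  exact ⟨WithLp.toLp 2 x, funext hx⟩

theorem isQuotientMap_torusProj : IsQuotientMap (torusProj (d := d)) := by
  have h1 : IsOpenQuotientMap (Pi.map (fun (_ : Fin d) (x : ℝ) => (x : UnitAddCircle))) :=
    IsOpenQuotientMap.piMap fun _ => QuotientAddGroup.isOpenQuotientMap_mk
  have h2 : IsQuotientMap (fun q : EuclideanSpace ℝ (Fin d) => (WithLp.ofLp q : Fin d → ℝ)) :=
    (EuclideanSpace.equiv (Fin d) ℝ).toHomeomorph.isQuotientMap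
  exact h1.isQuotientMap.comp h2

theorem torusProj_intVec (k : Fin d → ℤ) : torusProj (intVec ℝ k) = 0 := by
  ext i
  simp only [torusProj, intVec, Pi.zero_apply]
  rw [AddCircle.coe_eq_zero_iff]
  exact ⟨k i, by simp⟩

theorem mFourier_apply_add (k : Fin d → ℤ) (x y : Torus d) :
    mFourier k (x + y) = mFourier k x * mFourier k y := by
  simp only [mFourier, ContinuousMap.coe_mk, Pi.add_apply, fourier_apply, smul_add,
    AddCircle.toCircle_add, Circle.coe_mul, Finset.prod_mul_distrib]

theorem mFourier_torusProj (k : Fin d → ℤ) (q : EuclideanSpace ℝ (Fin d)) :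
    mFourier k (torusProj q) =
      Complex.exp (2 * Real.pi * Complex.I * ∑ i, (k i : ℂ) * (q i : ℂ)) := by
  simp only [mFourier, ContinuousMap.coe_mk, torusProj, fourier_coe_apply]
  rw [← Complex.exp_sum, Finset.mul_sum]
  congr 1
  refine Finset.sum_congr rfl fun i _ => ?_
  push_cast
  ring

theorem mFourierCoeff_comp_add (f : Torus d → ℂ) (a : Torus d) (k : Fin d → ℤ) :
    mFourierCoeff (fun t => f (t + a)) k = mFourier k a * mFourierCoeff f k := by
  change ∫ t, mFourier (-k) t • f (t + a) ∂(Measure.pi fun _ => AddCircle.haarAddCircle) =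
    mFourier k a * ∫ t, mFourier (-k) t • f t ∂(Measure.pi fun _ => AddCircle.haarAddCircle)
  rw [← integral_const_mul, ← integral_add_right_eq_self
    (μ := Measure.pi fun _ => AddCircle.haarAddCircle)
    (fun t : Torus d => mFourier k a * mFourier (-k) t • f t) a]
  congr 1 with t
  have h : mFourier k a * mFourier (-k) a = 1 := by
    rw [← mFourier_add, add_neg_cancel, mFourier_zero]; rfl
  rw [mFourier_apply_add, smul_eq_mul, smul_eq_mul]
  linear_combination (-(mFourier (-k) t * f (t + a))) * h

theorem exists_mFourier_ne_one {k : Fin d → ℤ} (hk : k ≠ 0) : ∃ a : Torus d, mFourier k a ≠ 1 := by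
  obtain ⟨i, hi⟩ := Function.ne_iff.mp hk
  refine ⟨torusProj (EuclideanSpace.single i (1 / (2 * (k i : ℝ)))), ?_⟩
  have hki : (k i : ℂ) ≠ 0 := by exact_mod_cast hi
  rw [mFourier_torusProj, Finset.sum_eq_single i]
  · rw [PiLp.single_apply, if_pos rfl]
    have : 2 * Real.pi * Complex.I * ((k i : ℂ) * ((1 / (2 * (k i : ℝ)) : ℝ) : ℂ)) =
        Real.pi * Complex.I := by
      push_cast
      field_simp
    rw [this, Complex.exp_pi_mul_I]
    norm_num
  · intro j _ hj
    simp [hj]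
  · simp

/-- A constant is invariant under translation by `a`, while its coefficient is multiplied by the
character at `a`, which can be chosen different from `1`. -/
theorem mFourierCoeff_const (c : ℂ) {k : Fin d → ℤ} (hk : k ≠ 0) :
    mFourierCoeff (fun _ : Torus d => c) k = 0 := by
  obtain ⟨a, ha⟩ := exists_mFourier_ne_one hk
  have h := mFourierCoeff_comp_add (fun _ : Torus d => c) a k
  have h2 : (mFourier k a - 1) * mFourierCoeff (fun _ : Torus d => c) k = 0 := by
    rw [sub_mul, ← h, one_mul, sub_self]
  exact (mul_eq_zero.mp h2).resolve_left (sub_ne_zero.mpr ha)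

theorem mFourierCoeff_sum {ι : Type*} (s : Finset ι) (f : ι → Torus d → ℂ)
    (hf : ∀ i ∈ s, Continuous (f i)) (k : Fin d → ℤ) :
    mFourierCoeff (fun t => ∑ i ∈ s, f i t) k = ∑ i ∈ s, mFourierCoeff (f i) k := by
  change ∫ t, mFourier (-k) t • (∑ i ∈ s, f i t)
      ∂(Measure.pi fun _ => AddCircle.haarAddCircle) =
    ∑ i ∈ s, ∫ t, mFourier (-k) t • f i t ∂(Measure.pi fun _ => AddCircle.haarAddCircle)
  rw [← integral_finsetSum]
  · simp only [Finset.smul_sum]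
  · intro i hi
    have hc : Continuous fun t => mFourier (-k) t • f i t :=
      (mFourier (-k)).continuous.smul (hf i hi)
    exact hc.integrable_of_hasCompactSupport (HasCompactSupport.of_compactSpace _)

/-- If the sum of `f` along the orbits of a rational translation is constant, then the Fourier
coefficients of `f` at the nonzero resonant frequencies vanish. -/
theorem mFourierCoeff_eq_zero_of_sum_eq {f : Torus d → ℂ} (hf : Continuous f) {n : ℕ}
    (hn : 0 < n) {a : Torus d} {c : ℂ}
    (hsum : ∀ t, ∑ i ∈ Finset.range n, f (t + i • a) = c) {k : Fin d → ℤ} (hk : k ≠ 0)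
    (ha : mFourier k a = 1) : mFourierCoeff f k = 0 := by
  have hpow : ∀ i : ℕ, mFourier k (i • a) = 1 := by
    intro i
    induction i with
    | zero =>
      rw [zero_smul]
      have := mFourier_apply_add k 0 a
      rw [zero_add, ha, mul_one] at this
      exact this.symm
    | succ i ih => rw [add_smul, one_smul, mFourier_apply_add, ih, ha, one_mul]
  have h1 : mFourierCoeff (fun t => ∑ i ∈ Finset.range n, f (t + i • a)) k = 0 := by
    simp only [hsum]
    exact mFourierCoeff_const c hk
  -- At a resonant frequency all `n` translates have the same coefficient, so the coefficient of the
  -- orbit sum is `n` times that of `f`.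
  rw [mFourierCoeff_sum _ (fun (i : ℕ) (t : Torus d) => f (t + i • a))
    fun i _ => hf.comp (continuous_add_const (i • a))] at h1
  simp only [mFourierCoeff_comp_add, hpow, one_mul, Finset.sum_const, Finset.card_range,
    nsmul_eq_mul] at h1
  exact (mul_eq_zero.mp h1).resolve_left (by exact_mod_cast hn.ne')

theorem contDiff_comp_torusProj_of_finite_support {G : Torus d → ℝ} (hG : Continuous G)
    (hfin : {k : Fin d → ℤ | mFourierCoeff (fun t => (G t : ℂ)) k ≠ 0}.Finite) :
    ContDiff ℝ ω (fun q : EuclideanSpace ℝ (Fin d) => G (torusProj q)) := by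
  let f : C(UnitAddTorus (Fin d), ℂ) := ⟨fun t => (G t : ℂ), Complex.continuous_ofReal.comp hG⟩
  have hsupp : ∀ k ∉ hfin.toFinset, mFourierCoeff f k = 0 := by
    intro k hk
    by_contra h
    exact hk (hfin.mem_toFinset.mpr h)
  have hsum : Summable (mFourierCoeff f) := summable_of_ne_finset_zero hsupp
  have hrep : ∀ q : EuclideanSpace ℝ (Fin d), G (torusProj q) =
      (∑ k ∈ hfin.toFinset, mFourierCoeff f k *
        Complex.exp (2 * Real.pi * Complex.I * ∑ i, (k i : ℂ) * (q i : ℂ))).re := by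
    intro q
    have h1 := (hasSum_mFourier_series_apply_of_summable hsum (torusProj q)).unique
      (hasSum_sum_of_ne_finset_zero (s := hfin.toFinset) fun k hk => by simp [hsupp k hk])
    have h2 : (G (torusProj q) : ℂ) = f (torusProj q) := rfl
    rw [← Complex.ofReal_re (G (torusProj q)), h2, h1]
    simp only [smul_eq_mul, mFourier_torusProj]
  simp only [hrep]
  refine Complex.reCLM.contDiff.comp (ContDiff.sum fun k _ => contDiff_const.mul ?_)
  refine ContDiff.cexp (contDiff_const.mul (ContDiff.sum fun i _ => contDiff_const.mul ?_))
  exact Complex.ofRealCLM.contDiff.comp (EuclideanSpace.proj i : _ →L[ℝ] ℝ).contDiff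

end FourierCoefficients

/-! ### Admissible rational vectors and resonances. -/

theorem exists_coprimePair {d : ℕ} (r : Fin d → ℚ) :
    ∃ (m : Fin d → ℤ) (n : ℕ), 0 < n ∧ CoprimePair m n ∧ ∀ i, (m i : ℚ) = n * r i := by
  classical
  have hex : ∃ n : ℕ, 0 < n ∧ ∃ m : Fin d → ℤ, ∀ i, (m i : ℚ) = n * r i := by
    refine ⟨∏ i, (r i).den, Finset.prod_pos fun i _ => (r i).den_pos,
      fun i => (r i).num * ∏ j ∈ Finset.univ.erase i, ((r j).den : ℤ), fun i => ?_⟩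
    rw [← Finset.mul_prod_erase _ _ (Finset.mem_univ i)]
    push_cast
    have := Rat.mul_den_eq_num (r i)
    rw [← this]
    ring
  obtain ⟨hpos, m, hm⟩ := Nat.find_spec hex
  refine ⟨m, Nat.find hex, hpos, ?_, hm⟩
  set n := Nat.find hex with hn
  set g := Nat.gcd (Finset.univ.gcd fun i => (m i).natAbs) n with hg
  have hgpos : 0 < g := Nat.gcd_pos_of_pos_right _ hpos
  obtain ⟨n', hn'⟩ : g ∣ n := Nat.gcd_dvd_right _ _
  have hgm : ∀ i, (g : ℤ) ∣ m i := fun i => Int.natCast_dvd.mpr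
    ((Nat.gcd_dvd_left _ _).trans (Finset.gcd_dvd (Finset.mem_univ i)))
  choose m' hm' using hgm
  have hn'pos : 0 < n' := by
    rcases Nat.eq_zero_or_pos n' with h | h
    · rw [h, mul_zero] at hn'; omega
    · exact h
  have hmin : n ≤ n' := Nat.find_min' hex ⟨hn'pos, m', fun i => by
    have h1 := hm i
    rw [hm' i, hn'] at h1
    push_cast at h1
    have h2 : (g : ℚ) ≠ 0 := by exact_mod_cast hgpos.ne'
    rw [mul_assoc] at h1
    exact mul_left_cancel₀ h2 h1⟩
  change g = 1
  rcases Nat.lt_or_ge g 2 with h | h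
  · omega
  · nlinarith

/-- `m / n` lies on one of the segments `I j • b j`. -/
def IsAdmissible {d : ℕ} (b : Fin d → Fin d → ℚ) (I : Fin d → Set ℝ) (m : Fin d → ℤ) (n : ℕ) :
    Prop :=
  0 < n ∧ CoprimePair m n ∧ ∃ j, ∃ t ∈ I j, ∀ i, (m i : ℝ) / (n : ℝ) = t * (b j i : ℝ)

theorem exists_isAdmissible {d : ℕ} {b : Fin d → Fin d → ℚ} {I : Fin d → Set ℝ} {j : Fin d}
    {t : ℚ} (ht : (t : ℝ) ∈ I j) :
    ∃ (m : Fin d → ℤ) (n : ℕ), IsAdmissible b I m n ∧ ∀ i, (m i : ℚ) = n * (t * b j i) := by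
  obtain ⟨m, n, hn, hc, h⟩ := exists_coprimePair fun i => t * b j i
  refine ⟨m, n, ⟨hn, hc, j, t, ht, fun i => ?_⟩, h⟩
  rw [div_eq_iff (by exact_mod_cast hn.ne')]
  have := h i
  have h2 : ((m i : ℚ) : ℝ) = ((n * (t * b j i) : ℚ) : ℝ) := by rw [this]
  push_cast at h2
  rw [h2]
  ring

/-- Take `t = s / N`, where `N` is the pairing of `k` with `b j` and `s` is the integer nearest to
`N * x`. The error is at most `1 / (2 |N|) < δ`, so `t` lies in `I j`, and `k` pairs with `t • b j`
to the integer `s`. -/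
theorem exists_resonant_isAdmissible {d : ℕ} {b : Fin d → Fin d → ℚ} {I : Fin d → Set ℝ}
    {j : Fin d} {x δ : ℝ} (hI : Metric.ball x δ ⊆ I j) {k : Fin d → ℤ}
    (hk : 1 < δ * |((∑ i, k i * b j i : ℚ) : ℝ)|) :
    ∃ (m : Fin d → ℤ) (n : ℕ) (s : ℤ), IsAdmissible b I m n ∧ ∑ i, k i * m i = n * s := by
  set N : ℚ := ∑ i, k i * b j i with hN
  have hN0 : N ≠ 0 := by
    rintro h
    rw [h] at hk
    norm_num at hk
  have hNr : (N : ℝ) ≠ 0 := by exact_mod_cast hN0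
  set s : ℤ := round (N * x) with hs
  have ht : (((s : ℚ) / N : ℚ) : ℝ) ∈ I j := by
    apply hI
    rw [Metric.mem_ball, Real.dist_eq]
    push_cast
    have h1 : (s : ℝ) / N - x = -(N * x - s) / N := by field_simp; ring
    rw [h1, abs_div, abs_neg, div_lt_iff₀ (abs_pos.mpr hNr)]
    have := abs_sub_round ((N : ℝ) * x)
    rw [← hs] at this
    linarith
  obtain ⟨m, n, hadm, hm⟩ := exists_isAdmissible (b := b) ht
  refine ⟨m, n, s, hadm, ?_⟩
  have : ((∑ i, k i * m i : ℤ) : ℚ) = ((n * s : ℤ) : ℚ) := by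
    push_cast
    calc ∑ i, (k i : ℚ) * m i = n * (s / N) * ∑ i, k i * b j i := by
          rw [Finset.mul_sum]
          refine Finset.sum_congr rfl fun i _ => ?_
          rw [hm]
          ring
      _ = n * s := by rw [← hN]; field_simp
  exact_mod_cast this

/-- The coordinates of `k` are fixed linear combinations of its pairings with the basis vectors, so
bounded pairings confine `k` to a box. -/
theorem finite_setOf_bounded {d : ℕ} (b : Module.Basis (Fin d) ℚ (Fin d → ℚ)) (C : Fin d → ℝ) :
    {k : Fin d → ℤ | ∀ j, |((∑ i, k i * b j i : ℚ) : ℝ)| ≤ C j}.Finite := by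
  let D : Fin d → ℤ := fun i => ⌈∑ j, |(b.repr (Pi.single i 1) j : ℝ)| * C j⌉
  refine (Set.finite_Icc (-D) D).subset fun k hk => ?_
  have key : ∀ i, |(k i : ℝ)| ≤ D i := by
    intro i
    have h1 : (k i : ℚ) = ∑ j, b.repr (Pi.single i 1) j * ∑ l, k l * b j l := by
      have h2 : ∑ l, (k l : ℚ) * (Pi.single i 1 : Fin d → ℚ) l = k i := by
        rw [Finset.sum_eq_single i]
        · simp
        · intro l _ hl; simp [hl]
        · simp
      rw [← h2]
      conv_lhs => rw [← b.sum_repr (Pi.single i 1 : Fin d → ℚ)]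
      simp only [Finset.sum_apply, Pi.smul_apply, smul_eq_mul, Finset.mul_sum]
      rw [Finset.sum_comm]
      refine Finset.sum_congr rfl fun j _ => Finset.sum_congr rfl fun l _ => ?_
      ring
    have h3 : (k i : ℝ) = ((∑ j, b.repr (Pi.single i 1) j * ∑ l, k l * b j l : ℚ) : ℝ) := by
      rw [← h1]; simp
    refine le_trans ?_ (Int.le_ceil _)
    rw [h3, Rat.cast_sum]
    refine (Finset.abs_sum_le_sum_abs _ _).trans (Finset.sum_le_sum fun j _ => ?_)
    rw [Rat.cast_mul, abs_mul]
    exact mul_le_mul_of_nonneg_left (hk j) (abs_nonneg _)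
  constructor
  · intro i
    have := neg_le_of_abs_le (key i)
    exact_mod_cast this
  · intro i
    have := le_of_abs_le (key i)
    exact_mod_cast this

/-- A function on the torus whose sums along the rational rotations of vector `m / n`, for all
`m / n` in segments along a basis, are constant, is a trigonometric polynomial. -/
theorem contDiff_omega_of_sum_eq {d : ℕ} (b : Module.Basis (Fin d) ℚ (Fin d → ℚ))
    (I : Fin d → Set ℝ) (hI : ∀ j, IsOpen (I j) ∧ (I j).Nonempty) {G : Torus d → ℝ}
    (hG : Continuous fun q : EuclideanSpace ℝ (Fin d) => G (torusProj q))
    (hsum : ∀ m n, IsAdmissible (fun j => b j) I m n → ∀ q q' : EuclideanSpace ℝ (Fin d),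
      ∑ i ∈ Finset.range n, G (torusProj (q + (i : ℝ) • ((n : ℝ)⁻¹ • intVec ℝ m))) =
        ∑ i ∈ Finset.range n, G (torusProj (q' + (i : ℝ) • ((n : ℝ)⁻¹ • intVec ℝ m)))) :
    ContDiff ℝ ω fun q : EuclideanSpace ℝ (Fin d) => G (torusProj q) := by
  have hGc : Continuous G := isQuotientMap_torusProj.continuous_iff.mpr hG
  refine contDiff_comp_torusProj_of_finite_support hGc ?_
  choose x hx using fun j => (hI j).2
  choose δ hδ hball using fun j => Metric.isOpen_iff.mp (hI j).1 (x j) (hx j)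
  refine ((finite_setOf_bounded b fun j => 1 / δ j).union (Set.finite_singleton 0)).subset ?_
  intro k hk
  by_cases hk0 : k = 0
  · exact Or.inr hk0
  refine Or.inl fun j => ?_
  by_contra hlt
  rw [not_le, div_lt_iff₀' (hδ j)] at hlt
  obtain ⟨m, n, s, hadm, hs⟩ := exists_resonant_isAdmissible (b := fun j => b j) (hball j) hlt
  have hn : (n : ℂ) ≠ 0 := by exact_mod_cast hadm.1.ne'
  refine hk (mFourierCoeff_eq_zero_of_sum_eq (Complex.continuous_ofReal.comp hGc) hadm.1
    (a := torusProj ((n : ℝ)⁻¹ • intVec ℝ m))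
    (c := ((∑ i ∈ Finset.range n, G (torusProj (0 + (i : ℝ) • ((n : ℝ)⁻¹ • intVec ℝ m))) : ℝ) : ℂ))
    ?_ hk0 ?_)
  · intro t
    obtain ⟨q, rfl⟩ := torusProj_surjective t
    rw [hsum m n hadm 0 q]
    push_cast
    refine Finset.sum_congr rfl fun i _ => ?_
    rw [torusProj_add, torusProj_natCast_smul]
    rfl
  · rw [mFourier_torusProj]
    have h1 : 2 * Real.pi * Complex.I *
        ∑ i, (k i : ℂ) * (((n : ℝ)⁻¹ • intVec ℝ m : EuclideanSpace ℝ (Fin d)) i : ℂ) =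
        s * (2 * Real.pi * Complex.I) := by
      have h2 : ∑ i, (k i : ℂ) * (((n : ℝ)⁻¹ • intVec ℝ m : EuclideanSpace ℝ (Fin d)) i : ℂ) =
          (n : ℂ)⁻¹ * ((∑ i, k i * m i : ℤ) : ℂ) := by
        push_cast
        rw [Finset.mul_sum]
        refine Finset.sum_congr rfl fun i _ => ?_
        simp [intVec]
        ring
      rw [h2, hs]
      push_cast
      field_simp
    rw [h1, Complex.exp_int_mul_two_pi_mul_I]

/-! ### Entire functions of several variables are analytic. -/

section Osgood

open MeasureTheory Complex

variable {n : ℕ}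

theorem continuous_torusMap (c : Fin n → ℂ) (R : Fin n → ℝ) : Continuous (torusMap c R) := by
  unfold torusMap
  fun_prop

theorem continuous_torusMap_apply (c : Fin n → ℂ) (R : Fin n → ℝ) (i : Fin n) :
    Continuous fun θ => torusMap c R θ i :=
  (continuous_apply i).comp (continuous_torusMap c R)

theorem norm_torusMap_zero (R : ℝ) (hR : 0 < R) (θ : Fin n → ℝ) (i : Fin n) :
    ‖torusMap 0 (fun _ => R) θ i‖ = R := by
  simp [torusMap, Complex.norm_exp_ofReal_mul_I, abs_of_pos hR]

theorem torusMap_sub_ne_zero {R : ℝ} {z : ℂ} (hz : ‖z‖ < R) (θ : Fin n → ℝ) (i : Fin n) :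
    torusMap 0 (fun _ => R) θ i - z ≠ 0 := by
  intro h
  have h1 := norm_torusMap_zero R ((norm_nonneg _).trans_lt hz) θ i
  rw [sub_eq_zero.mp h] at h1
  exact hz.ne h1

theorem continuous_torusMap_sub_inv {R : ℝ} {z : ℂ} (hz : ‖z‖ < R) (i : Fin n) :
    Continuous fun θ => (torusMap 0 (fun _ => R) θ i - z)⁻¹ :=
  ((continuous_torusMap_apply _ _ i).sub continuous_const).inv₀ fun θ => torusMap_sub_ne_zero hz θ i

/-- Cauchy's integral formula for a polydisc. -/
theorem torusIntegral_prod_inv_mul {R : ℝ} {f : (Fin n → ℂ) → ℂ} (hf : Differentiable ℂ f)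
    {z : Fin n → ℂ} (hz : ∀ i, ‖z i‖ < R) :
    torusIntegral (fun ζ => (∏ i, (ζ i - z i)⁻¹) * f ζ) 0 (fun _ => R) =
      (2 * Real.pi * I) ^ n * f z := by
  induction n with
  | zero =>
    rw [torusIntegral_dim0]
    simp [Subsingleton.elim z 0]
  | succ n ih =>
    have hint : TorusIntegrable (fun ζ => (∏ i, (ζ i - z i)⁻¹) * f ζ) 0 (fun _ => R) := by
      have h1 : Continuous fun θ => ∏ i, (torusMap 0 (fun _ => R) θ i - z i)⁻¹ :=
        continuous_finsetProd _ fun i _ => continuous_torusMap_sub_inv (hz i) i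
      have h2 : Continuous fun θ => f (torusMap 0 (fun _ => R) θ) :=
        hf.continuous.comp (continuous_torusMap _ _)
      exact (h1.mul h2).integrableOn_Icc
    rw [torusIntegral_succ hint]
    have hcons : ∀ x : ℂ, Differentiable ℂ fun y : Fin n → ℂ => f (Fin.cons x y) := by
      intro x
      refine hf.comp (differentiable_pi.mpr fun i => ?_)
      refine Fin.cases ?_ (fun j => ?_) i
      · simp
      · simpa using differentiable_apply j
    have hinner : ∀ x : ℂ, torusIntegral (fun y : Fin n → ℂ =>
        (∏ i, ((Fin.cons x y : Fin (n + 1) → ℂ) i - z i)⁻¹) * f (Fin.cons x y))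
        ((0 : Fin (n + 1) → ℂ) ∘ Fin.succ) ((fun _ => R) ∘ Fin.succ) =
        (x - z 0)⁻¹ • ((2 * Real.pi * I) ^ n * f (Fin.cons x (Fin.tail z))) := by
      intro x
      rw [← ih (hcons x) (z := Fin.tail z) fun i => hz i.succ, smul_eq_mul,
        ← torusIntegral_const_mul]
      simp only [Fin.prod_univ_succ, Fin.cons_zero, Fin.cons_succ, Fin.tail, mul_assoc]
      rfl
    have hcongr : (fun x : ℂ => torusIntegral (fun y : Fin n → ℂ =>
        (∏ i, ((Fin.cons x y : Fin (n + 1) → ℂ) i - z i)⁻¹) * f (Fin.cons x y))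
        ((0 : Fin (n + 1) → ℂ) ∘ Fin.succ) ((fun _ => R) ∘ Fin.succ)) = _ := funext hinner
    refine (congrArg (fun φ => circleIntegral φ 0 R) hcongr).trans ?_
    have hd : Differentiable ℂ fun x : ℂ => (2 * Real.pi * I) ^ n * f (Fin.cons x (Fin.tail z)) := by
      refine (hf.comp (differentiable_pi.mpr fun i => ?_)).const_mul _
      refine Fin.cases ?_ (fun j => ?_) i
      · simp
      · simp
    have h := (hd.differentiableOn (s := Metric.closedBall 0 R)).circleIntegral_sub_inv_smul
      (w := z 0) (by simpa using hz 0)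
    refine h.trans ?_
    rw [Fin.cons_self_tail, smul_eq_mul]
    ring

/-- Integration of bounded continuous functions against an integrable weight. -/
noncomputable def weightedIntegralCLM {X : Type*} [TopologicalSpace X] [MeasurableSpace X]
    [OpensMeasurableSpace X] (μ : Measure X) (w : X → ℂ) (hw : Integrable w μ) :
    BoundedContinuousFunction X ℂ →L[ℂ] ℂ :=
  LinearMap.mkContinuous
    { toFun := fun φ => ∫ x, φ x * w x ∂μ
      map_add' := fun φ ψ => by
        simp only [BoundedContinuousFunction.add_apply, add_mul]
        exact integral_add
          (hw.bdd_mul φ.continuous.aestronglyMeasurable (ae_of_all _ φ.norm_coe_le_norm))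
          (hw.bdd_mul ψ.continuous.aestronglyMeasurable (ae_of_all _ ψ.norm_coe_le_norm))
      map_smul' := fun c φ => by
        simp only [BoundedContinuousFunction.coe_smul, smul_eq_mul, RingHom.id_apply, mul_assoc]
        exact integral_const_mul c _ }
    (∫ x, ‖w x‖ ∂μ) fun φ => by
      refine (norm_integral_le_integral_norm _).trans ?_
      rw [mul_comm, ← integral_const_mul]
      refine integral_mono_of_nonneg (ae_of_all _ fun x => norm_nonneg _)
        (hw.norm.const_mul _) (ae_of_all _ fun x => ?_)
      change ‖φ x * w x‖ ≤ ‖φ‖ * ‖w x‖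
      rw [norm_mul]
      exact mul_le_mul_of_nonneg_right (φ.norm_coe_le_norm x) (norm_nonneg _)

theorem weightedIntegralCLM_apply {X : Type*} [TopologicalSpace X] [MeasurableSpace X]
    [OpensMeasurableSpace X] (μ : Measure X) (w : X → ℂ) (hw : Integrable w μ)
    (φ : BoundedContinuousFunction X ℂ) :
    weightedIntegralCLM μ w hw φ = ∫ x, φ x * w x ∂μ := rfl

/-- The coordinate functions on the torus of radius `R`. -/
noncomputable def torusCoord (R : ℝ) (hR : 0 < R) (i : Fin n) :
    BoundedContinuousFunction (Fin n → ℝ) ℂ :=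
  BoundedContinuousFunction.ofNormedAddCommGroup (fun θ => torusMap 0 (fun _ => R) θ i)
    (continuous_torusMap_apply _ _ i) R
    fun θ => (norm_torusMap_zero R hR θ i).le

/-- The units `ζ i - z` of the algebra of bounded continuous functions of `ζ` in the torus. -/
noncomputable def torusCoordUnit (R : ℝ) (hR : 0 < R) (i : Fin n) (z : ℂ) (hz : ‖z‖ < R) :
    (BoundedContinuousFunction (Fin n → ℝ) ℂ)ˣ where
  val := torusCoord R hR i - algebraMap ℂ _ z
  inv := BoundedContinuousFunction.ofNormedAddCommGroup
    (fun θ => (torusMap 0 (fun _ => R) θ i - z)⁻¹)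
    (continuous_torusMap_sub_inv hz i) (R - ‖z‖)⁻¹
    fun θ => by
      rw [norm_inv]
      refine inv_anti₀ (by linarith) ?_
      have := norm_sub_norm_le (torusMap 0 (fun _ => R) θ i) z
      rwa [norm_torusMap_zero R hR] at this
  val_inv := by
    ext θ
    exact mul_inv_cancel₀ (torusMap_sub_ne_zero hz θ i)
  inv_val := by
    ext θ
    exact inv_mul_cancel₀ (torusMap_sub_ne_zero hz θ i)

/-- **Osgood's lemma** for entire functions. -/
theorem contDiff_omega_of_differentiable {f : (Fin n → ℂ) → ℂ} (hf : Differentiable ℂ f) :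
    ContDiff ℂ ω f := by
  refine contDiff_iff_contDiffAt.mpr fun z₀ => ?_
  set R := ‖z₀‖ + 1 with hRdef
  have hR : 0 < R := by positivity
  set μ := (volume : Measure (Fin n → ℝ)).restrict (Set.Icc 0 fun _ => 2 * Real.pi) with hμ
  have hw : Integrable (fun θ : Fin n → ℝ => (∏ i, (R : ℂ) * exp (θ i * I) * I) *
      f (torusMap 0 (fun _ => R) θ)) μ := by
    have hc : Continuous (fun θ : Fin n → ℝ => (∏ i, (R : ℂ) * exp (θ i * I) * I) *
      f (torusMap 0 (fun _ => R) θ)) :=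
      Continuous.mul (by fun_prop) (hf.continuous.comp (continuous_torusMap _ _))
    exact hc.integrableOn_Icc
  set Λ := weightedIntegralCLM μ _ hw with hΛ
  -- Cauchy's formula writes `f` near `z₀` as a continuous linear functional of the Cauchy kernel.
  -- The kernel is analytic in `z` as a map to the Banach algebra of bounded continuous functions,
  -- since inversion is analytic at units.
  set K : (Fin n → ℂ) → BoundedContinuousFunction (Fin n → ℝ) ℂ := fun z =>
    ∏ i, Ring.inverse (torusCoord R hR i - algebraMap ℂ _ (z i)) with hK
  have hcoord : ∀ i, ‖z₀ i‖ < R := fun i =>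
    (norm_le_pi_norm z₀ i).trans_lt (by linarith)
  have hKan : ContDiffAt ℂ ω K z₀ := by
    refine contDiffAt_prod fun i _ => ?_
    have h1 := contDiffAt_ringInverse ℂ (n := ω) (torusCoordUnit R hR i (z₀ i) (hcoord i))
    have h2 : ContDiffAt ℂ ω (fun z : Fin n → ℂ => torusCoord R hR i -
        algebraMap ℂ (BoundedContinuousFunction (Fin n → ℝ) ℂ) (z i)) z₀ :=
      contDiffAt_const.sub (ContDiffAt.comp z₀
        (algebraMapCLM ℂ (BoundedContinuousFunction (Fin n → ℝ) ℂ)).contDiff.contDiffAt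
        (contDiff_apply ℂ ℂ i).contDiffAt)
    exact ContDiffAt.comp z₀ h1 h2
  have hrep : f =ᶠ[𝓝 z₀] fun z => ((2 * Real.pi * I) ^ n)⁻¹ * Λ (K z) := by
    have hnhds : ∀ᶠ z in 𝓝 z₀, ‖z‖ < R :=
      continuous_norm.continuousAt.eventually_lt continuousAt_const (by linarith)
    filter_upwards [hnhds] with z hz
    have hzi : ∀ i, ‖z i‖ < R := fun i => (norm_le_pi_norm z i).trans_lt hz
    have h2 : (2 * Real.pi * I : ℂ) ^ n ≠ 0 := pow_ne_zero _ Complex.two_pi_I_ne_zero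
    rw [eq_inv_mul_iff_mul_eq₀ h2, ← torusIntegral_prod_inv_mul hf hzi, hΛ,
      weightedIntegralCLM_apply, torusIntegral]
    congr 1 with θ
    have hKz : K z θ = ∏ i, (torusMap 0 (fun _ => R) θ i - z i)⁻¹ := by
      have : K z = ∏ i, ((torusCoordUnit R hR i (z i) (hzi i))⁻¹ :
          (BoundedContinuousFunction (Fin n → ℝ) ℂ)ˣ).val :=
        Finset.prod_congr rfl fun i _ =>
          Ring.inverse_unit (torusCoordUnit R hR i (z i) (hzi i))
      rw [this, BoundedContinuousFunction.prod_apply]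
      rfl
    rw [hKz, smul_eq_mul]
    ring
  exact (contDiffAt_const.mul (Λ.contDiff.contDiffAt.comp z₀ hKan)).congr_of_eventuallyEq hrep

end Osgood

/-! ### Lifts, generating functions and analyticity of the integrable map. -/

section Extraction

variable {d : ℕ}

theorem contDiff_omega_of_complexify {Φ : EuclideanSpace ℂ (Fin d) → EuclideanSpace ℂ (Fin d)}
    (hΦ : Differentiable ℂ Φ) {L : EuclideanSpace ℝ (Fin d) → EuclideanSpace ℝ (Fin d)}
    (hL : ∀ p i, Φ (WithLp.toLp 2 fun j => (p j : ℂ)) i = (L p i : ℂ)) : ContDiff ℝ ω L := by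
  rw [contDiff_euclidean]
  intro i
  have h1 : Differentiable ℂ fun y : Fin d → ℂ => Φ (WithLp.toLp 2 y) i :=
    (EuclideanSpace.proj i : EuclideanSpace ℂ (Fin d) →L[ℂ] ℂ).differentiable.comp
      (hΦ.comp (EuclideanSpace.equiv (Fin d) ℂ).symm.differentiable)
  have h2 : ContDiff ℝ ω fun y : Fin d → ℂ => Φ (WithLp.toLp 2 y) i :=
    (contDiff_omega_of_differentiable h1).restrict_scalars ℝ
  have h3 : ContDiff ℝ ω fun p : EuclideanSpace ℝ (Fin d) => (fun j => (p j : ℂ) : Fin d → ℂ) :=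
    contDiff_pi.mpr fun j =>
      Complex.ofRealCLM.contDiff.comp (EuclideanSpace.proj j : _ →L[ℝ] ℝ).contDiff
  have h4 := Complex.reCLM.contDiff.comp (h2.comp h3)
  have h5 : (fun p => L p i) = Complex.reCLM ∘ (fun y : Fin d → ℂ => Φ (WithLp.toLp 2 y) i) ∘
      fun p : EuclideanSpace ℝ (Fin d) => (fun j => (p j : ℂ) : Fin d → ℂ) := by
    funext p
    simp [hL]
  rw [h5]
  exact h4

theorem pairing_eq_inner (w v : EuclideanSpace ℝ (Fin d)) : pairing w v = ⟪w, v⟫ := by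
  simp [pairing, PiLp.inner_apply, mul_comm]

/-- A continuous integer-valued function on a connected space is constant. -/
theorem exists_eq_intVec_of_torusProj_eq_zero {X : Type*} [TopologicalSpace X]
    [PreconnectedSpace X] [Nonempty X] {φ : X → EuclideanSpace ℝ (Fin d)} (hφ : Continuous φ)
    (h : ∀ x, torusProj (φ x) = 0) : ∃ k : Fin d → ℤ, ∀ x, φ x = intVec ℝ k := by
  have h1 : ∀ x i, ∃ k : ℤ, (k : ℝ) = φ x i := by
    intro x i
    have := congrFun (h x) i
    simp only [torusProj, Pi.zero_apply, AddCircle.coe_eq_zero_iff] at this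
    obtain ⟨k, hk⟩ := this
    exact ⟨k, by simpa using hk⟩
  choose k hk using h1
  have hkc : ∀ i, Continuous fun x => k x i := by
    intro i
    rw [Int.isClosedEmbedding_coe_real.isInducing.continuous_iff]
    have : ((fun m : ℤ => (m : ℝ)) ∘ fun x => k x i) = fun x => φ x i := funext fun x => hk x i
    rw [this]
    exact (EuclideanSpace.proj i : _ →L[ℝ] ℝ).continuous.comp hφ
  obtain ⟨x₀⟩ := ‹Nonempty X›
  refine ⟨k x₀, fun x => ?_⟩
  ext i
  rw [← hk x i, PreconnectedSpace.constant inferInstance (hkc i) (x := x) (y := x₀)]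
  rfl

theorem torusProj_sub_eq_zero {p q : EuclideanSpace ℝ (Fin d)} (h : torusProj p = torusProj q) :
    torusProj (p - q) = 0 := by
  have := torusProj_add (p - q) q
  rw [sub_add_cancel, h] at this
  exact left_eq_add.mp (by rw [add_comm]; exact this)

/-- Two lifts of a map of the annulus differ by an integer translation. -/
theorem IsLift.exists_eq_add_intVec {F F' : PhaseSpace ℝ d → PhaseSpace ℝ d}
    {f : Annulus d → Annulus d} (hF : IsLift F f) (hF' : IsLift F' f) :
    ∃ k : Fin d → ℤ, ∀ x, F' x = ((F x).1 + intVec ℝ k, (F x).2) := by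
  have h : ∀ x, torusProj (F x).1 = torusProj (F' x).1 ∧ (F x).2 = (F' x).2 := fun x =>
    Prod.ext_iff.mp ((hF.2 x.1 x.2).symm.trans (hF'.2 x.1 x.2))
  obtain ⟨k, hk⟩ := exists_eq_intVec_of_torusProj_eq_zero
    ((continuous_fst.comp hF'.1).sub (continuous_fst.comp hF.1))
    fun x => torusProj_sub_eq_zero (h x).1.symm
  refine ⟨k, fun x => Prod.ext ?_ (h x).2.symm⟩
  simp [← hk x]

/-- A lift of an integrable map is an integrable map. -/
theorem IsLift.eq_of_integrable {F : PhaseSpace ℝ d → PhaseSpace ℝ d} {f : Annulus d → Annulus d}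
    (hF : IsLift F f) {Ω : EuclideanSpace ℝ (Fin d) → EuclideanSpace ℝ (Fin d)}
    (hΩ : Continuous Ω) (hf : ∀ θ p, f (θ, p) = (θ + torusProj (Ω p), p)) :
    ∃ k : Fin d → ℤ, ∀ q p, F (q, p) = (q + (Ω p + intVec ℝ k), p) := by
  have h : IsLift (fun x : PhaseSpace ℝ d => (x.1 + Ω x.2, x.2)) f :=
    ⟨(continuous_fst.add (hΩ.comp continuous_snd)).prodMk continuous_snd, fun q p => by
      rw [hf, torusProj_add]⟩
  obtain ⟨k, hk⟩ := h.exists_eq_add_intVec hF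
  exact ⟨k, fun q p => by rw [hk, add_assoc]⟩

/-- The differential of a generating function of an integrable map. -/
theorem IsGeneratingFunction.hasFDerivAt_of_integrable {F : PhaseSpace ℝ d → PhaseSpace ℝ d}
    {S : PhaseSpace ℝ d → ℝ} (hS : IsGeneratingFunction ℝ F S)
    {L H : EuclideanSpace ℝ (Fin d) → EuclideanSpace ℝ (Fin d)} (hLH : ∀ v, L (H v) = v)
    (hF : ∀ q p, F (q, p) = (q + L p, p)) (q Q : EuclideanSpace ℝ (Fin d)) :
    HasFDerivAt S ((pairing (H (Q - q))).comp
        (ContinuousLinearMap.snd ℝ (EuclideanSpace ℝ (Fin d)) (EuclideanSpace ℝ (Fin d))) -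
      (pairing (H (Q - q))).comp
        (ContinuousLinearMap.fst ℝ (EuclideanSpace ℝ (Fin d)) (EuclideanSpace ℝ (Fin d))))
      (q, Q) := by
  have h := hS.hasFDerivAt q (H (Q - q))
  rw [hF, hLH] at h
  simpa using h

theorem IsGeneratingFunction.hasGradientAt_of_integrable {F : PhaseSpace ℝ d → PhaseSpace ℝ d}
    {S : PhaseSpace ℝ d → ℝ} (hS : IsGeneratingFunction ℝ F S)
    {L H : EuclideanSpace ℝ (Fin d) → EuclideanSpace ℝ (Fin d)} (hLH : ∀ v, L (H v) = v)
    (hF : ∀ q p, F (q, p) = (q + L p, p)) (v : EuclideanSpace ℝ (Fin d)) :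
    HasGradientAt (fun v => S (0, v)) (H v) v := by
  rw [hasGradientAt_iff_hasFDerivAt]
  have h := (hS.hasFDerivAt_of_integrable hLH hF 0 v).comp v
    ((hasFDerivAt_const (0 : EuclideanSpace ℝ (Fin d)) v).prodMk (hasFDerivAt_id v))
  refine h.congr_fderiv ?_
  ext w
  simp [pairing_eq_inner]

/-- The map generated by `S(q, Q) + ε G(q)`, if `S` generates an integrable map. -/
theorem IsGeneratingFunction.eq_of_perturbed_integrable {F F' : PhaseSpace ℝ d → PhaseSpace ℝ d}
    {S : PhaseSpace ℝ d → ℝ} (hS : IsGeneratingFunction ℝ F S)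
    {L H : EuclideanSpace ℝ (Fin d) → EuclideanSpace ℝ (Fin d)} (hLH : ∀ v, L (H v) = v)
    (hF : ∀ q p, F (q, p) = (q + L p, p)) {G : EuclideanSpace ℝ (Fin d) → ℝ}
    {g : EuclideanSpace ℝ (Fin d) → EuclideanSpace ℝ (Fin d)} (hg : ∀ q, HasGradientAt G (g q) q)
    {ε : ℝ} (hS' : IsGeneratingFunction ℝ F' fun x => S x + ε * G x.1)
    (q p : EuclideanSpace ℝ (Fin d)) :
    F' (q, p) = (q + L (p + ε • g q), p + ε • g q) := by
  have h1 := hS'.hasFDerivAt q p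
  set Q := (F' (q, p)).1 with hQ
  set P := (F' (q, p)).2 with hP
  have h2 := (hS.hasFDerivAt_of_integrable hLH hF q Q).add
    (((hg q).hasFDerivAt.comp (q, Q) hasFDerivAt_fst).const_mul ε)
  have h3 := h1.unique h2
  have hP' : P = H (Q - q) := by
    refine ext_inner_right ℝ fun v => ?_
    have := congrArg (fun Λ => Λ (0, v)) h3
    simpa [pairing_eq_inner] using this
  have hp' : p = H (Q - q) - ε • g q := by
    refine ext_inner_right ℝ fun v => ?_
    have := congrArg (fun Λ => Λ (v, 0)) h3
    simp [pairing_eq_inner] at this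
    rw [inner_sub_left, real_inner_smul_left]
    linarith
  have hPp : P = p + ε • g q := by rw [hP', hp']; abel
  refine Prod.ext ?_ hPp
  change Q = q + L (p + ε • g q)
  rw [← hPp, hP', hLH]
  abel

/-- The derivative of `S` in `Q` is pairing with `H (Q - q)`; differentiating in `q` along `v`
produces the sign. This turns the bounds of strong positivity into convexity bounds. -/
theorem inner_fderiv_of_generating {F : PhaseSpace ℝ d → PhaseSpace ℝ d}
    {S : PhaseSpace ℝ d → ℝ} (hS : IsGeneratingFunction ℝ F S) (hS2 : ContDiff ℝ 2 S)
    {L H : EuclideanSpace ℝ (Fin d) → EuclideanSpace ℝ (Fin d)} (hLH : ∀ v, L (H v) = v)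
    (hF : ∀ q p, F (q, p) = (q + L p, p)) (hH : Differentiable ℝ H)
    (u v : EuclideanSpace ℝ (Fin d)) :
    ⟪fderiv ℝ H u v, v⟫ = -fderiv ℝ (fderiv ℝ S) (0, u) (v, 0) (0, v) := by
  have hline : HasDerivAt (fun t : ℝ => ((t • v, u) : PhaseSpace ℝ d)) (v, 0) 0 := by
    have h := ((hasDerivAt_id (0 : ℝ)).smul_const v).prodMk (hasDerivAt_const (0 : ℝ) u)
    rwa [one_smul] at h
  have hd : Differentiable ℝ (fderiv ℝ S) :=
    (hS2.fderiv_right (m := 1) (by norm_num)).differentiable (by norm_num)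
  have h1 : HasDerivAt (fun t : ℝ => fderiv ℝ S (t • v, u) (0, v))
      (fderiv ℝ (fderiv ℝ S) (0, u) (v, 0) (0, v)) 0 := by
    have h0 : HasFDerivAt (fderiv ℝ S) (fderiv ℝ (fderiv ℝ S) (0, u)) ((0 : ℝ) • v, u) := by
      rw [zero_smul]
      exact (hd (0, u)).hasFDerivAt
    exact (ContinuousLinearMap.apply ℝ ℝ ((0, v) : PhaseSpace ℝ d)).hasFDerivAt.comp_hasDerivAt
      (0 : ℝ) (HasFDerivAt.comp_hasDerivAt (0 : ℝ) h0 hline)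
  have h2 : HasDerivAt (fun t : ℝ => ⟪H (u - t • v), v⟫) (-⟪fderiv ℝ H u v, v⟫) 0 := by
    have hl : HasDerivAt (fun t : ℝ => u - t • v) (-v) 0 := by
      simpa using (((hasDerivAt_id (0 : ℝ)).smul_const v).const_sub u)
    have h0 : HasFDerivAt H (fderiv ℝ H u) ((fun t : ℝ => u - t • v) 0) := by
      simpa using (hH u).hasFDerivAt
    have h := (h0.comp_hasDerivAt (0 : ℝ) hl).inner ℝ (hasDerivAt_const (0 : ℝ) v)
    simpa using h
  have h3 : (fun t : ℝ => fderiv ℝ S (t • v, u) (0, v)) = fun t => ⟪H (u - t • v), v⟫ := by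
    funext t
    rw [(hS.hasFDerivAt_of_integrable hLH hF (t • v) u).fderiv]
    simp [pairing_eq_inner]
  rw [h3] at h1
  rw [h1.unique h2]
  ring

/-- Bounds on the quadratic form of the derivative give bounds on increments. -/
theorem exists_inner_fderiv_eq {E : Type*} [NormedAddCommGroup E] [InnerProductSpace ℝ E]
    {H : E → E} (hH : Differentiable ℝ H) (u v : E) :
    ∃ w, ⟪H u - H v, u - v⟫ = ⟪fderiv ℝ H w (u - v), u - v⟫ := by
  have hd : ∀ t : ℝ, HasDerivAt (fun t : ℝ => ⟪H (v + t • (u - v)), u - v⟫)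
      ⟪fderiv ℝ H (v + t • (u - v)) (u - v), u - v⟫ t := by
    intro t
    have hl : HasDerivAt (fun t : ℝ => v + t • (u - v)) (u - v) t := by
      simpa using (((hasDerivAt_id t).smul_const (u - v)).const_add v)
    have h := ((hH (v + t • (u - v))).hasFDerivAt.comp_hasDerivAt t hl).inner ℝ
      (hasDerivAt_const t (u - v))
    simpa using h
  obtain ⟨t, -, ht⟩ := exists_hasDerivAt_eq_slope _ _ zero_lt_one
    (fun t _ => (hd t).continuousAt.continuousWithinAt) fun t _ => hd t
  refine ⟨v + t • (u - v), ?_⟩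
  rw [ht]
  simp [inner_sub_left]

end Extraction

/-! ### Gradients of periodic functions. -/

section PeriodicGradient

variable {d : ℕ}

theorem gradient_add_intVec {G : EuclideanSpace ℝ (Fin d) → ℝ}
    (hper : ∀ (k : Fin d → ℤ) q, G (q + intVec ℝ k) = G q) (k : Fin d → ℤ)
    (q : EuclideanSpace ℝ (Fin d)) : gradient G (q + intVec ℝ k) = gradient G q := by
  have h : (fun x => G (x + intVec ℝ k)) = G := funext (hper k)
  rw [gradient, gradient, ← fderiv_comp_add_right, h]

theorem ContDiff.gradient {E : Type*} [NormedAddCommGroup E] [InnerProductSpace ℝ E]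
    [CompleteSpace E] {G : E → ℝ} {m n : WithTop ℕ∞} (hG : ContDiff ℝ n G) (hmn : m + 1 ≤ n) :
    ContDiff ℝ m (gradient G) :=
  (InnerProductSpace.toDual ℝ E).symm.contDiff.comp (hG.fderiv_right hmn)

theorem exists_lipschitz_of_periodic {g : EuclideanSpace ℝ (Fin d) → EuclideanSpace ℝ (Fin d)}
    (hg : ContDiff ℝ 1 g) (hper : ∀ (k : Fin d → ℤ) q, g (q + intVec ℝ k) = g q) :
    ∃ M, 0 ≤ M ∧ ∀ u v, ‖g u - g v‖ ≤ M * ‖u - v‖ := by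
  obtain ⟨M, hM, hb⟩ := exists_norm_le_of_periodic (hg.continuous_fderiv (by norm_num))
    fun k q => by
      have h : (fun x => g (x + intVec ℝ k)) = g := funext (hper k)
      rw [← fderiv_comp_add_right, h]
  exact ⟨M, hM, fun u v => convex_univ.norm_image_sub_le_of_norm_fderiv_le
    (fun x _ => (hg.differentiable (by norm_num)).differentiableAt) (fun x _ => hb x)
    (Set.mem_univ v) (Set.mem_univ u)⟩

end PeriodicGradient

/-! ### Reduction to the standard family and conclusion. -/

/-- The bounds on the second derivative of `S` give the monotonicity of `(∇ℓ)⁻¹`. -/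
theorem StronglyPositive.exists_inner_bounds {d : ℕ} {f : Annulus d → Annulus d}
    (h_pos : StronglyPositive f) {Ω N : EuclideanSpace ℝ (Fin d) → EuclideanSpace ℝ (Fin d)}
    (hΩ : Continuous Ω) (hN : Differentiable ℝ N) (hΩN : ∀ v, Ω (N v) = v)
    (hf : ∀ θ p, f (θ, p) = (θ + torusProj (Ω p), p)) :
    ∃ α β : ℝ, 0 < α ∧ 0 < β ∧ ∀ u v, α * ‖u - v‖ ^ 2 ≤ ⟪N u - N v, u - v⟫ ∧
      ⟪N u - N v, u - v⟫ ≤ β * ‖u - v‖ ^ 2 := by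
  obtain ⟨S, ⟨F, hF, hS⟩, hS2, α, β, hα, hβ, hb⟩ := h_pos
  -- The lift in the definition of strong positivity may differ from other lifts by an integer
  -- vector. This only translates the argument of `N` and leaves the bounds on increments unchanged.
  obtain ⟨k, hk⟩ := hF.eq_of_integrable hΩ hf
  refine ⟨α, β, hα, hβ, fun u v => ?_⟩
  have hH : Differentiable ℝ fun w => N (w - intVec ℝ k) :=
    hN.comp (differentiable_id.sub_const _)
  obtain ⟨w, hw⟩ := exists_inner_fderiv_eq hH (u + intVec ℝ k) (v + intVec ℝ k)
  have h1 := inner_fderiv_of_generating hS hS2 (L := fun p => Ω p + intVec ℝ k)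
    (fun v => by rw [hΩN, sub_add_cancel]) hk hH w (u - v)
  simp only [add_sub_cancel_right, add_sub_add_right_eq_sub] at hw
  rw [hw, h1]
  have := hb 0 w (u - v)
  constructor <;> linarith [this.1, this.2]

/-- Restricted to `q = 0`, the position component of the lift is `Ω` plus an integer vector, and it
extends to an entire map. -/
theorem AnalyticityProperty.contDiff_omega {d : ℕ} {f : Annulus d → Annulus d}
    (h_an : AnalyticityProperty f) {Ω : EuclideanSpace ℝ (Fin d) → EuclideanSpace ℝ (Fin d)}
    (hΩ : Continuous Ω) (hf : ∀ θ p, f (θ, p) = (θ + torusProj (Ω p), p)) : ContDiff ℝ ω Ω := by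
  obtain ⟨Fc, hFc, ⟨F, hF, hFcF⟩, -, -⟩ := h_an
  obtain ⟨k, hk⟩ := hF.eq_of_integrable hΩ hf
  have hd : Differentiable ℂ fun p : EuclideanSpace ℂ (Fin d) => (Fc (0, p)).1 :=
    (hFc.1.differentiable (by norm_num)).fst.comp
      ((differentiable_const 0).prodMk differentiable_id)
  have h : ContDiff ℝ ω fun p => Ω p + intVec ℝ k := by
    refine contDiff_omega_of_complexify hd fun p i => ?_
    have h1 := hFcF (0, p)
    rw [hk, zero_add] at h1
    have h2 : complexify ((0, p) : PhaseSpace ℝ d) = (0, WithLp.toLp 2 fun j => (p j : ℂ)) := by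
      refine Prod.ext ?_ rfl
      ext j
      simp [complexify]
    rw [h2] at h1
    rw [h1]
    rfl
  simpa using h.sub (contDiff_const (c := intVec ℝ k))

/-- The perturbations of an integrable twist map form a standard family. -/
theorem exists_standardFamily {d : ℕ} {f : Annulus d → Annulus d}
    {F : PhaseSpace ℝ d → PhaseSpace ℝ d} (hF : IsLift F f)
    {S : PhaseSpace ℝ d → ℝ} (hS : IsGeneratingFunction ℝ F S)
    {G : Torus d → ℝ} (hG : ContDiff ℝ 2 (fun q : EuclideanSpace ℝ (Fin d) => G (torusProj q)))
    {fε : ℝ → Annulus d → Annulus d}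
    (hSε : ∀ ε, HasGeneratingFunction (fε ε) (fun x => S x + ε * G (torusProj x.1)))
    {Fε : ℝ → PhaseSpace ℝ d → PhaseSpace ℝ d} (hFε : ∀ ε, IsLift (Fε ε) (fε ε))
    (hFε_cont : Continuous (fun y : ℝ × PhaseSpace ℝ d => Fε y.1 y.2))
    (h_int : CompletelyIntegrable f) (h_pos : StronglyPositive f) (h_an : AnalyticityProperty f) :
    ∃ A : StandardFamily d, (∀ q, A.G q = G (torusProj q)) ∧ A.g = gradient A.G ∧
      ContDiff ℝ ω A.L ∧ ∀ ε, A.map ε = Fε ε := by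
  obtain ⟨ℓ, -, ⟨hΩ, N, hN, hNΩ, hΩN⟩, hf⟩ := h_int
  set Ω := gradient ℓ with hΩdef
  obtain ⟨k₀, hk₀⟩ := hF.eq_of_integrable hΩ.continuous hf
  obtain ⟨α, β, hα, hβ, hbounds⟩ := h_pos.exists_inner_bounds hΩ.continuous
    (hN.differentiable (by norm_num)) hΩN hf
  set G' : EuclideanSpace ℝ (Fin d) → ℝ := fun q => G (torusProj q) with hG'
  have hper : ∀ (k : Fin d → ℤ) q, G' (q + intVec ℝ k) = G' q := fun k q => by
    simp only [hG', torusProj_add, torusProj_intVec, add_zero]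
  set g := gradient G' with hgdef
  have hgc : ContDiff ℝ 1 g := hG.gradient (by norm_num)
  have hg : ∀ q, HasGradientAt G' (g q) q := fun q =>
    ((hG.differentiable (by norm_num)) q).hasGradientAt
  have hgper := gradient_add_intVec hper
  obtain ⟨M, hM, hglip⟩ := exists_lipschitz_of_periodic hgc hgper
  obtain ⟨B₁, hB₁, hGB⟩ := exists_norm_le_of_periodic hG.continuous hper
  obtain ⟨B₂, hB₂, hgB⟩ := exists_norm_le_of_periodic hgc.continuous hgper
  set L₀ : EuclideanSpace ℝ (Fin d) → EuclideanSpace ℝ (Fin d) :=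
    fun p => Ω p + intVec ℝ k₀ with hL₀
  set H₀ : EuclideanSpace ℝ (Fin d) → EuclideanSpace ℝ (Fin d) :=
    fun v => N (v - intVec ℝ k₀) with hH₀
  have hLH₀ : ∀ v, L₀ (H₀ v) = v := fun v => by
    simp only [hL₀, hH₀, hΩN (v - intVec ℝ k₀), sub_add_cancel]
  have hlift : ∀ ε, ∃ k : Fin d → ℤ, ∀ q p,
      Fε ε (q, p) = (q + L₀ (p + ε • g q) + intVec ℝ k, p + ε • g q) := by
    intro ε
    obtain ⟨F', hF', hS'⟩ := hSε ε
    obtain ⟨k, hk⟩ := hF'.exists_eq_add_intVec (hFε ε)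
    exact ⟨k, fun q p => by
      rw [hk, hS.eq_of_perturbed_integrable hLH₀ hk₀ hg hS' q p]⟩
  -- For each `ε` the given lift differs from the generated map by an integer vector. Joint
  -- continuity of `Fε` makes this vector independent of `ε`, so it can be absorbed into `L`.
  obtain ⟨k₁, hk₁⟩ := exists_eq_intVec_of_torusProj_eq_zero
    (φ := fun y : ℝ × PhaseSpace ℝ d =>
      (Fε y.1 y.2).1 - (y.2.1 + L₀ (y.2.2 + y.1 • g y.2.1))) (by
      have h1 : Continuous g := hgc.continuous
      have h2 : Continuous L₀ := hΩ.continuous.add continuous_const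
      exact hFε_cont.fst.sub (by fun_prop)) fun y => by
      obtain ⟨k, hk⟩ := hlift y.1
      rw [show y.2 = (y.2.1, y.2.2) from rfl, hk]
      simp only [add_sub_cancel_left]
      exact torusProj_intVec k
  have hmap : ∀ ε q p, Fε ε (q, p) = (q + (L₀ (p + ε • g q) + intVec ℝ k₁), p + ε • g q) := by
    intro ε q p
    obtain ⟨k, hk⟩ := hlift ε
    refine Prod.ext ?_ (by rw [hk])
    rw [← add_assoc, ← hk₁ (ε, (q, p))]
    simp
  have hh : ∀ v, HasGradientAt (fun v => S (0, v - intVec ℝ k₁)) (H₀ (v - intVec ℝ k₁)) v :=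
    fun v => by
    have h := hS.hasGradientAt_of_integrable hLH₀ hk₀ (v - intVec ℝ k₁)
    simp only [sub_eq_add_neg] at h ⊢
    exact HasGradientAt.comp_add_const (f := fun v => S (0, v)) (-intVec ℝ k₁) h
  have hsub : ∀ u v : EuclideanSpace ℝ (Fin d),
      u - intVec ℝ k₁ - intVec ℝ k₀ - (v - intVec ℝ k₁ - intVec ℝ k₀) = u - v := by
    intro u v
    abel
  refine ⟨{
    h := fun v => S (0, v - intVec ℝ k₁)
    H := fun v => H₀ (v - intVec ℝ k₁)
    L := fun p => L₀ p + intVec ℝ k₁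
    G := G'
    g := g
    α := α
    β := β
    M := M
    B := max B₁ B₂
    α_pos := hα
    β_pos := hβ
    M_nonneg := hM
    B_nonneg := hB₁.trans (le_max_left _ _)
    hasGradientAt_h := hh
    hasGradientAt_G := hg
    contDiff_H := hN.comp ((contDiff_id.sub contDiff_const).sub contDiff_const)
    H_L := fun p => by simp only [hH₀, hL₀, add_sub_cancel_right]; exact hNΩ p
    L_H := fun v => by rw [hLH₀, sub_add_cancel]
    H_mono := fun u v => by
      have h := (hbounds (u - intVec ℝ k₁ - intVec ℝ k₀) (v - intVec ℝ k₁ - intVec ℝ k₀)).1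
      rwa [hsub] at h
    h_upper := quadratic_upper_bound hh fun u v => by
      have h := (hbounds (u - intVec ℝ k₁ - intVec ℝ k₀) (v - intVec ℝ k₁ - intVec ℝ k₀)).2
      rwa [hsub] at h
    G_periodic := hper
    g_lipschitz := hglip
    G_bound := fun q => (hGB q).trans (le_max_left _ _)
    g_bound := fun q => (hgB q).trans (le_max_right _ _) }, fun q => rfl, rfl, ?_, fun ε => ?_⟩
  · exact ((h_an.contDiff_omega hΩ.continuous hf).add contDiff_const).add contDiff_const
  · funext x
    exact (hmap ε x.1 x.2).symm

theorem theorem2 (d : ℕ) (hd : 1 ≤ d)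
    (f : Annulus d → Annulus d) (hf : IsSymplecticTwistMap f)
    (F : PhaseSpace ℝ d → PhaseSpace ℝ d) (hF : IsLift F f)
    (S : PhaseSpace ℝ d → ℝ) (hS : IsGeneratingFunction ℝ F S)
    (G : Torus d → ℝ) (hG : ContDiff ℝ 2 (fun q : EuclideanSpace ℝ (Fin d) => G (torusProj q)))
    (fε : ℝ → Annulus d → Annulus d) (hfε : ∀ ε, IsSymplecticTwistMap (fε ε))
    (hSε : ∀ ε, HasGeneratingFunction (fε ε) (fun x => S x + ε * G (torusProj x.1)))
    (Fε : ℝ → PhaseSpace ℝ d → PhaseSpace ℝ d) (hFε : ∀ ε, IsLift (Fε ε) (fε ε))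
    (hFε_cont : Continuous (fun y : ℝ × PhaseSpace ℝ d => Fε y.1 y.2))
    (h_int : CompletelyIntegrable f)
    (h_pos : StronglyPositive f)
    (h_an : AnalyticityProperty f)
    (h_per : ∃ (b : Module.Basis (Fin d) ℚ (Fin d → ℚ)) (I : Fin d → Set ℝ),
      (∀ j, IsOpen (I j) ∧ (I j).OrdConnected ∧ (I j).Nonempty) ∧
      ∀ (m : Fin d → ℤ) (n : ℕ), 0 < n → CoprimePair m n →
        (∃ j, ∃ t ∈ I j, ∀ i, (m i : ℝ) / (n : ℝ) = t * (b j i : ℝ)) →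
        AccPt (0 : ℝ) (𝓟 {ε : ℝ | HasLipschitzLagrangianPeriodicGraph (Fε ε) m n})) :
    ∃ c : ℝ, ∀ θ : Torus d, G θ = c := by
  obtain ⟨A, hAG, hAg, hAL, hAmap⟩ := exists_standardFamily hF hS hG hSε hFε hFε_cont h_int h_pos
    h_an
  obtain ⟨b, I, hI, hper⟩ := h_per
  have hacc : ∀ m n, IsAdmissible (fun j => b j) I m n →
      AccPt 0 (𝓟 (A.calibratedSet m n)) := by
    intro m n ⟨hn, hmn, hj⟩
    obtain ⟨ε₁, hε₁, hcal⟩ := A.exists_pos_mem_calibratedSet m hn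
    have hsmall : ∀ᶠ ε : ℝ in 𝓝 0, |ε| < ε₁ := by
      filter_upwards [Metric.ball_mem_nhds (0 : ℝ) hε₁] with ε hε
      simpa using hε
    rw [accPt_iff_frequently]
    refine ((accPt_iff_frequently.mp (hper m n hn hmn hj)).and_eventually hsmall).mono ?_
    rintro ε ⟨⟨hε0, hε⟩, hεs⟩
    exact ⟨hε0, hcal ε hεs (by rw [hAmap]; exact hε)⟩
  -- All admissible `(m, n)` are used here to gain analyticity of `G` from class `C²`; the
  -- continuation in `ε` is available only afterwards.
  have hGω : ContDiff ℝ ω A.G := by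
    rw [funext hAG]
    refine contDiff_omega_of_sum_eq b I (fun j => ⟨(hI j).1, (hI j).2.2⟩) hG.continuous ?_
    intro m n hmn q q'
    simp only [← hAG]
    exact A.sum_G_eq_of_accPt hmn.1 (hacc m n hmn) q q'
  have hgω : ContDiff ℝ ω A.g := by
    rw [hAg]
    exact hGω.gradient (by simp)
  -- A single admissible pair suffices for the conclusion; it exists because `d ≥ 1` and the open
  -- set contains a rational number.
  obtain ⟨t, ht⟩ := Rat.denseRange_cast.exists_mem_open (hI ⟨0, hd⟩).1 (hI ⟨0, hd⟩).2.2
  obtain ⟨m, n, hmn, -⟩ := exists_isAdmissible (b := fun j => b j) ht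
  obtain ⟨c, hc⟩ := A.G_eq_of_calibratedSet_eq_univ hmn.1
    (A.calibratedSet_eq_univ hAL hgω hmn.1 (hacc m n hmn))
  refine ⟨c, fun θ => ?_⟩
  obtain ⟨q, rfl⟩ := torusProj_surjective θ
  rw [← hAG, hc]
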